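/- **Theorem (Global consistency).** Let $X,Z$ be random vectors in $\mathbb R^d$ with supports $\mathcal X,\mathcal Z$, $\mathcal Z\subset\mathcal X$, and let $\phi:\mathbb R^d\to\mathbb R^m$ ($m\ge1$) be measurable. Assume that the laws $\nu_0$ of $\phi(X)$ and $\nu_1$ of $\phi(Z)$ have Lebesgue densities $f_0,f_1$ on $\mathbb R^m$, that $\nu_1\ll\nu_0$, and put $r=f_1/f_0$ (with $0/0=0$). Let $X_1,X_2,\dots$ be copies of $X$ and $Z_1,Z_2,\dots$ copies of $Z$ such that $X,X_1,X_2,\dots,Z_1,Z_2,\dots$ are jointly independent. For each $N_0$ let $N_1=N_1(N_0)$ and $M=M(N_0)$ be natural numbers, and let $\hat\phi$ be an estimator of $\phi$: a (jointly measurable) map $t\mapsto\hat\phi(t)\in\mathbb R^m$ that may depend on $X_1,\dots,X_{N_0},Z_1,\dots,Z_{N_1}$ and on the point $x$ at which the density ratio is estimated. Define $$A_\phi(x)=\{z\in\mathcal Z:\|\hat\phi(x)-\hat\phi(z)\|\le\hat\Phi_M(z)\},\qquad K_\phi(x)=\sum_{j=1}^{N_1}\mathbf 1(Z_j\in A_\phi(x)),\qquad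 \hat r_\phi(x)=\frac{N_0}{N_1}\frac{K_\phi(x)}{M},$$ where $\hat\Phi_M(z)$ is the $M$-th order statistic of $\{\|\hat\phi(X_i)-\hat\phi(z)\|\}_{i=1}^{N_0}$. Write $\|\cdot\|_\infty$ for the sup-norm over $\mathcal X$, and $\hat\phi_{z}$ for the estimator with $(Z_1,\dots,Z_p)$ replaced by $z\in\mathcal Z^p$. In the conditions (A) and (B) below the estimator is the one at the point $x=X$, and expectation and probability are over all the randomness (outer ones, if a supremum is not measurable). Let $p$ be an even positive integer. Assume that, as $N_0\to\infty$, $M\log N_0/N_0\to0$, $MN_1/N_0\to\infty$ and $M\to\infty$, and that (A) or (B) holds: (A) $\displaystyle\lim_{N_0\to\infty}\mathrm E\Big[\Big(\frac{N_0}{M}\Big)^p\sup_{z\in\mathcal Z^p}\|\hat\phi_{z}-\phi\|_\infty^{pm}\Big]=0$; (B) for every $\epsilon>0$ there are functions $T_\epsilon=T_{\epsilon,N_0}:(0,\infty)\to[0,\infty]$ such that for all $u>0$ $$\mathrm P\Big(\sup_{\delta\ge u}\delta^{-1}\sup_{s,t\in\mathcal X:\,\|\phi(s)-\phi(t)\|\le\delta}\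 \sup_{z\in\mathcal Z^p}\|(\hat\phi_{z}-\phi)(s)-(\hat\phi_{z}-\phi)(t)\|>\epsilon\Big)\le T_\epsilon(u),$$ with $\lim_{N_0\to\infty}(N_0/M)^k\int_0^\infty u^{k-1}T_\epsilon(u^{1/m})\,du=0$ for every $k\in\{1,\dots,p\}$, and $\lim_{N_0\to\infty}(N_0/M)^p\,\mathrm P(\|\hat\phi-\phi\|_\infty>\epsilon)=0$. Assume moreover that (i) $\mathcal X$ is compact and the surface areas of $\mathcal X$ and $\mathcal Z$ (the $(d-1)$-dimensional Hausdorff measures of their boundaries) are finite; the support of $\phi(X)$ is compact; (ii) $r\circ\phi$ is bounded on $\mathcal X$; (iii) $f_0$ is continuous on the support of $\phi(X)$ and $f_1$ is continuous on the support of $\phi(Z)$. Then $$\lim_{N_0\to\infty}\mathrm E\Big[\big|\hat r_\phi(X)-r(\phi(X))\big|^p\Big]=0 .$$ -/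

import Mathlib

open MeasureTheory ProbabilityTheory Filter Topology Set
open scoped ENNReal

/-- The Euclidean space `ℝᵏ`. -/
abbrev Euc (k : ℕ) : Type := EuclideanSpace ℝ (Fin k)

/-- The family consisting of `X`, of `X₁, X₂, …` and of `Z₁, Z₂, …`. -/
def twoSampleFamily {Ω : Type*} {d : ℕ} (X : Ω → Euc d) (Xs Zs : ℕ → Ω → Euc d) :
    Option (ℕ ⊕ ℕ) → Ω → Euc d
  | none => X
  | some (Sum.inl i) => Xs i
  | some (Sum.inr j) => Zs j

/-- Outer expectation: the infimum of the expectations of the measurable majorants. It is the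
usual expectation when the nonnegative function is measurable. -/
noncomputable def outerExpectation {Ω : Type*} [MeasurableSpace Ω] (μ : Measure Ω)
    (F : Ω → ℝ≥0∞) : ℝ≥0∞ :=
  ⨅ (G : Ω → ℝ≥0∞) (_ : Measurable G) (_ : F ≤ G), ∫⁻ ω, G ω ∂μ

theorem outerExpectation_eq_lintegral {Ω : Type*} [MeasurableSpace Ω] (μ : Measure Ω)
    (F : Ω → ℝ≥0∞) (hF : Measurable F) : outerExpectation μ F = ∫⁻ ω, F ω ∂μ := by
  apply le_antisymm
  · exact iInf_le_of_le F (iInf_le_of_le hF (iInf_le_of_le le_rfl le_rfl))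
  · exact le_iInf fun G => le_iInf fun _ => le_iInf fun h => lintegral_mono h

/-- The `M`-th order statistic (the `M`-th smallest value, `1 ≤ M ≤ N`) of `a₁, …, a_N`. -/
noncomputable def orderStat {N : ℕ} (M : ℕ) (a : Fin N → ℝ) : ℝ :=
  if h : M - 1 < N then a (Tuple.sort a ⟨M - 1, h⟩) else 0

/-- The catchment area of `x`: the points `z` of `SZ` for which `‖φ̂ x - φ̂ z‖` does not exceed the
`M`-th order statistic of the numbers `‖φ̂ (X i) - φ̂ z‖`. Here `ψ` stands for `φ̂`. -/
def catchment {d m N : ℕ} (SZ : Set (Euc d)) (M : ℕ) (ψ : Euc d → Euc m) (xs : Fin N → Euc d)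
    (x : Euc d) : Set (Euc d) :=
  {z | z ∈ SZ ∧ ‖ψ x - ψ z‖ ≤ orderStat M (fun i => ‖ψ (xs i) - ψ z‖)}

/-- The number of matched times of `x`. -/
noncomputable def matchCount {d m N N' : ℕ} (SZ : Set (Euc d)) (M : ℕ) (ψ : Euc d → Euc m)
    (xs : Fin N → Euc d) (zs : Fin N' → Euc d) (x : Euc d) : ℝ :=
  ∑ j, (catchment SZ M ψ xs x).indicator (fun _ => (1 : ℝ)) (zs j)

/-- The density ratio estimator `(N₀ / N₁) * (K x / M)`. -/
noncomputable def ratioEstimator {d m N N' : ℕ} (SZ : Set (Euc d)) (M : ℕ) (ψ : Euc d → Euc m)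
    (xs : Fin N → Euc d) (zs : Fin N' → Euc d) (x : Euc d) : ℝ :=
  ((N : ℝ) / (N' : ℝ)) * (matchCount SZ M ψ xs zs x / (M : ℝ))

/-- Replace the first `p` entries of `zs` by the entries of `z`. -/
def replaceFirst {α : Type*} {N p : ℕ} (zs : Fin N → α) (z : Fin p → α) : Fin N → α :=
  fun j => if h : (j : ℕ) < p then z ⟨j, h⟩ else zs j

/-- The sup-norm over `S` of `ψ - φ`. -/
noncomputable def supDist {d m : ℕ} (S : Set (Euc d)) (ψ φ : Euc d → Euc m) : ℝ≥0∞ :=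
  ⨆ t ∈ S, ‖ψ t - φ t‖ₑ

/-- An estimator of `φ : ℝᵈ → ℝᵐ` for each `N₀ = n`, with `N₁ = N₁ n`: a function of the sample
`X₁, …, X_{N₀}`, the sample `Z₁, …, Z_{N₁}` and a point `x`, whose value is a map `ℝᵈ → ℝᵐ`. -/
abbrev Estimator (d m : ℕ) (N₁ : ℕ → ℕ) : Type :=
  (n : ℕ) → (Fin n → Euc d) → (Fin (N₁ n) → Euc d) → Euc d → Euc d → Euc m

/-- The first approximation condition:
`E[(N₀ / M)ᵖ sup_{z ∈ SZᵖ} ‖φ̂_{(Z₁, …, Z_p) → z} - φ‖_∞^{p m}] → 0`, for the estimator at the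
random point `x = X`, with the expectation over the samples and `X`. -/
def SupNormCondition {Ω : Type*} [MeasurableSpace Ω] (μ : Measure Ω) {d m : ℕ} (p : ℕ)
    (SX SZ : Set (Euc d)) (φ : Euc d → Euc m) (M N₁ : ℕ → ℕ) (φhat : Estimator d m N₁)
    (X : Ω → Euc d) (Xs Zs : ℕ → Ω → Euc d) : Prop :=
  Tendsto (fun n : ℕ => outerExpectation μ (fun ω =>
    ENNReal.ofReal (((n : ℝ) / (M n : ℝ)) ^ p) *
      ⨆ (z : Fin p → Euc d) (_ : ∀ k, z k ∈ SZ),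
        supDist SX (φhat n (fun i => Xs i ω) (replaceFirst (fun j => Zs j ω) z) (X ω)) φ
          ^ (p * m)))
    atTop (𝓝 0)

/-- `sup_{δ ≥ u} δ⁻¹ sup_{s, t ∈ SX, ‖φ s - φ t‖ ≤ δ} sup_{z ∈ SZᵖ} ‖(ψ z - φ) s - (ψ z - φ) t‖`,
for a family `ψ z` of maps. -/
noncomputable def incrementModulus {d m p : ℕ} (SX SZ : Set (Euc d)) (φ : Euc d → Euc m)
    (ψ : (Fin p → Euc d) → Euc d → Euc m) (u : ℝ) : ℝ≥0∞ :=
  ⨆ (δ : ℝ) (_ : u ≤ δ), ENNReal.ofReal δ⁻¹ *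
    ⨆ (s ∈ SX) (t ∈ SX) (_ : ‖φ s - φ t‖ ≤ δ) (z : Fin p → Euc d) (_ : ∀ k, z k ∈ SZ),
      ‖(ψ z s - φ s) - (ψ z t - φ t)‖ₑ

/-- The second approximation condition: for each `ε > 0` the probability that the increment
modulus at `u` exceeds `ε` is at most `T ε n u`, where
`(N₀ / M)ᵏ ∫₀^∞ u^{k-1} T_ε(u^{1/m}) du → 0` for `1 ≤ k ≤ p`, and
`(N₀ / M)ᵖ P(‖φ̂ - φ‖_∞ > ε) → 0`. Again the estimator is the one at the random point `x = X`. -/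
def IncrementCondition {Ω : Type*} [MeasurableSpace Ω] (μ : Measure Ω) {d m : ℕ} (p : ℕ)
    (SX SZ : Set (Euc d)) (φ : Euc d → Euc m) (M N₁ : ℕ → ℕ) (φhat : Estimator d m N₁)
    (X : Ω → Euc d) (Xs Zs : ℕ → Ω → Euc d) : Prop :=
  (∃ T : ℝ → ℕ → ℝ → ℝ≥0∞,
    (∀ ε : ℝ, 0 < ε → ∀ n : ℕ, ∀ u : ℝ, 0 < u →
      μ {ω | ENNReal.ofReal ε < incrementModulus SX SZ φ
          (fun z : Fin p → Euc d =>
            φhat n (fun i => Xs i ω) (replaceFirst (fun j => Zs j ω) z) (X ω)) u} ≤ T ε n u) ∧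
    (∀ ε : ℝ, 0 < ε → ∀ k : ℕ, 1 ≤ k → k ≤ p →
      Tendsto (fun n : ℕ => ENNReal.ofReal (((n : ℝ) / (M n : ℝ)) ^ k) *
        ∫⁻ u in Ioi (0 : ℝ), ENNReal.ofReal (u ^ (k - 1)) * T ε n (u ^ (1 / (m : ℝ))))
        atTop (𝓝 0))) ∧
  (∀ ε : ℝ, 0 < ε →
    Tendsto (fun n : ℕ => ENNReal.ofReal (((n : ℝ) / (M n : ℝ)) ^ p) *
      μ {ω | ENNReal.ofReal ε <
        supDist SX (φhat n (fun i => Xs i ω) (fun j => Zs j ω) (X ω)) φ})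
      atTop (𝓝 0))

/-- The surface area of a subset of `ℝᵈ`: the `(d-1)`-dimensional Hausdorff measure of its
topological boundary. -/
noncomputable def surfaceArea {d : ℕ} (S : Set (Euc d)) : ℝ≥0∞ :=
  Measure.hausdorffMeasure ((d : ℝ) - 1) (frontier S)

/-! Put B = M N₁/N₀, so that the estimator is the matched count divided by B. If φ̂ were φ, a point
z would be matched to x exactly when fewer than M of the φ(X_i) are closer to φ(z) than φ(x) is. At
distance ρ that ball has ν₀-mass about f₀ V ρ^m, where V is the volume of the unit ball. The matched
z are therefore, up to few exceptions, those with φ(z) within R of φ(x), where f₀ V R^m = M/N₀.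
About N₁ f₁ V R^m = B r of the Z_j lie there. Chernoff bounds and Lebesgue differentiation make this
precise at almost every value of φ(X) (`tendsto_measure_outerCatch`, `tendsto_measure_innerCatch`).

The estimator φ̂ depends on all the data, so no independence is available once it appears. It is
removed pathwise. Unless a bad event occurs, its increments differ from those of φ by at most ε(‖φ s
− φ t‖ + u), and then the catchment area lies between two sets defined by φ alone. Their counts are
functions of independent samples. Each of (A) and (B) is used through a single consequence: with
u_i^m = 2^i M/N₀, the sum over i of 2^{pi} P(bad event at scale u_i) tends to 0
(`SupNormCondition.tendsto_tsum_badEvent`, `IncrementCondition.tendsto_tsum_badEvent`). The term i =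
0 gives convergence in probability.

For convergence in L^p the large values must be controlled. Cover ℝ^m by finitely many narrow cones
with vertex φ(x). If M sample points in a cone, outside the ball of radius u, are no farther out
than φ(z), then all of them are closer to z than x is, even as measured by φ̂, so z is not matched
(`matchCount_le_crudeCount`). Beyond radius u, only the part of each cone not preceded by M sample
points can contribute. Its ν₀-mass is of order M/N₀ with exponential tails, and boundedness of r
transfers this to ν₁. At scale u_i the normalised count thus exceeds A·2^i by an amount whose p-th
moment is exponentially small. Using the first scale that is not bad, the weights 2^{pi} pay for the
factors 2^i, and the excess of the estimator over A vanishes in L^p (`exists_excess_majorant`).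
Together with convergence in probability and boundedness of r this is enough
(`tendsto_lintegral_pow_of_excess`). -/

/-- The number of the points `w j` that lie in `S`. -/
noncomputable def hits {α : Type*} {N : ℕ} (S : Set α) (w : Fin N → α) : ℝ :=
  ∑ j, S.indicator (fun _ => (1 : ℝ)) (w j)

/-! ### Binomial counts: exponential moments and Chernoff bounds -/

section Hits

variable {α β γ : Type*} {N : ℕ}

theorem hits_nonneg (S : Set α) (w : Fin N → α) : 0 ≤ hits S w :=
  Finset.sum_nonneg fun _ _ => indicator_nonneg (fun _ _ => zero_le_one) _

theorem hits_mono {S : Set α} {S' : Set β} {w : Fin N → α} {w' : Fin N → β}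
    (h : ∀ j, w j ∈ S → w' j ∈ S') : hits S w ≤ hits S' w' := by
  refine Finset.sum_le_sum fun j _ => ?_
  by_cases hj : w j ∈ S
  · simp [hj, h j hj]
  · simp only [hj, not_false_eq_true, indicator_of_notMem]
    exact indicator_nonneg (fun _ _ => zero_le_one) _

theorem hits_le_add {S A B : Set α} (h : S ⊆ A ∪ B) (w : Fin N → α) :
    hits S w ≤ hits A w + hits B w := by
  unfold hits
  rw [← Finset.sum_add_distrib]
  refine Finset.sum_le_sum fun j _ => ?_
  have hA : 0 ≤ A.indicator (fun _ => (1 : ℝ)) (w j) := indicator_nonneg (fun _ _ => zero_le_one) _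
  have hB : 0 ≤ B.indicator (fun _ => (1 : ℝ)) (w j) := indicator_nonneg (fun _ _ => zero_le_one) _
  by_cases hj : w j ∈ S
  · rcases h hj with h1 | h1
    · simp only [hj, h1, indicator_of_mem] at *; linarith
    · simp only [hj, h1, indicator_of_mem] at *; linarith
  · simp only [hj, not_false_eq_true, indicator_of_notMem]; linarith

theorem hits_iUnion_le {κ : Type*} [Fintype κ] (S : κ → Set α) (w : Fin N → α) :
    hits (⋃ k, S k) w ≤ ∑ k, hits (S k) w := by
  unfold hits
  rw [Finset.sum_comm]
  refine Finset.sum_le_sum fun j _ => ?_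
  by_cases hj : w j ∈ ⋃ k, S k
  · obtain ⟨k, hk⟩ := mem_iUnion.1 hj
    rw [indicator_of_mem hj]
    refine le_trans (by rw [indicator_of_mem hk]) (Finset.single_le_sum
      (f := fun k => (S k).indicator (fun _ => (1 : ℝ)) (w j))
      (fun k _ => indicator_nonneg (fun _ _ => zero_le_one) _) (Finset.mem_univ k))
  · rw [indicator_of_notMem hj]
    exact Finset.sum_nonneg fun _ _ => indicator_nonneg (fun _ _ => zero_le_one) _

variable [MeasurableSpace α] [MeasurableSpace β] [MeasurableSpace γ]

theorem measurable_hits_param {S : Set (β × α)} (hS : MeasurableSet S) {b : γ → β}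
    (hb : Measurable b) {w : γ → Fin N → α} (hw : Measurable w) :
    Measurable fun g => hits {x | (b g, x) ∈ S} (w g) := by
  unfold hits
  refine Finset.measurable_sum _ fun j _ => ?_
  have h : Measurable fun g => S.indicator (fun _ => (1 : ℝ)) (b g, w g j) :=
    (measurable_const.indicator hS).comp (hb.prodMk ((measurable_pi_apply j).comp hw))
  exact h

theorem measurable_hits {S : Set α} (hS : MeasurableSet S) :
    Measurable fun w : Fin N → α => hits S w :=
  Finset.measurable_sum _ fun j _ =>
    (measurable_const.indicator hS).comp (measurable_pi_apply j)

variable (ν : Measure α) [IsProbabilityMeasure ν]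

theorem lintegral_hits {S : Set α} (hS : MeasurableSet S) :
    ∫⁻ w, ENNReal.ofReal (hits S w) ∂(Measure.pi fun _ : Fin N => ν) = N * ν S := by
  have h1 : ∀ w : Fin N → α, ENNReal.ofReal (hits S w)
      = ∑ j, S.indicator (fun _ => (1 : ℝ≥0∞)) (w j) := by
    intro w
    unfold hits
    rw [ENNReal.ofReal_sum_of_nonneg fun _ _ => indicator_nonneg (fun _ _ => zero_le_one) _]
    refine Finset.sum_congr rfl fun j _ => ?_
    by_cases hj : w j ∈ S <;> simp [hj]
  simp_rw [h1]
  have hm : Measurable (S.indicator (fun _ => (1 : ℝ≥0∞))) := measurable_const.indicator hS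
  rw [lintegral_finsetSum Finset.univ
    (f := fun (j : Fin N) (w : Fin N → α) => S.indicator (fun _ => (1 : ℝ≥0∞)) (w j))
    fun j _ => hm.comp (measurable_pi_apply j)]
  have h2 : ∀ j : Fin N, ∫⁻ w : Fin N → α, S.indicator (fun _ => (1 : ℝ≥0∞)) (w j)
      ∂(Measure.pi fun _ : Fin N => ν) = ν S := by
    intro j
    have := (measurePreserving_eval (fun _ : Fin N => ν) j).lintegral_comp hm
    simp only [Function.eval] at this
    rw [this, lintegral_indicator hS]
    simp
  simp [h2]

/-- By independence the exponential moment is a power of E exp(t(1_S − q)) = e^{−tq}(1 + q(e^t − 1))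
≤ exp(q(e^t − 1 − t)), and e^t − 1 − t ≤ t² for |t| ≤ 1. The exponent carries the mean N q rather
than N, which is essential since the sets of interest have mass of order M/N₀. -/
theorem lintegral_exp_hits_le {S : Set α} (hS : MeasurableSet S) {t : ℝ} (ht : |t| ≤ 1) :
    ∫⁻ w, ENNReal.ofReal (Real.exp (t * (hits S w - N * ν.real S)))
      ∂(Measure.pi fun _ : Fin N => ν) ≤ ENNReal.ofReal (Real.exp (N * ν.real S * t ^ 2)) := by
  set q := ν.real S
  have hq0 : 0 ≤ q := measureReal_nonneg
  set F : α → ℝ := fun x => Real.exp (t * (S.indicator (fun _ => (1 : ℝ)) x - q)) with hF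
  have hFm : Measurable F := by
    have : Measurable (S.indicator (fun _ => (1 : ℝ))) := measurable_const.indicator hS
    fun_prop
  have hprod : ∀ w : Fin N → α,
      Real.exp (t * (hits S w - N * q)) = ∏ j, F (w j) := by
    intro w
    rw [hF, ← Real.exp_sum, ← Finset.mul_sum, Finset.sum_sub_distrib]
    simp [hits]
  have hFeq : ∀ x, F x = Real.exp (-(t * q))
      + S.indicator (fun _ => Real.exp (-(t * q)) * (Real.exp t - 1)) x := by
    intro x
    by_cases hx : x ∈ S
    · simp only [hF, hx, indicator_of_mem]
      rw [mul_sub, mul_one, sub_eq_add_neg, Real.exp_add]; ring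
    · simp [hF, hx]
  have hFint : ∫ x, F x ∂ν = Real.exp (-(t * q)) * (1 + q * (Real.exp t - 1)) := by
    simp_rw [hFeq]
    rw [integral_add (integrable_const _) ((integrable_const _).indicator hS),
      integral_indicator hS]
    simp
    ring
  have hle : ∫ x, F x ∂ν ≤ Real.exp (q * t ^ 2) := by
    rw [hFint]
    have h1 : 1 + q * (Real.exp t - 1) ≤ Real.exp (q * (Real.exp t - 1)) := by
      linarith [Real.add_one_le_exp (q * (Real.exp t - 1))]
    have h2 := (abs_le.1 (Real.abs_exp_sub_one_sub_id_le ht)).2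
    calc _ ≤ Real.exp (-(t * q)) * Real.exp (q * (Real.exp t - 1)) := by gcongr
      _ = Real.exp (q * (Real.exp t - 1 - t)) := by rw [← Real.exp_add]; congr 1; ring
      _ ≤ _ := Real.exp_le_exp.2 (mul_le_mul_of_nonneg_left h2 hq0)
  have hF0 : ∀ x, 0 ≤ F x := fun x => (Real.exp_pos _).le
  have hFbdd : Integrable F ν := by
    have : F = fun x => _ := funext hFeq
    rw [this]
    exact (integrable_const _).add ((integrable_const _).indicator hS)
  simp_rw [hprod]
  rw [← ofReal_integral_eq_lintegral_ofReal]
  · apply ENNReal.ofReal_le_ofReal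
    rw [integral_fintype_prod_eq_pow]
    calc _ ≤ (Real.exp (q * t ^ 2)) ^ (Fintype.card (Fin N)) :=
          pow_le_pow_left₀ (integral_nonneg hF0) hle _
      _ = _ := by rw [← Real.exp_nat_mul]; simp [mul_assoc]
  · exact Integrable.fintype_prod fun _ => hFbdd
  · exact ae_of_all _ fun w => Finset.prod_nonneg fun j _ => hF0 _

theorem measure_hits_ge_le {S : Set α} (hS : MeasurableSet S) {t : ℝ} (ht0 : 0 ≤ t) (ht : t ≤ 1)
    (s : ℝ) : (Measure.pi fun _ : Fin N => ν) {w | N * ν.real S + s ≤ hits S w}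
      ≤ ENNReal.ofReal (Real.exp (N * ν.real S * t ^ 2 - t * s)) := by
  have hm := measurable_hits (N := N) hS
  have h1 := lintegral_exp_hits_le (N := N) ν hS (t := t) (by rwa [abs_of_nonneg ht0])
  calc _ ≤ ∫⁻ w, ENNReal.ofReal (Real.exp (-(t * s))) *
        ENNReal.ofReal (Real.exp (t * (hits S w - N * ν.real S)))
        ∂(Measure.pi fun _ : Fin N => ν) := by
        rw [← lintegral_indicator_one (measurableSet_le measurable_const hm)]
        refine lintegral_mono fun w => ?_
        by_cases hw : w ∈ {w | N * ν.real S + s ≤ hits S w}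
        · rw [indicator_of_mem hw, ← ENNReal.ofReal_mul (Real.exp_pos _).le, ← Real.exp_add,
            Pi.one_apply, ← ENNReal.ofReal_one]
          apply ENNReal.ofReal_le_ofReal
          rw [Real.one_le_exp_iff]
          have : N * ν.real S + s ≤ hits S w := hw
          nlinarith
        · rw [indicator_of_notMem hw]; exact zero_le
    _ ≤ _ := by
        rw [lintegral_const_mul _ (by fun_prop)]
        calc _ ≤ ENNReal.ofReal (Real.exp (-(t * s))) *
              ENNReal.ofReal (Real.exp (N * ν.real S * t ^ 2)) := by gcongr
          _ = _ := by
            rw [← ENNReal.ofReal_mul (Real.exp_pos _).le, ← Real.exp_add]; congr 2; ring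

theorem measure_hits_le_le {S : Set α} (hS : MeasurableSet S) {t : ℝ} (ht0 : 0 ≤ t) (ht : t ≤ 1)
    (s : ℝ) : (Measure.pi fun _ : Fin N => ν) {w | hits S w ≤ N * ν.real S - s}
      ≤ ENNReal.ofReal (Real.exp (N * ν.real S * t ^ 2 - t * s)) := by
  have hm := measurable_hits (N := N) hS
  have h1 := lintegral_exp_hits_le (N := N) ν hS (t := -t) (by rwa [abs_neg, abs_of_nonneg ht0])
  calc _ ≤ ∫⁻ w, ENNReal.ofReal (Real.exp (-(t * s))) *
        ENNReal.ofReal (Real.exp (-t * (hits S w - N * ν.real S)))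
        ∂(Measure.pi fun _ : Fin N => ν) := by
        rw [← lintegral_indicator_one (measurableSet_le hm measurable_const)]
        refine lintegral_mono fun w => ?_
        by_cases hw : w ∈ {w | hits S w ≤ N * ν.real S - s}
        · rw [indicator_of_mem hw, ← ENNReal.ofReal_mul (Real.exp_pos _).le, ← Real.exp_add,
            Pi.one_apply, ← ENNReal.ofReal_one]
          apply ENNReal.ofReal_le_ofReal
          rw [Real.one_le_exp_iff]
          have : hits S w ≤ N * ν.real S - s := hw
          nlinarith
        · rw [indicator_of_notMem hw]; exact zero_le
    _ ≤ _ := by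
        rw [lintegral_const_mul _ (by fun_prop)]
        calc _ ≤ ENNReal.ofReal (Real.exp (-(t * s))) *
              ENNReal.ofReal (Real.exp (N * ν.real S * (-t) ^ 2)) := by gcongr
          _ = _ := by
            rw [← ENNReal.ofReal_mul (Real.exp_pos _).le, ← Real.exp_add]; congr 2; ring

theorem measure_hits_lt_le {S : Set α} (hS : MeasurableSet S) {η : ℝ} (hη0 : 0 ≤ η) (hη : η ≤ 1)
    {M : ℝ} (hM : M ≤ (1 - η) * (N * ν.real S)) :
    (Measure.pi fun _ : Fin N => ν) {w | hits S w < M}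
      ≤ ENNReal.ofReal (Real.exp (-(η ^ 2 / 4 * (N * ν.real S)))) := by
  -- With c the mean, the exponent c t² − t η c is smallest at t = η/2, where it is −η² c/4.
  refine le_trans (measure_mono ?_) ((measure_hits_le_le (N := N) ν hS (t := η / 2) (by linarith)
    (by linarith) (η * (N * ν.real S))).trans ?_)
  · intro w hw
    have : hits S w < M := hw
    change hits S w ≤ N * ν.real S - η * (N * ν.real S)
    linarith
  · apply ENNReal.ofReal_le_ofReal
    rw [Real.exp_le_exp]; nlinarith

theorem max_zero_pow_le_exp {p : ℕ} (hp : 0 < p) (x : ℝ) :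
    max 0 x ^ p ≤ p.factorial * Real.exp x := by
  rcases le_total 0 x with h | h
  · rw [max_eq_right h]
    have := Real.pow_div_factorial_le_exp x h p
    rwa [div_le_iff₀ (by positivity), mul_comm] at this
  · rw [max_eq_left h]
    rw [zero_pow hp.ne']; positivity

/-- Use x₊^p ≤ p! e^x and the exponential moment at t = 1. That moment costs e^c with c the mean;
subtracting twice the mean instead of once absorbs it and leaves e^{−b}, uniformly in N and S. -/
theorem lintegral_hits_excess_le {S : Set α} (hS : MeasurableSet S) {p : ℕ} (hp : 0 < p) (b : ℝ) :
    ∫⁻ w, ENNReal.ofReal (max 0 (hits S w - 2 * (N * ν.real S) - b) ^ p)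
      ∂(Measure.pi fun _ : Fin N => ν) ≤ ENNReal.ofReal (p.factorial * Real.exp (-b)) := by
  have hm := measurable_hits (N := N) hS
  have h1 := lintegral_exp_hits_le (N := N) ν hS (t := 1) (by simp)
  set c := N * ν.real S
  calc _ ≤ ∫⁻ w, ENNReal.ofReal (p.factorial * Real.exp (-c - b)) *
        ENNReal.ofReal (Real.exp (1 * (hits S w - c))) ∂(Measure.pi fun _ : Fin N => ν) := by
        refine lintegral_mono fun w => ?_
        rw [← ENNReal.ofReal_mul (by positivity), mul_assoc, ← Real.exp_add]
        apply ENNReal.ofReal_le_ofReal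
        refine (max_zero_pow_le_exp hp _).trans (le_of_eq ?_)
        congr 2; ring
    _ ≤ _ := by
        rw [lintegral_const_mul _ (by fun_prop)]
        calc _ ≤ ENNReal.ofReal (p.factorial * Real.exp (-c - b)) *
              ENNReal.ofReal (Real.exp (c * 1 ^ 2)) := by gcongr
          _ = _ := by
            rw [← ENNReal.ofReal_mul (by positivity), mul_assoc, ← Real.exp_add]; congr 3; ring

end Hits

/-- R is the infimum of the points where the distribution function reaches τ. Continuity from the
right gives the first inequality and the left limit gives the second. Atoms are allowed, hence the
two different half-lines. -/
theorem exists_quantile (ρ : Measure ℝ) [IsFiniteMeasure ρ] {τ : ℝ} (hτ : 0 < τ)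
    (hτ' : τ < ρ.real univ) : ∃ R, τ ≤ ρ.real (Iic R) ∧ ρ.real (Iio R) ≤ τ := by
  set S : Set ℝ := {R | τ ≤ ρ.real (Iic R)} with hS
  have hcont := ENNReal.continuousAt_toReal (measure_ne_top ρ univ)
  have h1 : Tendsto (fun x => ρ.real (Iic x)) atTop (𝓝 (ρ.real univ)) :=
    hcont.tendsto.comp (tendsto_measure_Iic_atTop ρ)
  have h2 : Tendsto (fun k : ℕ => ρ.real (Iic (-(k : ℝ)))) atTop (𝓝 0) := by
    have hI : ⋂ k : ℕ, Iic (-(k : ℝ)) = ∅ := by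
      refine eq_empty_of_forall_notMem fun x hx => ?_
      obtain ⟨k, hk⟩ := exists_nat_gt (-x)
      have : x ≤ -(k : ℝ) := mem_iInter.1 hx k
      linarith
    have h := tendsto_measure_iInter_atTop (μ := ρ) (s := fun k : ℕ => Iic (-(k : ℝ)))
      (fun _ => measurableSet_Iic.nullMeasurableSet)
      (fun i j hij => Iic_subset_Iic.2 (neg_le_neg (Nat.cast_le.2 hij))) ⟨0, measure_ne_top _ _⟩
    rw [hI, measure_empty] at h
    exact (ENNReal.continuousAt_toReal ENNReal.zero_ne_top).tendsto.comp h
  have hne : S.Nonempty := by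
    obtain ⟨R, hR⟩ := (h1.eventually (lt_mem_nhds hτ')).exists
    exact ⟨R, hR.le⟩
  obtain ⟨b, hb⟩ := (h2.eventually (gt_mem_nhds hτ)).exists
  have hbdd : BddBelow S := by
    refine ⟨-(b : ℝ), fun R hR => ?_⟩
    by_contra h
    have hR' : τ ≤ ρ.real (Iic R) := hR
    have := measureReal_mono (μ := ρ) (Iic_subset_Iic.2 (not_le.1 h).le)
    linarith
  refine ⟨sInf S, ?_, ?_⟩
  · obtain ⟨u, hu, hgt, hlim⟩ := exists_seq_strictAnti_tendsto (sInf S)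
    have hI : Iic (sInf S) = ⋂ k, Iic (u k) := by
      ext x
      simp only [mem_Iic, mem_iInter]
      exact ⟨fun h k => h.trans (hgt k).le, fun h => ge_of_tendsto' hlim h⟩
    have hT : Tendsto (fun k => ρ.real (Iic (u k))) atTop (𝓝 (ρ.real (Iic (sInf S)))) := by
      rw [hI]
      refine (ENNReal.continuousAt_toReal (measure_ne_top _ _)).tendsto.comp
        (tendsto_measure_iInter_atTop (fun _ => measurableSet_Iic.nullMeasurableSet)
          (fun i j hij => Iic_subset_Iic.2 (hu.antitone hij)) ⟨0, measure_ne_top _ _⟩)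
    refine ge_of_tendsto' hT fun k => ?_
    obtain ⟨s, hs, hlt⟩ := exists_lt_of_csInf_lt hne (hgt k)
    exact le_trans hs (measureReal_mono (Iic_subset_Iic.2 hlt.le))
  · obtain ⟨u, hu, hlt, hlim⟩ := exists_seq_strictMono_tendsto (sInf S)
    have hU : Iio (sInf S) = ⋃ k, Iic (u k) := by
      ext x
      simp only [mem_Iio, mem_iUnion, mem_Iic]
      refine ⟨fun h => ?_, fun ⟨k, hk⟩ => hk.trans_lt (hlt k)⟩
      obtain ⟨k, hk⟩ := (hlim.eventually (lt_mem_nhds h)).exists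
      exact ⟨k, hk.le⟩
    have hT : Tendsto (fun k => ρ.real (Iic (u k))) atTop (𝓝 (ρ.real (Iio (sInf S)))) := by
      rw [hU]
      exact (ENNReal.continuousAt_toReal (measure_ne_top _ _)).tendsto.comp
        (tendsto_measure_iUnion_atTop fun i j hij => Iic_subset_Iic.2 (hu.monotone hij))
    refine le_of_tendsto' hT fun k => ?_
    by_contra h
    exact absurd (csInf_le hbdd (show u k ∈ S from (not_le.1 h).le)) (not_le.2 (hlt k))

/-! ### Mass of the region not preceded by M sample points -/

/-- The points `w` of `C` such that fewer than `M` of the points `ys i` of `C` are at most as far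
out as `w`, as measured by `g`. -/
def sparsePart {α : Type*} {n : ℕ} (C : Set α) (g : α → ℝ) (M : ℝ) (ys : Fin n → α) : Set α :=
  {w | w ∈ C ∧ hits {x | x ∈ C ∧ g x ≤ g w} ys < M}

section SparsePart

variable {α : Type*} [MeasurableSpace α] {n : ℕ} {C : Set α} {g : α → ℝ}

theorem measurableSet_sparsePart_prod (hC : MeasurableSet C) (hg : Measurable g) (M : ℝ) :
    MeasurableSet {q : (Fin n → α) × α | q.2 ∈ sparsePart C g M q.1} := by
  have hS : MeasurableSet {q : α × α | q.2 ∈ C ∧ g q.2 ≤ g q.1} :=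
    (measurable_snd hC).inter (measurableSet_le (hg.comp measurable_snd) (hg.comp measurable_fst))
  have := measurable_hits_param hS (γ := (Fin n → α) × α) (b := fun q => q.2) measurable_snd
    (w := fun q => q.1) measurable_fst
  exact (measurable_snd hC).inter (measurableSet_lt this measurable_const)

theorem measurableSet_sparsePart (hC : MeasurableSet C) (hg : Measurable g) (M : ℝ)
    (ys : Fin n → α) : MeasurableSet (sparsePart C g M ys) :=
  measurable_prodMk_left (measurableSet_sparsePart_prod hC hg M)

variable (ν : Measure α) [IsProbabilityMeasure ν]

theorem measurable_measure_sparsePart (hC : MeasurableSet C) (hg : Measurable g) (M : ℝ) :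
    Measurable fun ys : Fin n → α => ν.real (sparsePart C g M ys) :=
  (measurable_measure_prodMk_left (measurableSet_sparsePart_prod hC hg M)).ennreal_toReal

/-- Let R be the τ-quantile of g under ν restricted to C. Once M sample points fall into C ∩ {g ≤
R}, every w in C with g(w) ≥ R is preceded by M points, so the sparse part lies in C ∩ {g < R}, of
mass at most τ. Since the expected number there is at least nτ ≥ 2M, having fewer than M is a
Chernoff event with η = 1/2. -/
theorem measure_sparsePart_gt_le (hC : MeasurableSet C) (hg : Measurable g) {M τ : ℝ}
    (hτ : 0 < τ) (hM : 2 * M ≤ n * τ) :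
    (Measure.pi fun _ : Fin n => ν) {ys | τ < ν.real (sparsePart C g M ys)}
      ≤ ENNReal.ofReal (Real.exp (-(n * τ / 16))) := by
  rcases le_or_gt (ν.real C) τ with hle | hlt
  · have : {ys : Fin n → α | τ < ν.real (sparsePart C g M ys)} = ∅ := by
      refine eq_empty_of_forall_notMem fun ys hys => absurd hys (not_lt.2 (le_trans ?_ hle))
      exact measureReal_mono fun w hw => hw.1
    simp [this]
  have hmap : ∀ {A : Set ℝ}, MeasurableSet A →
      ((ν.restrict C).map g).real A = ν.real (C ∩ g ⁻¹' A) := by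
    intro A hA
    rw [map_measureReal_apply hg hA, measureReal_restrict_apply (hg hA), inter_comm]
  obtain ⟨R, hR1, hR2⟩ := exists_quantile ((ν.restrict C).map g) hτ (by
    rw [hmap MeasurableSet.univ]; simpa using hlt)
  rw [hmap measurableSet_Iic] at hR1
  rw [hmap measurableSet_Iio] at hR2
  have hS : MeasurableSet (C ∩ g ⁻¹' Iic R) := hC.inter (hg measurableSet_Iic)
  have hnτ : n * τ ≤ n * ν.real (C ∩ g ⁻¹' Iic R) := by gcongr
  refine (measure_mono ?_).trans ((measure_hits_lt_le (N := n) ν hS (η := 1 / 2) (by norm_num)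
    (by norm_num) (M := M) (by linarith)).trans ?_)
  · intro ys hys
    by_contra hcon
    have hcon' : M ≤ hits (C ∩ g ⁻¹' Iic R) ys := not_lt.1 hcon
    refine absurd hys (not_lt.2 (le_trans (measureReal_mono ?_) hR2))
    rintro w ⟨hwC, hw⟩
    refine ⟨hwC, ?_⟩
    by_contra hge
    have hge' : R ≤ g w := not_lt.1 hge
    refine absurd (hcon'.trans (hits_mono fun j hj => ?_)) (not_le.2 hw)
    exact ⟨hj.1, le_trans hj.2 hge'⟩
  · apply ENNReal.ofReal_le_ofReal
    rw [Real.exp_le_exp]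
    linarith

/-- Cut the excess into unit layers and sum (l + 1)^p exp(−(b + l)/16). The constant depends on p
only, so it serves all sample sizes, vertices and cones at once. -/
theorem lintegral_sparsePart_excess_le {p : ℕ} (hp : 0 < p) :
    ∃ K : ℝ, 0 ≤ K ∧ ∀ {α : Type*} [MeasurableSpace α] {n : ℕ} {C : Set α} {g : α → ℝ}
      (ν : Measure α) [IsProbabilityMeasure ν], MeasurableSet C → Measurable g → 0 < n →
      ∀ {M b : ℝ}, 0 < b → 2 * M ≤ b →
      ∫⁻ ys, ENNReal.ofReal (max 0 (n * ν.real (sparsePart C g M ys) - b) ^ p)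
        ∂(Measure.pi fun _ : Fin n => ν) ≤ ENNReal.ofReal (K * Real.exp (-(b / 16))) := by
  have hsum : Summable fun l : ℕ => ((l : ℝ) + 1) ^ p * Real.exp (-(l / 16)) := by
    have h := summable_pow_mul_geometric_of_norm_lt_one p (r := Real.exp (-(1 / 16)))
      (by rw [Real.norm_of_nonneg (Real.exp_pos _).le]; exact Real.exp_lt_one_iff.2 (by norm_num))
    have h2 := ((summable_nat_add_iff 1).2 h).mul_left (Real.exp (1 / 16))
    refine h2.congr fun l => ?_
    rw [← Real.exp_nat_mul, mul_left_comm, ← Real.exp_add]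
    push_cast
    congr 2; ring
  refine ⟨∑' l : ℕ, ((l : ℝ) + 1) ^ p * Real.exp (-(l / 16)),
    tsum_nonneg fun l => by positivity, ?_⟩
  intro α _ n C g ν _ hC hg hn M b hb hM
  have hn' : (0 : ℝ) < n := by exact_mod_cast hn
  have hm := measurable_measure_sparsePart (n := n) ν hC hg M
  calc _ ≤ ∫⁻ ys, ∑' l : ℕ, ENNReal.ofReal (((l : ℝ) + 1) ^ p) *
        {ys : Fin n → α | (b + l) / n < ν.real (sparsePart C g M ys)}.indicator 1 ys
        ∂(Measure.pi fun _ : Fin n => ν) := by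
        refine lintegral_mono fun ys => ?_
        set x := n * ν.real (sparsePart C g M ys) - b
        rcases le_or_gt x 0 with hx | hx
        · change ENNReal.ofReal (max 0 x ^ p) ≤ _
          rw [max_eq_left hx, zero_pow hp.ne']; simp
        · obtain ⟨l, hl⟩ : ∃ l : ℕ, ⌈x⌉₊ = l + 1 :=
            Nat.exists_eq_succ_of_ne_zero (Nat.ceil_pos.2 hx).ne'
          have h1 : x ≤ l + 1 := by
            have := Nat.le_ceil x; rw [hl] at this; exact_mod_cast this
          have h2 : (l : ℝ) < x := Nat.lt_ceil.1 (by omega)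
          refine le_trans ?_ (ENNReal.le_tsum l)
          rw [indicator_of_mem, Pi.one_apply, mul_one]
          · apply ENNReal.ofReal_le_ofReal
            rw [max_eq_right hx.le]
            gcongr
          · change (b + l) / n < ν.real (sparsePart C g M ys)
            rw [div_lt_iff₀ hn', mul_comm _ (n : ℝ)]; linarith
    _ = ∑' l : ℕ, ENNReal.ofReal (((l : ℝ) + 1) ^ p) * (Measure.pi fun _ : Fin n => ν)
        {ys : Fin n → α | (b + l) / n < ν.real (sparsePart C g M ys)} := by
        have hms : ∀ l : ℕ, MeasurableSet
            {ys : Fin n → α | (b + l) / n < ν.real (sparsePart C g M ys)} :=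
          fun l => measurableSet_lt measurable_const hm
        rw [lintegral_tsum fun l => ((measurable_one.indicator (hms l)).const_mul _).aemeasurable]
        refine tsum_congr fun l => ?_
        rw [lintegral_const_mul _ (measurable_one.indicator (hms l)),
          lintegral_indicator_one (hms l)]
    _ ≤ ∑' l : ℕ, ENNReal.ofReal (((l : ℝ) + 1) ^ p * Real.exp (-(l / 16)) *
        Real.exp (-(b / 16))) := by
        refine ENNReal.tsum_le_tsum fun l => ?_
        rw [mul_assoc, ENNReal.ofReal_mul (by positivity)]
        gcongr
        have hbl : (n : ℝ) * ((b + l) / n) = b + l := by field_simp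
        refine (measure_sparsePart_gt_le (n := n) ν hC hg (M := M) (τ := (b + l) / n)
          (by positivity) (by rw [hbl]; linarith [(Nat.cast_nonneg l : (0 : ℝ) ≤ l)])).trans
          (le_of_eq ?_)
        rw [hbl, ← Real.exp_add]
        congr 2; ring
    _ = _ := by
        rw [← ENNReal.ofReal_tsum_of_nonneg (fun l => by positivity) (hsum.mul_right _),
          tsum_mul_right]

end SparsePart

/-! ### Cones and the crude bound on the matched count -/

theorem add_pow_le_two_pow_mul {a b : ℝ} (ha : 0 ≤ a) (hb : 0 ≤ b) (p : ℕ) :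
    (a + b) ^ p ≤ 2 ^ p * (a ^ p + b ^ p) := by
  rcases le_total a b with h | h
  · calc (a + b) ^ p ≤ (2 * b) ^ p := pow_le_pow_left₀ (by positivity) (by linarith) p
      _ ≤ _ := by rw [mul_pow]; gcongr; linarith [pow_nonneg ha p]
  · calc (a + b) ^ p ≤ (2 * a) ^ p := pow_le_pow_left₀ (by positivity) (by linarith) p
      _ ≤ _ := by rw [mul_pow]; gcongr; linarith [pow_nonneg hb p]

theorem sum_pow_le_card_pow_mul {ι : Type*} (s : Finset ι) {f : ι → ℝ} (hf : ∀ i ∈ s, 0 ≤ f i)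
    {p : ℕ} (hp : 0 < p) : (∑ i ∈ s, f i) ^ p ≤ (s.card : ℝ) ^ p * ∑ i ∈ s, f i ^ p := by
  rcases s.eq_empty_or_nonempty with rfl | hs
  · simp [hp.ne']
  obtain ⟨i, hi, hmax⟩ := s.exists_max_image f hs
  calc (∑ j ∈ s, f j) ^ p ≤ (s.card * f i) ^ p := by
        refine pow_le_pow_left₀ (Finset.sum_nonneg hf) ?_ p
        simpa using Finset.sum_le_card_nsmul s f (f i) hmax
    _ = (s.card : ℝ) ^ p * f i ^ p := mul_pow _ _ _
    _ ≤ _ := by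
        gcongr
        exact Finset.single_le_sum (f := fun i => f i ^ p) (fun j hj => pow_nonneg (hf j hj) p) hi

/-- The points of the narrow cone with vertex `y` and direction `e` at distance at least `u`. -/
def coneAt {m : ℕ} (y e : Euc m) (u : ℝ) : Set (Euc m) :=
  {w | u ≤ ‖w - y‖ ∧ ‖(w - y) - ‖w - y‖ • e‖ ≤ ‖w - y‖ / 4}

theorem exists_cone_net (m : ℕ) : ∃ es : Finset (Euc m), ∀ v : Euc m,
    ∃ e ∈ es, v ≠ 0 → ‖v - ‖v‖ • e‖ ≤ ‖v‖ / 4 := by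
  obtain ⟨t, -, htf, hcov⟩ := finite_cover_balls_of_compact (isCompact_sphere (0 : Euc m) 1)
    (e := 1 / 4) (by norm_num)
  classical
  -- The element 0 only supplies some member of the set for v = 0; the directions come from a
  -- 1/4-net of the unit sphere.
  refine ⟨insert 0 htf.toFinset, fun v => ?_⟩
  by_cases hv : v = 0
  · exact ⟨0, Finset.mem_insert_self _ _, fun h => absurd hv h⟩
  have hv' : 0 < ‖v‖ := norm_pos_iff.2 hv
  have hmem : ‖v‖⁻¹ • v ∈ Metric.sphere (0 : Euc m) 1 := by
    simp [norm_smul, hv'.ne']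
  obtain ⟨e, he, hb⟩ := mem_iUnion₂.1 (hcov hmem)
  refine ⟨e, Finset.mem_insert_of_mem (htf.mem_toFinset.2 he), fun _ => ?_⟩
  have h1 : v - ‖v‖ • e = ‖v‖ • (‖v‖⁻¹ • v - e) := by
    rw [smul_sub, smul_smul, mul_inv_cancel₀ hv'.ne', one_smul]
  rw [h1, norm_smul, norm_norm]
  have h2 : ‖‖v‖⁻¹ • v - e‖ < 1 / 4 := by simpa [dist_eq_norm] using hb
  nlinarith

theorem measurableSet_coneAt_prod {m : ℕ} (e : Euc m) (u : ℝ) :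
    MeasurableSet {q : Euc m × Euc m | q.2 ∈ coneAt q.1 e u} := by
  refine (measurableSet_le (f := fun _ => u) (g := fun q : Euc m × Euc m => ‖q.2 - q.1‖)
    (by fun_prop) (by fun_prop)).inter (measurableSet_le
    (f := fun q : Euc m × Euc m => ‖(q.2 - q.1) - ‖q.2 - q.1‖ • e‖)
    (g := fun q => ‖q.2 - q.1‖ / 4) (by fun_prop) (by fun_prop))

theorem measurableSet_coneAt {m : ℕ} (y e : Euc m) (u : ℝ) : MeasurableSet (coneAt y e u) :=
  measurable_prodMk_left (measurableSet_coneAt_prod e u)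

/-- An upper bound for the number of matched times: all points of the ball of radius `u`, and for
each cone the points that are not preceded by `M` points of the first sample in that cone. -/
noncomputable def crudeCount {m n N : ℕ} (es : Finset (Euc m)) (M u : ℝ) (y : Euc m)
    (ys : Fin n → Euc m) (ws : Fin N → Euc m) : ℝ :=
  hits (Metric.closedBall y u) ws
    + ∑ e ∈ es, hits (sparsePart (coneAt y e u) (fun w => ‖w - y‖) M ys) ws

theorem measurable_crudeCount {m n N : ℕ} (es : Finset (Euc m)) (M u : ℝ) :
    Measurable fun q : Euc m × (Fin n → Euc m) × (Fin N → Euc m) =>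
      crudeCount es M u q.1 q.2.1 q.2.2 := by
  refine Measurable.add ?_ (Finset.measurable_sum _ fun e _ => ?_)
  · have hS : MeasurableSet {q : Euc m × Euc m | dist q.2 q.1 ≤ u} :=
      measurableSet_le (by fun_prop) measurable_const
    exact measurable_hits_param hS (b := fun q : Euc m × (Fin n → Euc m) × (Fin N → Euc m) => q.1)
      measurable_fst (w := fun q => q.2.2) (by fun_prop)
  · have hP : MeasurableSet {q : (Euc m × Euc m) × Euc m |
        q.2 ∈ coneAt q.1.1 e u ∧ ‖q.2 - q.1.1‖ ≤ ‖q.1.2 - q.1.1‖} := by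
      have h1 : MeasurableSet {q : (Euc m × Euc m) × Euc m | ‖q.2 - q.1.1‖ ≤ ‖q.1.2 - q.1.1‖} :=
        measurableSet_le (by fun_prop) (by fun_prop)
      exact ((show Measurable fun q : (Euc m × Euc m) × Euc m => (q.1.1, q.2) by fun_prop)
        (measurableSet_coneAt_prod e u)).inter h1
    have hS : MeasurableSet {q : (Euc m × (Fin n → Euc m)) × Euc m |
        q.2 ∈ sparsePart (coneAt q.1.1 e u) (fun w => ‖w - q.1.1‖) M q.1.2} := by
      have h1 := measurable_hits_param hP
        (b := fun q : (Euc m × (Fin n → Euc m)) × Euc m => (q.1.1, q.2)) (by fun_prop)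
        (w := fun q => q.1.2) (by fun_prop)
      exact ((show Measurable fun q : (Euc m × (Fin n → Euc m)) × Euc m => (q.1.1, q.2) by
        fun_prop) (measurableSet_coneAt_prod e u)).inter (h1 measurableSet_Iio)
    exact measurable_hits_param hS
      (b := fun q : Euc m × (Fin n → Euc m) × (Fin N → Euc m) => (q.1, q.2.1)) (by fun_prop)
      (w := fun q => q.2.2) (by fun_prop)

/-- Every count is at most twice its mean, plus cB, plus an excess. For the ball, twice the mean is
at most 2DcB. For a cone, ν₁ ≤ Cν₀ and nν₀(sparse part) ≤ 2cM + excess bound it by 4CcB plus a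
multiple of the second excess. Dividing by B gives the constants 2D + 1 and 4C + 1. In the
application c = 2^i is the scale, with u^m = cM/n. -/
theorem crudeCount_excess_le {m n N : ℕ} (es : Finset (Euc m)) {M u B C D c : ℝ} (hM : 1 ≤ M)
    (hB : 1 ≤ B) (hBdef : B = M * N / n) (hn : 0 < n) (hC : 0 ≤ C) {y : Euc m}
    {ys : Fin n → Euc m} (ws : Fin N → Euc m) {ν₀ ν₁ : Measure (Euc m)}
    (hν : ∀ S, ν₁.real S ≤ C * ν₀.real S)
    (hball : ν₁.real (Metric.closedBall y u) ≤ D * (c * (M / n))) :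
    max 0 ((n : ℝ) / N * (crudeCount es M u y ys ws / M)
        - ((2 * D + 1) + es.card * (4 * C + 1)) * c) ≤
      max 0 (hits (Metric.closedBall y u) ws - 2 * (N * ν₁.real (Metric.closedBall y u)) - c * B)
      + ∑ e ∈ es, (max 0 (hits (sparsePart (coneAt y e u) (fun w => ‖w - y‖) M ys) ws
          - 2 * (N * ν₁.real (sparsePart (coneAt y e u) (fun w => ‖w - y‖) M ys)) - c * B)
        + 2 * C * max 0 (n * ν₀.real (sparsePart (coneAt y e u) (fun w => ‖w - y‖) M ys)
          - 2 * c * M)) := by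
  have hn' : (0 : ℝ) < n := by exact_mod_cast hn
  have hB0 : 0 < B := by linarith
  have hM0 : 0 < M := by linarith
  have hN : (0 : ℝ) < N := by
    rw [hBdef] at hB0
    have : 0 < M * N := by
      have := mul_pos hB0 hn'
      rwa [div_mul_cancel₀ _ hn'.ne'] at this
    exact pos_of_mul_pos_right this hM0.le
  have hscale : ∀ x : ℝ, (n : ℝ) / N * (x / M) = x / B := by
    intro x; rw [hBdef]; field_simp
  have hNB : (N : ℝ) = B * n / M := by rw [hBdef]; field_simp
  set ξ := max 0 (hits (Metric.closedBall y u) ws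
    - 2 * (N * ν₁.real (Metric.closedBall y u)) - c * B)
  set T : Euc m → Set (Euc m) := fun e => sparsePart (coneAt y e u) (fun w => ‖w - y‖) M ys
  set η : Euc m → ℝ := fun e => max 0 (hits (T e) ws - 2 * (N * ν₁.real (T e)) - c * B)
  set ζ : Euc m → ℝ := fun e => max 0 (n * ν₀.real (T e) - 2 * c * M)
  have hdiv : ∀ x : ℝ, 0 ≤ x → x / B ≤ x := fun x hx => div_le_self hx hB
  have h0 : hits (Metric.closedBall y u) ws / B ≤ (2 * D + 1) * c + ξ := by
    have h1 : hits (Metric.closedBall y u) ws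
        ≤ 2 * (N * ν₁.real (Metric.closedBall y u)) + c * B + ξ := by
      have := le_max_right 0 (hits (Metric.closedBall y u) ws
        - 2 * (N * ν₁.real (Metric.closedBall y u)) - c * B)
      linarith
    have h2 : N * ν₁.real (Metric.closedBall y u) ≤ D * c * B := by
      calc _ ≤ N * (D * (c * (M / n))) := by gcongr
        _ = _ := by rw [hBdef]; field_simp
    rw [div_le_iff₀ hB0]
    have h3 : ξ ≤ ξ * B := le_mul_of_one_le_right (le_max_left _ _) hB
    nlinarith
  have he : ∀ e, hits (T e) ws / B ≤ (4 * C + 1) * c + (η e + 2 * C * ζ e) := by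
    intro e
    have h1 : hits (T e) ws ≤ 2 * (N * ν₁.real (T e)) + c * B + η e := by
      have := le_max_right 0 (hits (T e) ws - 2 * (N * ν₁.real (T e)) - c * B)
      change _ ≤ η e at this
      linarith
    have h2 : n * ν₀.real (T e) ≤ 2 * c * M + ζ e := by
      have := le_max_right 0 (n * ν₀.real (T e) - 2 * c * M)
      change _ ≤ ζ e at this
      linarith
    have hζ : 0 ≤ ζ e := le_max_left _ _
    have hη : 0 ≤ η e := le_max_left _ _
    have h4 : N * ν₁.real (T e) ≤ C * B * (2 * c + ζ e) := by
      calc N * ν₁.real (T e) ≤ N * (C * ν₀.real (T e)) := by gcongr; exact hν _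
        _ = C * (B / M) * (n * ν₀.real (T e)) := by rw [hNB]; ring
        _ ≤ C * (B / M) * (2 * c * M + ζ e) := by gcongr
        _ = C * B * (2 * c + ζ e / M) := by field_simp
        _ ≤ _ := by gcongr; exact div_le_self hζ hM
    rw [div_le_iff₀ hB0]
    have h3 : η e ≤ η e * B := le_mul_of_one_le_right hη hB
    nlinarith
  refine max_le (add_nonneg (le_max_left _ _) (Finset.sum_nonneg fun e _ =>
    add_nonneg (le_max_left _ _) (mul_nonneg (by positivity) (le_max_left _ _)))) ?_
  rw [hscale]
  have hsum := Finset.sum_le_sum fun e (_ : e ∈ es) => he e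
  rw [Finset.sum_add_distrib, Finset.sum_const, nsmul_eq_mul, ← Finset.sum_div] at hsum
  have : crudeCount es M u y ys ws / B = hits (Metric.closedBall y u) ws / B
      + (∑ e ∈ es, hits (T e) ws) / B := by
    rw [← add_div]; rfl
  rw [this]
  linarith

/-- Integrate over the second sample first: given the first sample, the sparse parts are fixed sets
and the counts in them are binomial, which yields exp(−cB). The remaining random masses of the
sparse parts are then integrated over the first sample, which yields exp(−cM/8). -/
theorem lintegral_crudeCount_excess_le {m p : ℕ} (hp : 0 < p) (es : Finset (Euc m)) {C : ℝ}
    (hC : 0 ≤ C) : ∃ K : ℝ, 0 ≤ K ∧ ∀ {n N : ℕ} {M u B D c : ℝ}, 1 ≤ M → 1 ≤ B → B = M * N / n →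
      0 < n → 1 ≤ c → ∀ (ν₀ ν₁ : Measure (Euc m)) [IsProbabilityMeasure ν₀]
      [IsProbabilityMeasure ν₁], (∀ S, ν₁.real S ≤ C * ν₀.real S) → ∀ y : Euc m,
      ν₁.real (Metric.closedBall y u) ≤ D * (c * (M / n)) →
      ∫⁻ ys, ∫⁻ ws, ENNReal.ofReal (max 0 ((n : ℝ) / N * (crudeCount es M u y ys ws / M)
        - ((2 * D + 1) + es.card * (4 * C + 1)) * c) ^ p)
        ∂(Measure.pi fun _ : Fin N => ν₁) ∂(Measure.pi fun _ : Fin n => ν₀)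
      ≤ ENNReal.ofReal (K * (Real.exp (-(c * B)) + Real.exp (-(c * M / 8)))) := by
  obtain ⟨Kp, hKp, hsparse⟩ := lintegral_sparsePart_excess_le hp
  set k : ℝ := (es.card : ℝ)
  set A : ℝ := 2 ^ p * (k ^ p * 2 ^ p + 1)
  refine ⟨A * ((k + 1) * p.factorial + k * ((2 * C) ^ p * Kp)), by positivity, ?_⟩
  intro n N M u B D c hM hB hBdef hn hc ν₀ ν₁ _ _ hν y hball
  have hk : 0 ≤ k := Nat.cast_nonneg _
  set T : Euc m → (Fin n → Euc m) → Set (Euc m) :=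
    fun e ys => sparsePart (coneAt y e u) (fun w => ‖w - y‖) M ys with hT
  have hg : Measurable fun w : Euc m => ‖w - y‖ := by fun_prop
  have hTm : ∀ e ys, MeasurableSet (T e ys) :=
    fun e ys => measurableSet_sparsePart (measurableSet_coneAt y e u) hg M ys
  set ξ : (Fin N → Euc m) → ℝ := fun ws => max 0 (hits (Metric.closedBall y u) ws
    - 2 * (N * ν₁.real (Metric.closedBall y u)) - c * B) with hξ
  set η : Euc m → (Fin n → Euc m) → (Fin N → Euc m) → ℝ := fun e ys ws =>
    max 0 (hits (T e ys) ws - 2 * (N * ν₁.real (T e ys)) - c * B) with hη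
  set ζ : Euc m → (Fin n → Euc m) → ℝ := fun e ys =>
    max 0 (n * ν₀.real (T e ys) - 2 * c * M) with hζ
  have hpt : ∀ ys ws, max 0 ((n : ℝ) / N * (crudeCount es M u y ys ws / M)
        - ((2 * D + 1) + es.card * (4 * C + 1)) * c) ^ p
      ≤ A * (ξ ws ^ p + ∑ e ∈ es, (η e ys ws ^ p + (2 * C) ^ p * ζ e ys ^ p)) := by
    intro ys ws
    have hξ0 : 0 ≤ ξ ws := le_max_left _ _
    have hη0 : ∀ e, 0 ≤ η e ys ws := fun e => le_max_left _ _
    have hζ0 : ∀ e, 0 ≤ 2 * C * ζ e ys := fun e => mul_nonneg (by positivity) (le_max_left _ _)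
    have hs0 : ∀ e ∈ es, 0 ≤ η e ys ws + 2 * C * ζ e ys := fun e _ => add_nonneg (hη0 e) (hζ0 e)
    have h1 := crudeCount_excess_le es hM hB hBdef hn hC (ys := ys) ws hν hball
    have h2 : ∑ e ∈ es, (η e ys ws + 2 * C * ζ e ys) ^ p
        ≤ 2 ^ p * ∑ e ∈ es, (η e ys ws ^ p + (2 * C) ^ p * ζ e ys ^ p) := by
      rw [Finset.mul_sum]
      refine Finset.sum_le_sum fun e _ => ?_
      refine (add_pow_le_two_pow_mul (hη0 e) (hζ0 e) p).trans_eq ?_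
      rw [mul_pow (2 * C)]
    set S2 := ∑ e ∈ es, (η e ys ws ^ p + (2 * C) ^ p * ζ e ys ^ p)
    have hS2 : 0 ≤ S2 := Finset.sum_nonneg fun e _ => by
      rw [← mul_pow]; exact add_nonneg (pow_nonneg (hη0 e) _) (pow_nonneg (hζ0 e) _)
    calc _ ≤ (ξ ws + ∑ e ∈ es, (η e ys ws + 2 * C * ζ e ys)) ^ p :=
          pow_le_pow_left₀ (le_max_left _ _) h1 p
      _ ≤ 2 ^ p * (ξ ws ^ p + (∑ e ∈ es, (η e ys ws + 2 * C * ζ e ys)) ^ p) :=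
          add_pow_le_two_pow_mul hξ0 (Finset.sum_nonneg hs0) p
      _ ≤ 2 ^ p * (ξ ws ^ p + k ^ p * (2 ^ p * S2)) := by
          gcongr
          exact (sum_pow_le_card_pow_mul es hs0 hp).trans (by gcongr)
      _ ≤ A * (ξ ws ^ p + S2) := by
          have hx : 0 ≤ ξ ws ^ p := pow_nonneg hξ0 p
          have h3 : 0 ≤ k ^ p * 2 ^ p := by positivity
          have h4 : ξ ws ^ p + k ^ p * (2 ^ p * S2) ≤ (k ^ p * 2 ^ p + 1) * (ξ ws ^ p + S2) := by
            nlinarith [mul_nonneg h3 hx]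
          calc _ ≤ 2 ^ p * ((k ^ p * 2 ^ p + 1) * (ξ ws ^ p + S2)) := by gcongr
            _ = _ := by ring
  have hζm : ∀ e, Measurable (ζ e) := fun e => by
    have := measurable_measure_sparsePart (n := n) ν₀ (measurableSet_coneAt y e u) hg M
    exact measurable_const.max ((this.const_mul _).sub_const _)
  have hξm : Measurable ξ := by
    have := measurable_hits (N := N) (Metric.isClosed_closedBall (x := y) (ε := u)).measurableSet
    fun_prop
  have hηm : ∀ e ys, Measurable (η e ys) := fun e ys => by
    have := measurable_hits (N := N) (hTm e ys)
    fun_prop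
  have hA : 0 ≤ A := by positivity
  have hinner : ∀ ys, ∫⁻ ws, ENNReal.ofReal (max 0 ((n : ℝ) / N *
        (crudeCount es M u y ys ws / M) - ((2 * D + 1) + es.card * (4 * C + 1)) * c) ^ p)
        ∂(Measure.pi fun _ : Fin N => ν₁)
      ≤ ENNReal.ofReal A * (ENNReal.ofReal (p.factorial * Real.exp (-(c * B)))
        + ∑ e ∈ es, (ENNReal.ofReal (p.factorial * Real.exp (-(c * B)))
          + ENNReal.ofReal ((2 * C) ^ p) * ENNReal.ofReal (ζ e ys ^ p))) := by
    intro ys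
    calc _ ≤ ∫⁻ ws, ENNReal.ofReal A * (ENNReal.ofReal (ξ ws ^ p)
          + ∑ e ∈ es, (ENNReal.ofReal (η e ys ws ^ p)
            + ENNReal.ofReal ((2 * C) ^ p) * ENNReal.ofReal (ζ e ys ^ p)))
          ∂(Measure.pi fun _ : Fin N => ν₁) := by
          refine lintegral_mono fun ws => (ENNReal.ofReal_le_ofReal (hpt ys ws)).trans_eq ?_
          have hξ0 : 0 ≤ ξ ws ^ p := pow_nonneg (le_max_left _ _) _
          have hη0 : ∀ e, 0 ≤ η e ys ws ^ p := fun e => pow_nonneg (le_max_left _ _) _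
          have hζ0 : ∀ e, 0 ≤ (2 * C) ^ p * ζ e ys ^ p :=
            fun e => mul_nonneg (by positivity) (pow_nonneg (le_max_left _ _) _)
          rw [ENNReal.ofReal_mul hA, ENNReal.ofReal_add hξ0
            (Finset.sum_nonneg fun e _ => add_nonneg (hη0 e) (hζ0 e)),
            ENNReal.ofReal_sum_of_nonneg fun e _ => add_nonneg (hη0 e) (hζ0 e)]
          congr 2
          refine Finset.sum_congr rfl fun e _ => ?_
          rw [ENNReal.ofReal_add (hη0 e) (hζ0 e), ENNReal.ofReal_mul (by positivity)]
      _ ≤ _ := by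
          rw [lintegral_const_mul' _ _ ENNReal.ofReal_ne_top,
            lintegral_add_left (by fun_prop),
            lintegral_finsetSum _ (fun e _ => by have := hηm e ys; fun_prop)]
          gcongr with e he
          · exact lintegral_hits_excess_le ν₁ Metric.isClosed_closedBall.measurableSet hp _
          · rw [lintegral_add_right _ measurable_const, lintegral_const, measure_univ, mul_one]
            gcongr
            exact lintegral_hits_excess_le ν₁ (hTm e ys) hp _
  refine (lintegral_mono hinner).trans ?_
  rw [lintegral_const_mul' _ _ ENNReal.ofReal_ne_top, lintegral_add_left (by fun_prop),
    lintegral_finsetSum _ (fun e _ => by have := hζm e; fun_prop), lintegral_const, measure_univ,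
    mul_one]
  calc _ ≤ ENNReal.ofReal A * (ENNReal.ofReal (p.factorial * Real.exp (-(c * B)))
        + ∑ e ∈ es, (ENNReal.ofReal (p.factorial * Real.exp (-(c * B)))
          + ENNReal.ofReal ((2 * C) ^ p) * ENNReal.ofReal (Kp * Real.exp (-(c * M / 8))))) := by
        gcongr with e he
        rw [lintegral_add_left measurable_const, lintegral_const, measure_univ, mul_one,
          lintegral_const_mul' _ _ ENNReal.ofReal_ne_top]
        gcongr
        refine (hsparse ν₀ (measurableSet_coneAt y e u) hg hn (M := M) (b := 2 * c * M)
          (by positivity) (by nlinarith)).trans_eq ?_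
        congr 3; ring
    _ ≤ _ := by
        rw [Finset.sum_const, nsmul_eq_mul, ← ENNReal.ofReal_natCast es.card,
          ← ENNReal.ofReal_mul (by positivity),
          ← ENNReal.ofReal_add (by positivity) (by positivity),
          ← ENNReal.ofReal_mul (by positivity),
          ← ENNReal.ofReal_add (by positivity) (by positivity),
          ← ENNReal.ofReal_mul (by positivity)]
        apply ENNReal.ofReal_le_ofReal
        have e1 : 0 ≤ Real.exp (-(c * B)) := (Real.exp_pos _).le
        have e2 : 0 ≤ Real.exp (-(c * M / 8)) := (Real.exp_pos _).le
        set x := Real.exp (-(c * B))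
        set z := Real.exp (-(c * M / 8))
        change A * (p.factorial * x + k * (p.factorial * x + (2 * C) ^ p * (Kp * z))) ≤ _
        have h1 : 0 ≤ A * ((k + 1) * p.factorial) * z := by positivity
        have h2 : 0 ≤ A * (k * ((2 * C) ^ p * Kp)) * x := by positivity
        nlinarith

/-! ### Local densities and an integrable tail -/

/-- The volume of the unit ball of `ℝᵐ`. -/
noncomputable def unitBallVolume (m : ℕ) : ℝ := volume.real (Metric.ball (0 : Euc m) 1)

theorem unitBallVolume_pos (m : ℕ) : 0 < unitBallVolume m :=
  ENNReal.toReal_pos (Metric.measure_ball_pos volume _ one_pos).ne' measure_ball_lt_top.ne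

theorem volume_real_closedBall {m : ℕ} (w : Euc m) {ρ : ℝ} (hρ : 0 ≤ ρ) :
    volume.real (Metric.closedBall w ρ) = unitBallVolume m * ρ ^ m := by
  rw [measureReal_def, Measure.addHaar_closedBall _ _ hρ, ENNReal.toReal_mul,
    ENNReal.toReal_ofReal (by positivity), finrank_euclideanSpace_fin, mul_comm]
  rfl

/-- The measure `ν` has the density `g` at `y`, in the sense that small balls that are not far from
`y` in proportion to their radius have about the mass `g` times their volume. -/
def HasDensityAt {m : ℕ} (ν : Measure (Euc m)) (g : ℝ) (y : Euc m) : Prop :=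
  ∀ η : ℝ, 0 < η → ∃ ρ₀ : ℝ, 0 < ρ₀ ∧ ∀ (w : Euc m) (ρ : ℝ), 0 < ρ → ρ < ρ₀ → ‖y - w‖ ≤ 2 * ρ →
    |ν.real (Metric.closedBall w ρ) - g * (unitBallVolume m * ρ ^ m)|
      ≤ η * (unitBallVolume m * ρ ^ m)

/-- Lebesgue differentiation along balls whose centre lies within a fixed multiple of the radius
from y. Centred balls would not do: the balls to be measured are about the candidate match w, with y
near their boundary. -/
theorem ae_hasDensityAt {m : ℕ} {ν : Measure (Euc m)} [IsFiniteMeasure ν] {f : Euc m → ℝ}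
    (hf : Measurable f) (hf0 : ∀ y, 0 ≤ f y)
    (hν : ν = volume.withDensity fun y => ENNReal.ofReal (f y)) :
    ∀ᵐ y ∂volume, HasDensityAt ν (f y) y := by
  have hint : Integrable f volume := by
    refine ⟨hf.aestronglyMeasurable, ?_⟩
    rw [hasFiniteIntegral_iff_ofReal (ae_of_all _ hf0)]
    have := measure_lt_top ν univ
    rwa [hν, withDensity_apply _ MeasurableSet.univ, Measure.restrict_univ] at this
  have hreal : ∀ S, MeasurableSet S → ν.real S = ∫ x in S, f x := by
    intro S hS
    rw [measureReal_def, hν, withDensity_apply _ hS,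
      integral_eq_lintegral_of_nonneg_ae (ae_of_all _ hf0) hf.aestronglyMeasurable]
  filter_upwards [IsUnifLocDoublingMeasure.ae_tendsto_average (μ := (volume : Measure (Euc m)))
    hint.locallyIntegrable 2] with y hy
  intro η hη
  by_contra! hcon
  have hseq : ∀ k : ℕ, ∃ q : Euc m × ℝ, 0 < q.2 ∧ q.2 < 1 / ((k : ℝ) + 1) ∧ ‖y - q.1‖ ≤ 2 * q.2 ∧
      η * (unitBallVolume m * q.2 ^ m) <
        |ν.real (Metric.closedBall q.1 q.2) - f y * (unitBallVolume m * q.2 ^ m)| := by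
    intro k
    obtain ⟨w, ρ, h1, h2, h3, h4⟩ := hcon (1 / ((k : ℝ) + 1)) (by positivity)
    exact ⟨(w, ρ), h1, h2, h3, h4⟩
  choose q hq0 hq1 hq2 hq3 using hseq
  have hlim : Tendsto (fun k => (q k).2) atTop (𝓝[>] 0) :=
    tendsto_nhdsWithin_iff.2 ⟨squeeze_zero (fun k => (hq0 k).le) (fun k => (hq1 k).le)
      tendsto_one_div_add_atTop_nhds_zero_nat, Eventually.of_forall hq0⟩
  have havg := hy (fun k => (q k).1) (fun k => (q k).2) hlim
    (Eventually.of_forall fun k => by rw [Metric.mem_closedBall, dist_eq_norm]; exact hq2 k)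
  obtain ⟨k, hk⟩ := (havg.eventually (Metric.ball_mem_nhds (f y) hη)).exists
  have hV : 0 < unitBallVolume m * (q k).2 ^ m :=
    mul_pos (unitBallVolume_pos m) (pow_pos (hq0 k) m)
  rw [setAverage_eq, ← hreal _ Metric.isClosed_closedBall.measurableSet,
    volume_real_closedBall _ (hq0 k).le, smul_eq_mul] at hk
  replace hk : |_ - _| < η := hk
  have h5 := hq3 k
  set V := unitBallVolume m * (q k).2 ^ m
  set x := ν.real (Metric.closedBall (q k).1 (q k).2)
  have h6 : x - f y * V = (V⁻¹ * x - f y) * V := by field_simp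
  rw [h6, abs_mul, abs_of_pos hV] at h5
  exact absurd hk (not_lt.2 (lt_of_mul_lt_mul_right h5 hV.le).le)

/-- Translation and scaling reduce this to y = 0 and R = 1, where the decay exponent 2m exceeds the
dimension m. -/
theorem exists_lintegral_one_add_norm_div_le {m : ℕ} (hm : 0 < m) :
    ∃ J : ℝ, 0 ≤ J ∧ ∀ (y : Euc m) {R : ℝ}, 0 < R →
      ∫⁻ w, ENNReal.ofReal ((1 + ‖w - y‖ / R) ^ (-(2 * m : ℝ))) ≤ ENNReal.ofReal (J * R ^ m) := by
  have hfin := finite_integral_one_add_norm (E := Euc m) (μ := volume) (r := 2 * m) (by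
    rw [finrank_euclideanSpace_fin]
    have : (0 : ℝ) < m := by exact_mod_cast hm
    linarith)
  refine ⟨(∫⁻ v : Euc m, ENNReal.ofReal ((1 + ‖v‖) ^ (-(2 * m : ℝ)))).toReal,
    ENNReal.toReal_nonneg, fun y R hR => le_of_eq ?_⟩
  rw [lintegral_sub_right_eq_self (fun w : Euc m =>
    ENNReal.ofReal ((1 + ‖w‖ / R) ^ (-(2 * m : ℝ)))) y]
  have h1 := Measure.map_addHaar_smul (volume : Measure (Euc m)) (r := R⁻¹) (inv_pos.2 hR).ne'
  have h2 : ∫⁻ w : Euc m, ENNReal.ofReal ((1 + ‖w‖ / R) ^ (-(2 * m : ℝ)))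
      = ∫⁻ v, ENNReal.ofReal ((1 + ‖v‖) ^ (-(2 * m : ℝ)))
        ∂(Measure.map (fun x : Euc m => R⁻¹ • x) volume) := by
    rw [lintegral_map (by fun_prop) (by fun_prop)]
    refine lintegral_congr fun w => ?_
    rw [norm_smul, norm_inv, Real.norm_of_nonneg hR.le, div_eq_inv_mul]
  rw [h2, h1, lintegral_smul_measure, finrank_euclideanSpace_fin, ENNReal.ofReal_mul
    ENNReal.toReal_nonneg, ENNReal.ofReal_toReal hfin.ne, smul_eq_mul, mul_comm, inv_pow, inv_inv,
    abs_of_nonneg (by positivity)]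

/-! ### Convergence in probability for the sets defined by φ -/

/-- The points whose distance to `y` is, up to a relative error `ε` and an additive error of order
`ε * u`, at most the distance to the `M`-th nearest point of the sample `ys`. -/
def outerCatch {m n : ℕ} (M ε u : ℝ) (y : Euc m) (ys : Fin n → Euc m) : Set (Euc m) :=
  {w | hits {v | (1 + ε) * ‖v - w‖ + 2 * ε * u < (1 - ε) * ‖y - w‖} ys < M}

/-- The counterpart of `outerCatch` with the errors of the opposite sign. -/
def innerCatch {m n : ℕ} (M ε u : ℝ) (y : Euc m) (ys : Fin n → Euc m) : Set (Euc m) :=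
  {w | hits {v | (1 - ε) * ‖v - w‖ < (1 + ε) * ‖y - w‖ + 2 * ε * u} ys < M}

theorem measurableSet_outerCatch_prod {m n : ℕ} (M ε u : ℝ) :
    MeasurableSet {q : (Euc m × (Fin n → Euc m)) × Euc m | q.2 ∈ outerCatch M ε u q.1.1 q.1.2} := by
  have hP : MeasurableSet {q : (Euc m × Euc m) × Euc m |
      (1 + ε) * ‖q.2 - q.1.2‖ + 2 * ε * u < (1 - ε) * ‖q.1.1 - q.1.2‖} :=
    measurableSet_lt (by fun_prop) (by fun_prop)
  exact measurable_hits_param hP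
    (b := fun q : (Euc m × (Fin n → Euc m)) × Euc m => (q.1.1, q.2)) (by fun_prop)
    (w := fun q => q.1.2) (by fun_prop) measurableSet_Iio

theorem measurableSet_innerCatch_prod {m n : ℕ} (M ε u : ℝ) :
    MeasurableSet {q : (Euc m × (Fin n → Euc m)) × Euc m | q.2 ∈ innerCatch M ε u q.1.1 q.1.2} := by
  have hP : MeasurableSet {q : (Euc m × Euc m) × Euc m |
      (1 - ε) * ‖q.2 - q.1.2‖ < (1 + ε) * ‖q.1.1 - q.1.2‖ + 2 * ε * u} :=
    measurableSet_lt (by fun_prop) (by fun_prop)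
  exact measurable_hits_param hP
    (b := fun q : (Euc m × (Fin n → Euc m)) × Euc m => (q.1.1, q.2)) (by fun_prop)
    (w := fun q => q.1.2) (by fun_prop) measurableSet_Iio

theorem measurable_hits_outerCatch {m n N : ℕ} (M ε u : ℝ) :
    Measurable fun q : Euc m × (Fin n → Euc m) × (Fin N → Euc m) =>
      hits (outerCatch M ε u q.1 q.2.1) q.2.2 :=
  measurable_hits_param (measurableSet_outerCatch_prod M ε u)
    (b := fun q : Euc m × (Fin n → Euc m) × (Fin N → Euc m) => (q.1, q.2.1)) (by fun_prop)
    (w := fun q => q.2.2) (by fun_prop)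

theorem measurable_hits_innerCatch {m n N : ℕ} (M ε u : ℝ) :
    Measurable fun q : Euc m × (Fin n → Euc m) × (Fin N → Euc m) =>
      hits (innerCatch M ε u q.1 q.2.1) q.2.2 :=
  measurable_hits_param (measurableSet_innerCatch_prod M ε u)
    (b := fun q : Euc m × (Fin n → Euc m) × (Fin N → Euc m) => (q.1, q.2.1)) (by fun_prop)
    (w := fun q => q.2.2) (by fun_prop)

/-- Markov's inequality for the number of sample points in a random set independent of the sample.
By Fubini its mean is N times the integral of the probability that the set contains w. -/
theorem prod_measure_hits_ge_le {α β : Type*} [MeasurableSpace α] [MeasurableSpace β] {N : ℕ}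
    (π : Measure β) [IsProbabilityMeasure π] (ν : Measure α) [IsProbabilityMeasure ν]
    {A : β → Set α} (hA : MeasurableSet {q : β × α | q.2 ∈ A q.1}) {s : ℝ} (hs : 0 < s)
    {G : α → ℝ≥0∞}
    (hG : ∀ᵐ w ∂ν, π {b | w ∈ A b} ≤ G w) :
    (π.prod (Measure.pi fun _ : Fin N => ν)) {q | s ≤ hits (A q.1) q.2}
      ≤ ENNReal.ofReal (N / s) * ∫⁻ w, G w ∂ν := by
  have hm : Measurable fun q : β × (Fin N → α) => hits (A q.1) q.2 :=
    measurable_hits_param hA (b := fun q : β × (Fin N → α) => q.1) (by fun_prop)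
      (w := fun q => q.2) (by fun_prop)
  have hAb : ∀ b, MeasurableSet (A b) := fun b => measurable_prodMk_left hA
  have h1 : ∫⁻ q, ENNReal.ofReal (hits (A q.1) q.2) ∂(π.prod (Measure.pi fun _ : Fin N => ν))
      ≤ N * ∫⁻ w, G w ∂ν := by
    rw [lintegral_prod _ hm.ennreal_ofReal.aemeasurable]
    simp_rw [fun b => lintegral_hits (N := N) ν (hAb b)]
    rw [lintegral_const_mul' _ _ (ENNReal.natCast_ne_top N)]
    gcongr
    have h2 : ∫⁻ b, ν (A b) ∂π = (π.prod ν) {q | q.2 ∈ A q.1} := (Measure.prod_apply hA).symm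
    rw [h2, Measure.prod_apply_symm hA]
    exact lintegral_mono_ae hG
  have h3 := mul_meas_ge_le_lintegral (μ := π.prod (Measure.pi fun _ : Fin N => ν))
    hm.ennreal_ofReal (ENNReal.ofReal s)
  have h4 : {q : β × (Fin N → α) | ENNReal.ofReal s ≤ ENNReal.ofReal (hits (A q.1) q.2)}
      = {q | s ≤ hits (A q.1) q.2} := by
    ext q
    exact ENNReal.ofReal_le_ofReal_iff (hits_nonneg _ _)
  rw [h4] at h3
  have hs' : ENNReal.ofReal s ≠ 0 := by simpa using hs
  rw [ENNReal.ofReal_div_of_pos hs, ENNReal.ofReal_natCast, ENNReal.mul_comm_div, ← mul_div_assoc,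
    ENNReal.le_div_iff_mul_le (Or.inl hs') (Or.inl ENNReal.ofReal_ne_top), mul_comm]
  exact h3.trans h1

/-- R is the radius at which the ball about y has expected count (1 + δ)M to first order. For w
beyond R but close to y, the ball about w of radius (1 − θ)‖y − w‖ consists of points counted in the
definition of `outerCatch`, and it should hold more than M (‖y − w‖/R)^m sample points. Membership
of w requires fewer than M, a Chernoff event. -/
theorem measure_mem_outerCatch_le_near {m n : ℕ} {ν₀ : Measure (Euc m)} [IsProbabilityMeasure ν₀]
    {M R g₀ δ ε θ κ u : ℝ} {y w : Euc m} (hn : 0 < n) (hM : 0 < M) (hR : 0 < R) (hg₀ : 0 < g₀)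
    (hRm : R ^ m = (1 + δ) * (M / n) / (g₀ * unitBallVolume m)) (hδ : 0 < δ) (hδ' : δ ≤ 1 / 2)
    (hε : 0 ≤ ε) (hu : u ≤ κ * R) (hκ : 0 ≤ κ)
    (hθm : 1 + δ / 2 ≤ (1 + δ) * (1 - θ) ^ m) (hεθ : (1 + ε) * (1 - θ) + 2 * ε * κ < 1 - ε)
    (hw : R ≤ ‖y - w‖) (hball : g₀ * (1 - δ / 16) * (unitBallVolume m * ((1 - θ) * ‖y - w‖) ^ m)
      ≤ ν₀.real (Metric.closedBall w ((1 - θ) * ‖y - w‖))) :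
    (Measure.pi fun _ : Fin n => ν₀) {ys | w ∈ outerCatch M ε u y ys}
      ≤ ENNReal.ofReal (Real.exp (-(δ ^ 2 / 100 * (M * (‖y - w‖ / R) ^ m)))) := by
  set D := ‖y - w‖
  have hD : 0 < D := hR.trans_le hw
  have hn' : (0 : ℝ) < n := by exact_mod_cast hn
  have hV := unitBallVolume_pos m
  set q := ν₀.real (Metric.closedBall w ((1 - θ) * D))
  set l := (D / R) ^ m
  have hl : 1 ≤ l := one_le_pow₀ ((one_le_div hR).2 hw)
  have hDm : D ^ m = l * ((1 + δ) * (M / n) / (g₀ * unitBallVolume m)) := by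
    rw [← hRm, ← mul_pow, div_mul_cancel₀ _ hR.ne']
  -- The surplus δ in R^m is spent on shrinking the radius by 1 − θ and on the density error δ/16.
  -- What is left, δ/4, still leaves room for η = δ/5, because (1 − δ/5)(1 + δ/4) ≥ 1.
  have hq : (1 + δ / 4) * (M * l) ≤ n * q := by
    calc (1 + δ / 4) * (M * l) ≤ (1 - δ / 16) * (1 + δ / 2) * (M * l) := by
          gcongr; nlinarith
      _ ≤ (1 - δ / 16) * ((1 + δ) * (1 - θ) ^ m) * (M * l) := by gcongr; linarith
      _ = n * (g₀ * (1 - δ / 16) * (unitBallVolume m * ((1 - θ) * D) ^ m)) := by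
          rw [mul_pow, hDm]; field_simp
      _ ≤ n * q := by gcongr
  have hMl : M ≤ M * l := le_mul_of_one_le_right hM.le hl
  refine (measure_mono ?_).trans ((measure_hits_lt_le (N := n) ν₀
    (Metric.isClosed_closedBall (x := w) (ε := (1 - θ) * D)).measurableSet (η := δ / 5) (M := M)
    (by positivity) (by linarith) ?_).trans ?_)
  · intro ys hys
    refine lt_of_le_of_lt (hits_mono fun j hj => ?_) hys
    have hj' : ‖ys j - w‖ ≤ (1 - θ) * D := by rwa [Metric.mem_closedBall, dist_eq_norm] at hj
    change (1 + ε) * ‖ys j - w‖ + 2 * ε * u < (1 - ε) * D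
    calc _ ≤ (1 + ε) * ((1 - θ) * D) + 2 * ε * (κ * D) := by
          gcongr
          exact hu.trans (by gcongr)
      _ = ((1 + ε) * (1 - θ) + 2 * ε * κ) * D := by ring
      _ < _ := by gcongr
  · calc M ≤ M * l := hMl
      _ ≤ (1 - δ / 5) * ((1 + δ / 4) * (M * l)) := by
          rw [← mul_assoc]; exact le_mul_of_one_le_left (by positivity) (by nlinarith)
      _ ≤ _ := by gcongr; linarith
  · apply ENNReal.ofReal_le_ofReal
    rw [Real.exp_le_exp, neg_le_neg_iff]
    have : M * l ≤ n * q := le_trans (le_mul_of_one_le_left (by positivity) (by linarith)) hq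
    calc _ = (δ / 5) ^ 2 / 4 * (M * l) := by ring
      _ ≤ _ := by gcongr

/-- Far from y the local density says nothing, but a uniform lower bound β for the mass of balls of
fixed radius suffices. Since θ ≤ 1/2, the ball of radius ρ/2 about w lies in the shrunken ball, and
its expected count nβ is at least 2M. -/
theorem measure_mem_outerCatch_le_far {m n : ℕ} {ν₀ : Measure (Euc m)} [IsProbabilityMeasure ν₀]
    {M R ε θ κ u ρ β : ℝ} {y w : Euc m} (hR : 0 < R)
    (hε : 0 ≤ ε) (hu : u ≤ κ * R) (hκ : 0 ≤ κ) (hθ : θ ≤ 1 / 2)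
    (hεθ : (1 + ε) * (1 - θ) + 2 * ε * κ < 1 - ε)
    (hw : R ≤ ‖y - w‖) (hρ : ρ ≤ ‖y - w‖) (hβ : β ≤ ν₀.real (Metric.closedBall w (ρ / 2)))
    (hM : 2 * M ≤ n * β) :
    (Measure.pi fun _ : Fin n => ν₀) {ys | w ∈ outerCatch M ε u y ys}
      ≤ ENNReal.ofReal (Real.exp (-(n * β / 16))) := by
  set D := ‖y - w‖
  have hD : 0 < D := hR.trans_le hw
  have hnβ : n * β ≤ n * ν₀.real (Metric.closedBall w (ρ / 2)) := by gcongr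
  refine (measure_mono ?_).trans ((measure_hits_lt_le (N := n) ν₀
    (Metric.isClosed_closedBall (x := w) (ε := ρ / 2)).measurableSet (η := 1 / 2) (M := M)
    (by positivity) (by norm_num) (by linarith)).trans ?_)
  · intro ys hys
    refine lt_of_le_of_lt (hits_mono fun j hj => ?_) hys
    have hj' : ‖ys j - w‖ ≤ ρ / 2 := by rwa [Metric.mem_closedBall, dist_eq_norm] at hj
    have hj'' : ‖ys j - w‖ ≤ (1 - θ) * D := by nlinarith
    change (1 + ε) * ‖ys j - w‖ + 2 * ε * u < (1 - ε) * D
    calc _ ≤ (1 + ε) * ((1 - θ) * D) + 2 * ε * (κ * D) := by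
          gcongr
          exact hu.trans (by gcongr)
      _ = ((1 + ε) * (1 - θ) + 2 * ε * κ) * D := by ring
      _ < _ := by gcongr
  · apply ENNReal.ofReal_le_ofReal
    rw [Real.exp_le_exp]
    linarith

theorem exp_neg_pow_le {m : ℕ} {c l : ℝ} (hc : 0 < c) (hl : 1 ≤ l) :
    Real.exp (-(c * l ^ m)) ≤ 2 * 4 ^ m / c ^ 2 * (1 + l) ^ (-(2 * m : ℝ)) := by
  have hl0 : 0 < l := by linarith
  have h1 := Real.pow_div_factorial_le_exp (c * l ^ m) (by positivity) 2
  have h2 : (1 + l) ^ (-(2 * m : ℝ)) = ((1 + l) ^ (2 * m))⁻¹ := by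
    rw [Real.rpow_neg (by positivity)]; congr 1; exact_mod_cast Real.rpow_natCast (1 + l) (2 * m)
  have h3 : (1 + l) ^ (2 * m) ≤ 4 ^ m * (l ^ m) ^ 2 := by
    calc (1 + l) ^ (2 * m) ≤ (2 * l) ^ (2 * m) := by gcongr; linarith
      _ = _ := by rw [mul_pow, pow_mul, pow_mul']; norm_num
  rw [h2, Real.exp_neg, ← div_eq_mul_inv, inv_le_comm₀ (Real.exp_pos _) (by positivity), inv_div]
  refine le_trans ?_ h1
  rw [div_div_eq_mul_div, div_le_iff₀ (by positivity)]
  simp only [Nat.factorial]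
  push_cast
  have h4 : c ^ 2 * (1 + l) ^ (2 * m) ≤ c ^ 2 * (4 ^ m * (l ^ m) ^ 2) := by gcongr
  rw [mul_pow]
  linarith

theorem measure_pi_hits_dense {m N : ℕ} {ν₁ : Measure (Euc m)} [IsProbabilityMeasure ν₁]
    {S : Set (Euc m)} (hS : MeasurableSet S) {δ B L : ℝ} (hδ : 0 < δ) (hB : 0 < B)
    (hL : δ ≤ L) (hN : N * ν₁.real S ≤ L * B) :
    (Measure.pi fun _ : Fin N => ν₁) {ws | N * ν₁.real S + δ * B ≤ hits S ws}
        ≤ ENNReal.ofReal (Real.exp (-(δ ^ 2 / (4 * L) * B))) ∧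
    (Measure.pi fun _ : Fin N => ν₁) {ws | hits S ws ≤ N * ν₁.real S - δ * B}
        ≤ ENNReal.ofReal (Real.exp (-(δ ^ 2 / (4 * L) * B))) := by
  have hL0 : 0 < L := hδ.trans_le hL
  -- The exponent L B t² − tδB is smallest at t = δ/(2L); the assumption δ ≤ L keeps t within the
  -- range of the Chernoff bound.
  have ht1 : δ / (2 * L) ≤ 1 := by rw [div_le_one (by positivity)]; linarith
  have key : N * ν₁.real S * (δ / (2 * L)) ^ 2 - δ / (2 * L) * (δ * B)
      ≤ -(δ ^ 2 / (4 * L) * B) := by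
    calc _ ≤ L * B * (δ / (2 * L)) ^ 2 - δ / (2 * L) * (δ * B) := by gcongr
      _ = _ := by field_simp; ring
  exact ⟨(measure_hits_ge_le ν₁ hS (by positivity) ht1 _).trans
    (ENNReal.ofReal_le_ofReal (Real.exp_le_exp.2 key)),
    (measure_hits_le_le ν₁ hS (by positivity) ht1 _).trans
    (ENNReal.ofReal_le_ofReal (Real.exp_le_exp.2 key))⟩

/-- The radius whose `m`-th power is `x`. -/
noncomputable def rootRadius (m : ℕ) (x : ℝ) : ℝ := x ^ (1 / (m : ℝ))

theorem rootRadius_pow {m : ℕ} (hm : 0 < m) {x : ℝ} (hx : 0 ≤ x) : rootRadius m x ^ m = x := by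
  rw [rootRadius, one_div, Real.rpow_inv_natCast_pow hx hm.ne']

theorem rootRadius_pos {m : ℕ} {x : ℝ} (hx : 0 < x) : 0 < rootRadius m x :=
  Real.rpow_pos_of_pos hx _

theorem tendsto_rootRadius {m : ℕ} (hm : 0 < m) {ι : Type*} {l : Filter ι} {f : ι → ℝ}
    (hf : Tendsto f l (𝓝 0)) : Tendsto (fun i => rootRadius m (f i)) l (𝓝 0) := by
  have hm' : 1 / (m : ℝ) ≠ 0 := by positivity
  have := hf.rpow_const (p := 1 / (m : ℝ)) (Or.inr (by positivity))
  rwa [Real.zero_rpow hm'] at this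

theorem rootRadius_le_mul {m : ℕ} (hm : 0 < m) {x R κ : ℝ} (hx : 0 ≤ x) (hR : 0 ≤ R) (hκ : 0 ≤ κ)
    (h : x ≤ κ ^ m * R ^ m) : rootRadius m x ≤ κ * R := by
  refine le_of_pow_le_pow_left₀ hm.ne' (by positivity) ?_
  rwa [rootRadius_pow hm hx, mul_pow]

theorem lintegral_exp_neg_norm_le {m : ℕ} {J : ℝ}
    (hJ : ∀ (y : Euc m) {R : ℝ}, 0 < R →
      ∫⁻ w, ENNReal.ofReal ((1 + ‖w - y‖ / R) ^ (-(2 * m : ℝ))) ≤ ENNReal.ofReal (J * R ^ m))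
    {ν₁ : Measure (Euc m)} {C₁ : ℝ} (hC₁0 : 0 ≤ C₁) (hC₁ : ν₁ ≤ ENNReal.ofReal C₁ • volume)
    (y : Euc m) {R c : ℝ} (hR : 0 < R) (hc : 0 < c) :
    ∫⁻ w in {w | R ≤ ‖y - w‖}, ENNReal.ofReal (Real.exp (-(c * (‖y - w‖ / R) ^ m))) ∂ν₁
      ≤ ENNReal.ofReal (C₁ * (2 * 4 ^ m / c ^ 2 * (J * R ^ m))) := by
  have hmeas : MeasurableSet {w : Euc m | R ≤ ‖y - w‖} :=
    measurableSet_le measurable_const (by fun_prop)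
  calc _ ≤ ∫⁻ w in {w | R ≤ ‖y - w‖}, ENNReal.ofReal (2 * 4 ^ m / c ^ 2) *
        ENNReal.ofReal ((1 + ‖w - y‖ / R) ^ (-(2 * m : ℝ))) ∂ν₁ := by
        refine setLIntegral_mono' hmeas fun w hw => ?_
        rw [← ENNReal.ofReal_mul (by positivity), norm_sub_rev w y]
        exact ENNReal.ofReal_le_ofReal (exp_neg_pow_le hc ((one_le_div hR).2 hw))
    _ ≤ ∫⁻ w, ENNReal.ofReal (2 * 4 ^ m / c ^ 2) *
        ENNReal.ofReal ((1 + ‖w - y‖ / R) ^ (-(2 * m : ℝ))) ∂(ENNReal.ofReal C₁ • volume) :=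
        lintegral_mono' (Measure.restrict_le_self.trans hC₁) le_rfl
    _ ≤ _ := by
        rw [lintegral_smul_measure, lintegral_const_mul' _ _ ENNReal.ofReal_ne_top, smul_eq_mul,
          ENNReal.ofReal_mul hC₁0, ENNReal.ofReal_mul (by positivity)]
        gcongr
        exact hJ y hR

theorem tendsto_ofReal_exp_neg {c : ℝ} (hc : 0 < c) {ι : Type*} {l : Filter ι} {f : ι → ℝ}
    (hf : Tendsto f l atTop) (L : ℝ) :
    Tendsto (fun i => ENNReal.ofReal (L * Real.exp (-(c * f i)))) l (𝓝 0) := by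
  have h1 : Tendsto (fun i => Real.exp (-(c * f i))) l (𝓝 0) :=
    Real.tendsto_exp_neg_atTop_nhds_zero.comp (hf.const_mul_atTop hc)
  have h2 := ENNReal.tendsto_ofReal (h1.const_mul L)
  simpa using h2

-- Split the set at the ball S of radius R about y. The count in S is binomial with mean about (1 +
-- δ)(g₁/g₀)B. The expected number of points of the set outside S is o(B), by the near and far
-- estimates integrated against ν₁.
set_option maxHeartbeats 1000000 in
theorem tendsto_measure_outerCatch {m : ℕ} (hm : 0 < m) {ν₀ ν₁ : Measure (Euc m)}
    [IsProbabilityMeasure ν₀] [IsProbabilityMeasure ν₁] {M N : ℕ → ℕ} (hM : Tendsto M atTop atTop)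
    (hMn : Tendsto (fun n : ℕ => (M n : ℝ) / n) atTop (𝓝 0))
    (hB : Tendsto (fun n : ℕ => (M n : ℝ) * N n / n) atTop atTop)
    {C₁ : ℝ} (hC₁0 : 0 ≤ C₁) (hC₁ : ν₁ ≤ ENNReal.ofReal C₁ • volume)
    {y : Euc m} {g₀ g₁ : ℝ} (hg₀ : 0 < g₀) (hg₁ : 0 ≤ g₁) (hd₀ : HasDensityAt ν₀ g₀ y)
    (hd₁ : HasDensityAt ν₁ g₁ y)
    (hfar : ∀ ρ : ℝ, 0 < ρ → ∃ β : ℝ, 0 < β ∧ ∀ᵐ w ∂ν₁, β ≤ ν₀.real (Metric.closedBall w ρ))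
    {δ ε θ κ : ℝ} (hδ : 0 < δ) (hδ' : δ ≤ 1 / 2) (hε : 0 ≤ ε) (hκ : 0 ≤ κ) (hθ0 : 0 < θ)
    (hθ : θ ≤ 1 / 2)
    (hκm : g₀ * unitBallVolume m ≤ κ ^ m * (1 + δ))
    (hθm : 1 + δ / 2 ≤ (1 + δ) * (1 - θ) ^ m) (hεθ : (1 + ε) * (1 - θ) + 2 * ε * κ < 1 - ε) :
    Tendsto (fun n : ℕ => ((Measure.pi fun _ : Fin n => ν₀).prod
      (Measure.pi fun _ : Fin (N n) => ν₁)) {q | (1 + δ) * (g₁ / g₀) + 3 * δ <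
        (n : ℝ) / N n *
          (hits (outerCatch (M n) ε (rootRadius m (M n / n)) y q.1) q.2 / M n)}) atTop (𝓝 0) := by
  have hV := unitBallVolume_pos m
  set V := unitBallVolume m with hVdef
  obtain ⟨J, hJ0, hJ⟩ := exists_lintegral_one_add_norm_div_le hm
  obtain ⟨ρ₀, hρ₀, hball₀⟩ := hd₀ (g₀ * (δ / 16)) (by positivity)
  -- Since N V R^m = (1 + δ)B/g₀, this tolerance contributes exactly δB to the expected count.
  obtain ⟨ρ₁, hρ₁, hball₁⟩ := hd₁ (g₀ * δ / (1 + δ)) (by positivity)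
  obtain ⟨β, hβ, hfarβ⟩ := hfar (ρ₀ / 2) (by positivity)
  set L : ℝ := (1 + δ) * (g₁ / g₀) + δ with hL
  have hLδ : δ ≤ L := le_add_of_nonneg_left (by positivity)
  set c : ℝ := δ ^ 2 / 100 with hc
  have hc0 : 0 < c := by positivity
  set R : ℕ → ℝ := fun n => rootRadius m ((1 + δ) * (M n / n) / (g₀ * V)) with hR
  -- The near tail has rate proportional to M, whose inverse square enters the integral. The volume
  -- R^m ~ M/n cancels the Markov factor n/(δM), leaving K/M².
  set K : ℝ := C₁ * (2 * 4 ^ m / c ^ 2 * (J * ((1 + δ) / (g₀ * V)))) / δ with hK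
  have hRlim : Tendsto R atTop (𝓝 0) := by
    refine tendsto_rootRadius hm ?_
    simpa using (hMn.const_mul (1 + δ)).div_const (g₀ * V)
  have hMr : Tendsto (fun n => (M n : ℝ)) atTop atTop := tendsto_natCast_atTop_atTop.comp hM
  have hbound : Tendsto (fun n : ℕ => ENNReal.ofReal (1 * Real.exp (-(δ ^ 2 / (4 * L) *
      ((M n : ℝ) * N n / n)))) + (ENNReal.ofReal (K / (M n : ℝ) ^ 2)
      + ENNReal.ofReal (1 / δ * (n * Real.exp (-(β / 16 * n)))))) atTop (𝓝 0) := by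
    have h1 := tendsto_ofReal_exp_neg (c := δ ^ 2 / (4 * L)) (by positivity) hB 1
    have h2 : Tendsto (fun n => ENNReal.ofReal (K / (M n : ℝ) ^ 2)) atTop (𝓝 0) := by
      have := ENNReal.tendsto_ofReal (Tendsto.const_div_atTop
        ((tendsto_pow_atTop (two_ne_zero)).comp hMr) K)
      simpa using this
    have h3 : Tendsto (fun n : ℕ => ENNReal.ofReal (1 / δ * (n * Real.exp (-(β / 16 * n)))))
        atTop (𝓝 0) := by
      have h := (Real.tendsto_pow_mul_exp_neg_atTop_nhds_zero 1).comp
        ((tendsto_natCast_atTop_atTop (R := ℝ)).const_mul_atTop (by positivity : 0 < β / 16))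
      have h' := ENNReal.tendsto_ofReal (h.const_mul (1 / δ * (16 / β)))
      rw [mul_zero, ENNReal.ofReal_zero] at h'
      refine h'.congr fun n => ?_
      congr 1
      simp only [Function.comp, pow_one]
      field_simp
    simpa using h1.add (h2.add h3)
  refine tendsto_of_tendsto_of_tendsto_of_le_of_le' tendsto_const_nhds hbound
    (Eventually.of_forall fun _ => zero_le) ?_
  filter_upwards [eventually_gt_atTop 0, hM.eventually_ge_atTop 1, hB.eventually_ge_atTop 1,
    hRlim.eventually (gt_mem_nhds (lt_min hρ₀ hρ₁)),
    hMn.eventually (gt_mem_nhds (show (0 : ℝ) < β / 2 by positivity))] with n hn hM1 hB1 hRn hMβ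
  have hn' : (0 : ℝ) < n := by exact_mod_cast hn
  have hM' : (1 : ℝ) ≤ M n := by exact_mod_cast hM1
  have hM0 : (0 : ℝ) < M n := by linarith
  have hRn0 : 0 < R n := rootRadius_pos (by positivity)
  have hRm : R n ^ m = (1 + δ) * (M n / n) / (g₀ * V) := rootRadius_pow hm (by positivity)
  set B : ℝ := (M n : ℝ) * N n / n with hBdef
  have hB0 : 0 < B := by linarith
  have hN : (0 : ℝ) < N n := by
    rcases Nat.eq_zero_or_pos (N n) with h | h
    · rw [hBdef, h] at hB0; simp at hB0
    · exact_mod_cast h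
  have hu : rootRadius m (M n / n) ≤ κ * R n := by
    refine rootRadius_le_mul hm (by positivity) hRn0.le hκ ?_
    rw [hRm, ← mul_div_assoc, le_div_iff₀ (by positivity)]
    calc (M n / n : ℝ) * (g₀ * V) ≤ (M n / n : ℝ) * (κ ^ m * (1 + δ)) := by gcongr
      _ = _ := by ring
  set S := Metric.closedBall y (R n) with hS
  have hSm : MeasurableSet S := Metric.isClosed_closedBall.measurableSet
  have hNS : N n * ν₁.real S ≤ L * B := by
    have h1 := hball₁ y (R n) hRn0 (hRn.trans_le (min_le_right _ _)) (by simp; positivity)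
    have h2 := (abs_le.1 h1).2
    calc N n * ν₁.real S ≤ N n * ((g₁ + g₀ * δ / (1 + δ)) * (V * R n ^ m)) := by
          gcongr; linarith
      _ = L * B := by rw [hRm, hL, hBdef]; field_simp
  set A : (Fin n → Euc m) → Set (Euc m) :=
    fun ys => outerCatch (M n) ε (rootRadius m (M n / n)) y ys \ S with hA
  have hAm : MeasurableSet {q : (Fin n → Euc m) × Euc m | q.2 ∈ A q.1} := by
    have h1 : MeasurableSet {q : (Fin n → Euc m) × Euc m |
        q.2 ∈ outerCatch (M n) ε (rootRadius m (M n / n)) y q.1} :=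
      (show Measurable fun q : (Fin n → Euc m) × Euc m => ((y, q.1), q.2) by fun_prop)
        (measurableSet_outerCatch_prod _ _ _)
    exact h1.diff (measurable_snd hSm)
  set G : Euc m → ℝ≥0∞ := fun w => {w | R n ≤ ‖y - w‖}.indicator
    (fun w => ENNReal.ofReal (Real.exp (-(c * M n * (‖y - w‖ / R n) ^ m)))) w
      + ENNReal.ofReal (Real.exp (-(n * β / 16))) with hG
  have hGle : ∀ᵐ w ∂ν₁, (Measure.pi fun _ : Fin n => ν₀) {ys | w ∈ A ys} ≤ G w := by
    filter_upwards [hfarβ] with w hwβ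
    by_cases hwS : w ∈ S
    · have : {ys | w ∈ A ys} = ∅ := eq_empty_of_forall_notMem fun ys h => h.2 hwS
      rw [this, measure_empty]; exact zero_le
    have hwR : R n ≤ ‖y - w‖ := by
      rw [hS, Metric.mem_closedBall, dist_eq_norm, norm_sub_rev] at hwS
      exact (not_le.1 hwS).le
    have hsub : {ys | w ∈ A ys} ⊆ {ys : Fin n → Euc m |
      w ∈ outerCatch (M n) ε (rootRadius m (M n / n)) y ys} := fun ys h => h.1
    refine (measure_mono hsub).trans ?_
    rcases lt_or_ge ‖y - w‖ ρ₀ with hnear | hfar'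
    · refine le_trans ?_ le_self_add
      rw [indicator_of_mem (show w ∈ {w | R n ≤ ‖y - w‖} from hwR), mul_assoc]
      have hD : 0 < ‖y - w‖ := hRn0.trans_le hwR
      refine measure_mem_outerCatch_le_near hn hM0 hRn0 hg₀ hRm hδ hδ' hε hu hκ hθm hεθ hwR ?_
      have h1 := hball₀ w ((1 - θ) * ‖y - w‖) (by nlinarith) (by nlinarith) (by nlinarith)
      have h2 := (abs_le.1 h1).1
      linarith
    · refine le_trans ?_ le_add_self
      refine measure_mem_outerCatch_le_far hRn0 hε hu hκ hθ hεθ hwR hfar' hwβ ?_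
      rw [div_lt_iff₀ hn'] at hMβ
      linarith
  have hGint : ENNReal.ofReal (N n / (δ * B)) * ∫⁻ w, G w ∂ν₁ ≤ ENNReal.ofReal (K / (M n : ℝ) ^ 2)
      + ENNReal.ofReal (1 / δ * (n * Real.exp (-(β / 16 * n)))) := by
    have hmeas : MeasurableSet {w : Euc m | R n ≤ ‖y - w‖} :=
      measurableSet_le measurable_const (by fun_prop)
    rw [hG, lintegral_add_right _ measurable_const, lintegral_const, measure_univ, mul_one,
      lintegral_indicator hmeas, mul_add]
    have hNδ : (N n : ℝ) / (δ * B) = n / (δ * M n) := by rw [hBdef]; field_simp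
    rw [hNδ]
    gcongr
    · calc _ ≤ ENNReal.ofReal (n / (δ * M n)) * ENNReal.ofReal
            (C₁ * (2 * 4 ^ m / (c * M n) ^ 2 * (J * R n ^ m))) := by
            gcongr
            exact lintegral_exp_neg_norm_le hJ hC₁0 hC₁ y hRn0 (by positivity)
        _ = _ := by
            rw [← ENNReal.ofReal_mul (by positivity), hRm, hK]
            congr 1; field_simp
    · rw [← ENNReal.ofReal_mul (by positivity)]
      apply ENNReal.ofReal_le_ofReal
      rw [show n * β / 16 = β / 16 * n by ring, ← mul_assoc]
      gcongr
      rw [div_le_iff₀ (by positivity)]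
      calc (n : ℝ) ≤ n * M n := le_mul_of_one_le_right hn'.le hM'
        _ = _ := by field_simp
  set π := (Measure.pi fun _ : Fin n => ν₀).prod (Measure.pi fun _ : Fin (N n) => ν₁)
  calc _ ≤ π (univ ×ˢ {ws | N n * ν₁.real S + δ * B ≤ hits S ws} ∪
        {q | δ * B ≤ hits (A q.1) q.2}) := by
        refine measure_mono fun q hq => ?_
        by_contra hcon
        rw [mem_union, not_or] at hcon
        have h1 : hits S q.2 < N n * ν₁.real S + δ * B := by
          by_contra h; exact hcon.1 ⟨mem_univ _, not_lt.1 h⟩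
        have h2 : hits (A q.1) q.2 < δ * B := not_le.1 hcon.2
        have h3 := hits_le_add (S := outerCatch (M n) ε (rootRadius m (M n / n)) y q.1)
          (A := S) (B := A q.1) (fun w hw => by
            by_cases h : w ∈ S
            · exact Or.inl h
            · exact Or.inr ⟨hw, h⟩) q.2
        have hq' : (1 + δ) * (g₁ / g₀) + 3 * δ < (n : ℝ) / N n *
            (hits (outerCatch (M n) ε (rootRadius m (M n / n)) y q.1) q.2 / M n) := hq
        refine absurd hq' (not_lt.2 ?_)
        have h4 : (n : ℝ) / N n *
            (hits (outerCatch (M n) ε (rootRadius m (M n / n)) y q.1) q.2 / M n)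
            = hits (outerCatch (M n) ε (rootRadius m (M n / n)) y q.1) q.2 / B := by
          rw [hBdef]; field_simp
        rw [h4, div_le_iff₀ hB0]
        -- The three errors δB are the density error (inside L), the fluctuation of the count in S,
        -- and the points outside S.
        have h5 : ((1 + δ) * (g₁ / g₀) + 3 * δ) * B = L * B + δ * B + δ * B := by rw [hL]; ring
        linarith
    _ ≤ _ := by
        refine (measure_union_le _ _).trans (add_le_add ?_ ?_)
        · rw [Measure.prod_prod, measure_univ, one_mul, one_mul]
          exact (measure_pi_hits_dense hSm hδ hB0 hLδ hNS).1
        · exact (prod_measure_hits_ge_le _ ν₁ hAm (by positivity) hGle).trans hGint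

-- Now R is slightly too small: the ball about y should hold only (1 − δ)M sample points. A point w
-- of that ball outside `innerCatch` needs M sample points within (1 + θ)R of w, where at most (1 −
-- δ/4)M are expected. Only w near y matter, so neither a tail integral nor a lower bound far away
-- is needed.
set_option maxHeartbeats 1000000 in
theorem tendsto_measure_innerCatch {m : ℕ} (hm : 0 < m) {ν₀ ν₁ : Measure (Euc m)}
    [IsProbabilityMeasure ν₀] [IsProbabilityMeasure ν₁] {M N : ℕ → ℕ} (hM : Tendsto M atTop atTop)
    (hMn : Tendsto (fun n : ℕ => (M n : ℝ) / n) atTop (𝓝 0))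
    (hB : Tendsto (fun n : ℕ => (M n : ℝ) * N n / n) atTop atTop)
    {y : Euc m} {g₀ g₁ : ℝ} (hg₀ : 0 < g₀) (hg₁ : 0 ≤ g₁) (hd₀ : HasDensityAt ν₀ g₀ y)
    (hd₁ : HasDensityAt ν₁ g₁ y)
    {δ ε θ κ : ℝ} (hδ : 0 < δ) (hδ' : δ ≤ 1 / 2) (hε : 0 ≤ ε) (hκ : 0 ≤ κ) (hθ0 : 0 < θ)
    (hκm : g₀ * unitBallVolume m ≤ κ ^ m * (1 - δ)) (hε' : ε < 1)
    (hθm : (1 - δ) * (1 + θ) ^ m ≤ 1 - δ / 2) (hεθ : 1 + ε + 2 * ε * κ ≤ (1 - ε) * (1 + θ)) :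
    Tendsto (fun n : ℕ => ((Measure.pi fun _ : Fin n => ν₀).prod
      (Measure.pi fun _ : Fin (N n) => ν₁)) {q | (n : ℝ) / N n *
          (hits (innerCatch (M n) ε (rootRadius m (M n / n)) y q.1) q.2 / M n) <
          (1 - δ) * (g₁ / g₀) - 3 * δ}) atTop (𝓝 0) := by
  have hV := unitBallVolume_pos m
  set V := unitBallVolume m with hVdef
  have hδ1 : 0 < 1 - δ := by linarith
  obtain ⟨ρ₀, hρ₀, hball₀⟩ := hd₀ (g₀ * (δ / 16)) (by positivity)
  obtain ⟨ρ₁, hρ₁, hball₁⟩ := hd₁ (g₀ * δ / (1 - δ)) (by positivity)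
  set L : ℝ := (1 - δ) * (g₁ / g₀) + δ with hL
  have hLδ : δ ≤ L := le_add_of_nonneg_left (by positivity)
  set R : ℕ → ℝ := fun n => rootRadius m ((1 - δ) * (M n / n) / (g₀ * V)) with hR
  have hRlim : Tendsto R atTop (𝓝 0) := by
    refine tendsto_rootRadius hm ?_
    simpa using (hMn.const_mul (1 - δ)).div_const (g₀ * V)
  have hMr : Tendsto (fun n => (M n : ℝ)) atTop atTop := tendsto_natCast_atTop_atTop.comp hM
  have hbound : Tendsto (fun n : ℕ => ENNReal.ofReal (1 * Real.exp (-(δ ^ 2 / (4 * L) *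
      ((M n : ℝ) * N n / n)))) + ENNReal.ofReal (L / δ * Real.exp (-(δ ^ 2 / 64 * M n))))
      atTop (𝓝 0) := by
    have h1 := tendsto_ofReal_exp_neg (c := δ ^ 2 / (4 * L)) (by positivity) hB 1
    have h2 := tendsto_ofReal_exp_neg (c := δ ^ 2 / 64) (by positivity) hMr (L / δ)
    simpa using h1.add h2
  refine tendsto_of_tendsto_of_tendsto_of_le_of_le' tendsto_const_nhds hbound
    (Eventually.of_forall fun _ => zero_le) ?_
  have hρ₀' : 0 < ρ₀ / (1 + θ) := by positivity
  filter_upwards [eventually_gt_atTop 0, hM.eventually_ge_atTop 1, hB.eventually_ge_atTop 1,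
    hRlim.eventually (gt_mem_nhds (lt_min hρ₀' hρ₁))] with n hn hM1 hB1 hRn
  have hn' : (0 : ℝ) < n := by exact_mod_cast hn
  have hM' : (1 : ℝ) ≤ M n := by exact_mod_cast hM1
  have hM0 : (0 : ℝ) < M n := by linarith
  have hRn0 : 0 < R n := rootRadius_pos (by positivity)
  have hRm : R n ^ m = (1 - δ) * (M n / n) / (g₀ * V) := rootRadius_pow hm (by positivity)
  set B : ℝ := (M n : ℝ) * N n / n with hBdef
  have hB0 : 0 < B := by linarith
  have hN : (0 : ℝ) < N n := by
    rcases Nat.eq_zero_or_pos (N n) with h | h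
    · rw [hBdef, h] at hB0; simp at hB0
    · exact_mod_cast h
  have hu : rootRadius m (M n / n) ≤ κ * R n := by
    refine rootRadius_le_mul hm (by positivity) hRn0.le hκ ?_
    rw [hRm, ← mul_div_assoc, le_div_iff₀ (by positivity)]
    calc (M n / n : ℝ) * (g₀ * V) ≤ (M n / n : ℝ) * (κ ^ m * (1 - δ)) := by gcongr
      _ = _ := by ring
  set S := Metric.closedBall y (R n) with hS
  have hSm : MeasurableSet S := Metric.isClosed_closedBall.measurableSet
  have hball := hball₁ y (R n) hRn0 (hRn.trans_le (min_le_right _ _)) (by simp; positivity)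
  have hNS : N n * ν₁.real S ≤ L * B := by
    have h2 := (abs_le.1 hball).2
    calc N n * ν₁.real S ≤ N n * ((g₁ + g₀ * δ / (1 - δ)) * (V * R n ^ m)) := by
          gcongr; linarith
      _ = L * B := by rw [hRm, hL, hBdef]; field_simp
  have hNS' : ((1 - δ) * (g₁ / g₀) - δ) * B ≤ N n * ν₁.real S := by
    have h2 := (abs_le.1 hball).1
    calc ((1 - δ) * (g₁ / g₀) - δ) * B
        = N n * ((g₁ - g₀ * δ / (1 - δ)) * (V * R n ^ m)) := by
          rw [hRm, hBdef]; field_simp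
      _ ≤ _ := by gcongr; linarith
  set A : (Fin n → Euc m) → Set (Euc m) :=
    fun ys => S \ innerCatch (M n) ε (rootRadius m (M n / n)) y ys with hA
  have hAm : MeasurableSet {q : (Fin n → Euc m) × Euc m | q.2 ∈ A q.1} := by
    have h1 : MeasurableSet {q : (Fin n → Euc m) × Euc m |
        q.2 ∈ innerCatch (M n) ε (rootRadius m (M n / n)) y q.1} :=
      (show Measurable fun q : (Fin n → Euc m) × Euc m => ((y, q.1), q.2) by fun_prop)
        (measurableSet_innerCatch_prod _ _ _)
    exact (measurable_snd hSm).diff h1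
  set G : Euc m → ℝ≥0∞ := S.indicator
    (fun _ => ENNReal.ofReal (Real.exp (-(δ ^ 2 / 64 * M n)))) with hG
  have hGle : ∀ᵐ w ∂ν₁, (Measure.pi fun _ : Fin n => ν₀) {ys | w ∈ A ys} ≤ G w := by
    refine ae_of_all _ fun w => ?_
    by_cases hwS : w ∈ S
    swap
    · have : {ys | w ∈ A ys} = ∅ := eq_empty_of_forall_notMem fun ys h => hwS h.1
      rw [this, measure_empty]; exact zero_le
    have hwR : ‖y - w‖ ≤ R n := by
      rwa [hS, Metric.mem_closedBall, dist_eq_norm, norm_sub_rev] at hwS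
    rw [hG, indicator_of_mem hwS]
    set q := ν₀.real (Metric.closedBall w ((1 + θ) * R n))
    have hq : n * q ≤ (1 - δ / 4) * M n := by
      have hRn' : R n < ρ₀ / (1 + θ) := hRn.trans_le (min_le_left _ _)
      rw [lt_div_iff₀ (by positivity)] at hRn'
      have h1 := hball₀ w ((1 + θ) * R n) (by positivity) (by linarith)
        (by nlinarith)
      have h2 := (abs_le.1 h1).2
      calc n * q ≤ n * ((1 + δ / 16) * g₀ * (V * ((1 + θ) * R n) ^ m)) := by gcongr; linarith
        _ = (1 + δ / 16) * ((1 - δ) * (1 + θ) ^ m) * M n := by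
            rw [mul_pow, hRm]; field_simp
        _ ≤ (1 + δ / 16) * (1 - δ / 2) * M n := by gcongr
        _ ≤ _ := by gcongr; nlinarith
    refine (measure_mono ?_).trans ((measure_hits_ge_le (N := n) ν₀
      (Metric.isClosed_closedBall (x := w) (ε := (1 + θ) * R n)).measurableSet (t := δ / 8)
      (by positivity) (by linarith) (δ / 4 * M n)).trans ?_)
    · intro ys hys
      have h1 : (M n : ℝ) ≤ hits {v | (1 - ε) * ‖v - w‖ < (1 + ε) * ‖y - w‖
        + 2 * ε * rootRadius m (M n / n)} ys := not_lt.1 hys.2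
      have h2 : n * q + δ / 4 * M n ≤ M n := by linarith
      refine h2.trans (h1.trans (hits_mono fun j hj => ?_))
      rw [Metric.mem_closedBall, dist_eq_norm]
      have hj' : (1 - ε) * ‖ys j - w‖ < (1 + ε) * ‖y - w‖ + 2 * ε * rootRadius m (M n / n) := hj
      have h3 : (1 - ε) * ‖ys j - w‖ ≤ (1 - ε) * ((1 + θ) * R n) := by
        calc _ ≤ (1 + ε) * R n + 2 * ε * (κ * R n) := by
              refine hj'.le.trans ?_
              gcongr
          _ = (1 + ε + 2 * ε * κ) * R n := by ring
          _ ≤ ((1 - ε) * (1 + θ)) * R n := by gcongr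
          _ = _ := by ring
      exact le_of_mul_le_mul_left h3 (by linarith)
    · apply ENNReal.ofReal_le_ofReal
      rw [Real.exp_le_exp]
      have h3 : n * q ≤ M n := hq.trans (by nlinarith)
      have h4 : n * q * (δ / 8) ^ 2 ≤ M n * (δ / 8) ^ 2 := by gcongr
      change n * q * (δ / 8) ^ 2 - δ / 8 * (δ / 4 * M n) ≤ _
      nlinarith
  have hGint : ENNReal.ofReal (N n / (δ * B)) * ∫⁻ w, G w ∂ν₁
      ≤ ENNReal.ofReal (L / δ * Real.exp (-(δ ^ 2 / 64 * M n))) := by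
    rw [hG, lintegral_indicator_const hSm, ← ofReal_measureReal,
      ← ENNReal.ofReal_mul (Real.exp_pos _).le, ← ENNReal.ofReal_mul (by positivity)]
    apply ENNReal.ofReal_le_ofReal
    calc _ = (N n * ν₁.real S) / (δ * B) * Real.exp (-(δ ^ 2 / 64 * M n)) := by ring
      _ ≤ (L * B) / (δ * B) * Real.exp (-(δ ^ 2 / 64 * M n)) := by gcongr
      _ = _ := by rw [mul_div_mul_right _ _ hB0.ne']
  set π := (Measure.pi fun _ : Fin n => ν₀).prod (Measure.pi fun _ : Fin (N n) => ν₁)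
  calc _ ≤ π (univ ×ˢ {ws | hits S ws ≤ N n * ν₁.real S - δ * B} ∪
        {q | δ * B ≤ hits (A q.1) q.2}) := by
        refine measure_mono fun q hq => ?_
        by_contra hcon
        rw [mem_union, not_or] at hcon
        have h1 : N n * ν₁.real S - δ * B < hits S q.2 := by
          by_contra h; exact hcon.1 ⟨mem_univ _, not_lt.1 h⟩
        have h2 : hits (A q.1) q.2 < δ * B := not_le.1 hcon.2
        have h3 := hits_le_add (S := S)
          (A := innerCatch (M n) ε (rootRadius m (M n / n)) y q.1) (B := A q.1) (fun w hw => by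
            by_cases h : w ∈ innerCatch (M n) ε (rootRadius m (M n / n)) y q.1
            · exact Or.inl h
            · exact Or.inr ⟨hw, h⟩) q.2
        have hq' : (n : ℝ) / N n *
            (hits (innerCatch (M n) ε (rootRadius m (M n / n)) y q.1) q.2 / M n) <
            (1 - δ) * (g₁ / g₀) - 3 * δ := hq
        refine absurd hq' (not_lt.2 ?_)
        have h4 : (n : ℝ) / N n *
            (hits (innerCatch (M n) ε (rootRadius m (M n / n)) y q.1) q.2 / M n)
            = hits (innerCatch (M n) ε (rootRadius m (M n / n)) y q.1) q.2 / B := by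
          rw [hBdef]; field_simp
        rw [h4, le_div_iff₀ hB0]
        linarith
    _ ≤ _ := by
        refine (measure_union_le _ _).trans (add_le_add ?_ ?_)
        · rw [Measure.prod_prod, measure_univ, one_mul, one_mul]
          exact (measure_pi_hits_dense hSm hδ hB0 hLδ hNS).2
        · exact (prod_measure_hits_ge_le _ ν₁ hAm (by positivity) hGle).trans hGint

/-! ### From the catchment area to counts, pathwise -/

/-- The M-th smallest value has index M − 1 after sorting, so it is at least b exactly when the
indices with value below b all precede M − 1, that is, when there are fewer than M of them. Ties do
no harm, and from here on order statistics are replaced by counts. -/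
theorem le_orderStat_iff {N M : ℕ} (hM : 1 ≤ M) (hMN : M ≤ N) (a : Fin N → ℝ) (b : ℝ) :
    b ≤ orderStat M a ↔ hits (Iio b) a < M := by
  have hlt : M - 1 < N := by omega
  have hmono := Tuple.monotone_sort a
  set σ := Tuple.sort a
  have hcount : hits (Iio b) a = ((Finset.univ.filter fun k => a (σ k) < b).card : ℝ) := by
    unfold hits
    rw [← Equiv.sum_comp σ, Finset.card_filter]
    push_cast
    refine Finset.sum_congr rfl fun k _ => ?_
    by_cases h : a (σ k) < b <;> simp [h]
  rw [hcount, Nat.cast_lt, orderStat, dif_pos hlt]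
  constructor
  · intro h
    have hsub : (Finset.univ.filter fun k => a (σ k) < b) ⊆ Finset.Iio ⟨M - 1, hlt⟩ := by
      intro k hk
      rw [Finset.mem_filter] at hk
      rw [Finset.mem_Iio]
      by_contra hcon
      exact absurd (h.trans (hmono (not_lt.1 hcon))) (not_le.2 hk.2)
    have := Finset.card_le_card hsub
    rw [Fin.card_Iio] at this
    simp only at this
    omega
  · intro h
    by_contra hcon
    have hsub : Finset.Iic ⟨M - 1, hlt⟩ ⊆ (Finset.univ.filter fun k => a (σ k) < b) := by
      intro k hk
      rw [Finset.mem_Iic] at hk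
      rw [Finset.mem_filter]
      exact ⟨Finset.mem_univ _, (hmono hk).trans_lt (not_le.1 hcon)⟩
    have := Finset.card_le_card hsub
    rw [Fin.card_Iic] at this
    simp only at this
    omega

/-- The increments of `ψ` differ from those of `φ` by at most `ε` times their size plus `u`. -/
def IncrementClose {d m : ℕ} (S : Set (Euc d)) (φ ψ : Euc d → Euc m) (ε u : ℝ) : Prop :=
  ∀ s ∈ S, ∀ t ∈ S, ‖(ψ s - φ s) - (ψ t - φ t)‖ ≤ ε * (‖φ s - φ t‖ + u)

section Deterministic

variable {d m n N M : ℕ} {SX SZ : Set (Euc d)} {φ ψ : Euc d → Euc m} {ε u : ℝ}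
  {xs : Fin n → Euc d} {zs : Fin N → Euc d} {x : Euc d}

theorem IncrementClose.norm_le (h : IncrementClose SX φ ψ ε u) {s t : Euc d} (hs : s ∈ SX)
    (ht : t ∈ SX) : ‖ψ s - ψ t‖ ≤ (1 + ε) * ‖φ s - φ t‖ + ε * u := by
  have h1 := h s hs t ht
  have h2 : ψ s - ψ t = (φ s - φ t) + ((ψ s - φ s) - (ψ t - φ t)) := by abel
  rw [h2]
  linarith [norm_add_le (φ s - φ t) ((ψ s - φ s) - (ψ t - φ t))]

theorem IncrementClose.le_norm (h : IncrementClose SX φ ψ ε u) {s t : Euc d} (hs : s ∈ SX)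
    (ht : t ∈ SX) : (1 - ε) * ‖φ s - φ t‖ - ε * u ≤ ‖ψ s - ψ t‖ := by
  have h1 := h s hs t ht
  have h2 : φ s - φ t = (ψ s - ψ t) - ((ψ s - φ s) - (ψ t - φ t)) := by abel
  have h3 := norm_sub_le (ψ s - ψ t) ((ψ s - φ s) - (ψ t - φ t))
  rw [← h2] at h3
  linarith

theorem mem_catchment_iff (hM : 1 ≤ M) (hMn : M ≤ n) {z : Euc d} :
    z ∈ catchment SZ M ψ xs x ↔
      z ∈ SZ ∧ hits (Iio ‖ψ x - ψ z‖) (fun i => ‖ψ (xs i) - ψ z‖) < M :=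
  and_congr_right fun _ => le_orderStat_iff hM hMn _ _

/-- Both sides of the comparison of distances are distorted, each by a factor 1 ± ε and a shift εu.
A sample point closer to φ(z) than φ(x) by this total margin is also closer under ψ, so it counts
against z. -/
theorem matchCount_le_outerCatch (h : IncrementClose SX φ ψ ε u) (hM : 1 ≤ M) (hMn : M ≤ n)
    (hx : x ∈ SX) (hxs : ∀ i, xs i ∈ SX) (hzs : ∀ j, zs j ∈ SX) :
    matchCount SZ M ψ xs zs x
      ≤ hits (outerCatch M ε u (φ x) fun i => φ (xs i)) fun j => φ (zs j) := by
  refine hits_mono (S := catchment SZ M ψ xs x) fun j hj => ?_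
  rw [mem_catchment_iff hM hMn] at hj
  refine lt_of_le_of_lt (hits_mono fun i hi => ?_) hj.2
  have hi' : (1 + ε) * ‖φ (xs i) - φ (zs j)‖ + 2 * ε * u < (1 - ε) * ‖φ x - φ (zs j)‖ := hi
  change ‖ψ (xs i) - ψ (zs j)‖ < ‖ψ x - ψ (zs j)‖
  linarith [h.norm_le (hxs i) (hzs j), h.le_norm hx (hzs j)]

theorem innerCatch_le_matchCount (h : IncrementClose SX φ ψ ε u) (hM : 1 ≤ M) (hMn : M ≤ n)
    (hx : x ∈ SX) (hxs : ∀ i, xs i ∈ SX) (hzs : ∀ j, zs j ∈ SX) (hzs' : ∀ j, zs j ∈ SZ) :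
    hits (innerCatch M ε u (φ x) fun i => φ (xs i)) (fun j => φ (zs j))
      ≤ matchCount SZ M ψ xs zs x := by
  refine hits_mono (S' := catchment SZ M ψ xs x) fun j hj => ?_
  rw [mem_catchment_iff hM hMn]
  refine ⟨hzs' j, lt_of_le_of_lt (hits_mono fun i hi => ?_) hj⟩
  have hi' : ‖ψ (xs i) - ψ (zs j)‖ < ‖ψ x - ψ (zs j)‖ := hi
  change (1 - ε) * ‖φ (xs i) - φ (zs j)‖ < (1 + ε) * ‖φ x - φ (zs j)‖ + 2 * ε * u
  linarith [h.le_norm (hxs i) (hzs j), h.norm_le hx (hzs j)]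

/-- Take the vertex as origin. Of two points p, q in one narrow cone with ‖q‖ ≤ ‖p‖, the point q is
nearer to p than the vertex is, and this survives relative perturbations 2ε. With l = ‖q‖/‖p‖,
comparing v' with l v gives ‖v' − v‖ ≤ (1/2 + 4ε)‖q‖ + (1 − l)‖v‖, while l‖v‖ ≥ (1 − 2ε)‖q‖; the
choice ε ≤ 1/32 leaves 1/2 + 6ε < 1. -/
theorem norm_sub_lt_of_narrow_cone {p q v v' e : Euc m} (hε : ε ≤ 1 / 32)
    (hq : 0 < ‖q‖) (hqp : ‖q‖ ≤ ‖p‖) (hp' : ‖p - ‖p‖ • e‖ ≤ ‖p‖ / 4)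
    (hq' : ‖q - ‖q‖ • e‖ ≤ ‖q‖ / 4) (hv : ‖v - p‖ ≤ 2 * ε * ‖p‖)
    (hv' : ‖v' - q‖ ≤ 2 * ε * ‖q‖) : ‖v' - v‖ < ‖v‖ := by
  have hp : 0 < ‖p‖ := hq.trans_le hqp
  set l := ‖q‖ / ‖p‖ with hl
  have hl0 : 0 ≤ l := by positivity
  have hl1 : l ≤ 1 := (div_le_one hp).2 hqp
  have hlp : l * ‖p‖ = ‖q‖ := div_mul_cancel₀ _ hp.ne'
  have h1 : v' - v = (v' - q) + (q - ‖q‖ • e) - l • (p - ‖p‖ • e) - l • (v - p) - (1 - l) • v := by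
    rw [smul_sub, smul_sub, smul_smul, hlp, sub_smul, one_smul]; abel
  have h2 : ‖v' - v‖ ≤ ‖v' - q‖ + ‖q - ‖q‖ • e‖ + l * ‖p - ‖p‖ • e‖ + l * ‖v - p‖
      + (1 - l) * ‖v‖ := by
    rw [h1]
    refine (norm_sub_le _ _).trans (add_le_add ((norm_sub_le _ _).trans (add_le_add
      ((norm_sub_le _ _).trans (add_le_add (norm_add_le _ _) ?_)) ?_)) ?_)
    · rw [norm_smul, Real.norm_of_nonneg hl0]
    · rw [norm_smul, Real.norm_of_nonneg hl0]
    · rw [norm_smul, Real.norm_of_nonneg (by linarith)]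
  have h3 : l * ‖p - ‖p‖ • e‖ ≤ ‖q‖ / 4 := by
    calc _ ≤ l * (‖p‖ / 4) := by gcongr
      _ = _ := by rw [← mul_div_assoc, hlp]
  have h4 : l * ‖v - p‖ ≤ 2 * ε * ‖q‖ := by
    calc _ ≤ l * (2 * ε * ‖p‖) := by gcongr
      _ = 2 * ε * (l * ‖p‖) := by ring
      _ = _ := by rw [hlp]
  have h5 : (1 - 2 * ε) * ‖p‖ ≤ ‖v‖ := by
    have := norm_sub_norm_le p (p - v)
    rw [sub_sub_cancel, norm_sub_rev p v] at this
    linarith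
  have h6 : (1 - 2 * ε) * ‖q‖ ≤ l * ‖v‖ := by
    calc _ = l * ((1 - 2 * ε) * ‖p‖) := by rw [← hlp]; ring
      _ ≤ _ := by gcongr
  nlinarith

/-- Stone's cone argument. Beyond distance u the additive error is dominated by the distance, so
displacements relative to x are perturbed by a relative error of at most 2ε. Sample points in the
same cone and no farther out than φ(z) are then strictly closer to z than x is under ψ, and M of
them exclude z. -/
theorem matchCount_le_crudeCount {es : Finset (Euc m)}
    (hes : ∀ v : Euc m, ∃ e ∈ es, v ≠ 0 → ‖v - ‖v‖ • e‖ ≤ ‖v‖ / 4)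
    (h : IncrementClose SX φ ψ ε u) (hε0 : 0 ≤ ε) (hε : ε ≤ 1 / 32) (hu : 0 < u) (hM : 1 ≤ M)
    (hMn : M ≤ n) (hx : x ∈ SX) (hxs : ∀ i, xs i ∈ SX) (hzs : ∀ j, zs j ∈ SX) :
    matchCount SZ M ψ xs zs x
      ≤ crudeCount es M u (φ x) (fun i => φ (xs i)) fun j => φ (zs j) := by
  set y := φ x
  set ys : Fin n → Euc m := fun i => φ (xs i)
  set T : es → Set (Euc m) := fun e => sparsePart (coneAt y e u) (fun w => ‖w - y‖) M ys
  have hclose : ∀ s ∈ SX, u ≤ ‖φ s - y‖ →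
      ‖(ψ s - ψ x) - (φ s - y)‖ ≤ 2 * ε * ‖φ s - y‖ := by
    intro s hs hus
    have h1 := h s hs x hx
    have h2 : (ψ s - ψ x) - (φ s - y) = (ψ s - φ s) - (ψ x - φ x) := by simp only [y]; abel
    rw [h2]
    calc _ ≤ ε * (‖φ s - y‖ + u) := h1
      _ ≤ ε * (‖φ s - y‖ + ‖φ s - y‖) := by gcongr
      _ = _ := by ring
  have hmain : matchCount SZ M ψ xs zs x
      ≤ hits (Metric.closedBall y u ∪ ⋃ e, T e) fun j => φ (zs j) := by
    refine hits_mono (S := catchment SZ M ψ xs x) fun j hj => ?_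
    rw [mem_catchment_iff hM hMn] at hj
    rcases le_or_gt ‖φ (zs j) - y‖ u with hle | hgt
    · exact Or.inl (by rwa [Metric.mem_closedBall, dist_eq_norm])
    obtain ⟨e, he, hcone⟩ := hes (φ (zs j) - y)
    have hcone' := hcone (norm_pos_iff.1 (hu.trans hgt))
    refine Or.inr (mem_iUnion.2 ⟨⟨e, he⟩, ⟨⟨hgt.le, hcone'⟩,
      lt_of_le_of_lt (hits_mono fun i hi => ?_) hj.2⟩⟩)
    obtain ⟨⟨hui, hconei⟩, hle⟩ := hi
    have := norm_sub_lt_of_narrow_cone hε (hu.trans_le hui) hle hcone' hconei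
      (hclose _ (hzs j) hgt.le) (hclose _ (hxs i) hui)
    rw [sub_sub_sub_cancel_right] at this
    change ‖ψ (xs i) - ψ (zs j)‖ < ‖ψ x - ψ (zs j)‖
    rwa [norm_sub_rev (ψ x)]
  refine hmain.trans ((hits_le_add subset_rfl _).trans (add_le_add le_rfl ?_))
  refine (hits_iUnion_le T _).trans_eq ?_
  exact Finset.sum_coe_sort es fun e =>
    hits (sparsePart (coneAt y e u) (fun w => ‖w - y‖) M ys) fun j => φ (zs j)

end Deterministic

/-! ### Consequence of the approximation conditions for bad events -/

theorem exists_small_parameters {m : ℕ} {δ κ ε₁ : ℝ} (hδ : 0 < δ) (hε₁ : 0 < ε₁) :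
    ∃ ε θ : ℝ, 0 < ε ∧ ε ≤ ε₁ ∧ ε < 1 ∧ 0 < θ ∧ θ ≤ 1 / 2 ∧
      1 + δ / 2 ≤ (1 + δ) * (1 - θ) ^ m ∧ (1 - δ) * (1 + θ) ^ m ≤ 1 - δ / 2 ∧
      (1 + ε) * (1 - θ) + 2 * ε * κ < 1 - ε ∧ 1 + ε + 2 * ε * κ ≤ (1 - ε) * (1 + θ) := by
  have hpos : ∀ᶠ t in 𝓝[>] (0 : ℝ), 0 < t := eventually_mem_nhdsWithin
  have hlim : ∀ f : ℝ → ℝ, Continuous f → Tendsto f (𝓝[>] 0) (𝓝 (f 0)) :=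
    fun f hf => (hf.tendsto 0).mono_left nhdsWithin_le_nhds
  have h1 : ∀ᶠ t in 𝓝[>] (0 : ℝ), t < 1 / 2 :=
    (hlim (fun t => t) (by fun_prop)).eventually (gt_mem_nhds (by norm_num))
  have h2 : ∀ᶠ t in 𝓝[>] (0 : ℝ), 1 + δ / 2 < (1 + δ) * (1 - t) ^ m :=
    (hlim (fun t => (1 + δ) * (1 - t) ^ m) (by fun_prop)).eventually
      (lt_mem_nhds (by simp; linarith))
  have h3 : ∀ᶠ t in 𝓝[>] (0 : ℝ), (1 - δ) * (1 + t) ^ m < 1 - δ / 2 :=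
    (hlim (fun t => (1 - δ) * (1 + t) ^ m) (by fun_prop)).eventually
      (gt_mem_nhds (by simp; linarith))
  -- First θ is fixed from δ and m; only then is ε chosen, small compared with θ and 1/κ.
  obtain ⟨θ, hθ0, hθ1, hθ2, hθ3⟩ := (hpos.and (h1.and (h2.and h3))).exists
  have h4 : ∀ᶠ t in 𝓝[>] (0 : ℝ), (1 + t) * (1 - θ) + 2 * t * κ - (1 - t) < 0 :=
    (hlim (fun t => (1 + t) * (1 - θ) + 2 * t * κ - (1 - t)) (by fun_prop)).eventually
      (gt_mem_nhds (by simp; linarith))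
  have h5 : ∀ᶠ t in 𝓝[>] (0 : ℝ), 1 + t + 2 * t * κ - (1 - t) * (1 + θ) < 0 :=
    (hlim (fun t => 1 + t + 2 * t * κ - (1 - t) * (1 + θ)) (by fun_prop)).eventually
      (gt_mem_nhds (by simp; linarith))
  have h6 : ∀ᶠ t in 𝓝[>] (0 : ℝ), t < min ε₁ 1 :=
    (hlim (fun t => t) (by fun_prop)).eventually (gt_mem_nhds (by simp [hε₁]))
  obtain ⟨ε, hε0, hε4, hε5, hε6⟩ := (hpos.and (h4.and (h5.and h6))).exists
  exact ⟨ε, θ, hε0, hε6.le.trans (min_le_left _ _), hε6.trans_le (min_le_right _ _), hθ0, hθ1.le,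
    hθ2.le, hθ3.le, by linarith, by linarith⟩

/-- A geometric sum with ratio at least 2 is at most twice its largest term, and only powers not
exceeding h occur. -/
theorem tsum_pow_indicator_le {x : ℝ≥0∞} (hx : 2 ≤ x) (h : ℝ≥0∞) :
    ∑' i : ℕ, {t | x ^ i ≤ t}.indicator (fun _ => x ^ i) h ≤ 2 * h := by
  have hgeom : ∀ k : ℕ, ∑ i ∈ Finset.range k, x ^ i ≤ x ^ k := by
    intro k
    induction k with
    | zero => simp
    | succ k ih =>
      rw [Finset.sum_range_succ]
      calc _ ≤ x ^ k + x ^ k := by gcongr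
        _ = x ^ k * 2 := by rw [mul_two]
        _ ≤ _ := by rw [pow_succ]; gcongr
  refine ENNReal.tsum_le_of_sum_range_le fun k => ?_
  induction k with
  | zero => simp
  | succ k ih =>
    rw [Finset.sum_range_succ]
    by_cases hk : x ^ k ≤ h
    · rw [indicator_of_mem (show h ∈ {t | x ^ k ≤ t} from hk)]
      calc _ ≤ ∑ i ∈ Finset.range k, x ^ i + x ^ k := by
            gcongr with i hi
            exact indicator_le_self _ _ _
        _ ≤ x ^ k + x ^ k := by gcongr; exact hgeom k
        _ = 2 * x ^ k := by rw [two_mul]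
        _ ≤ _ := by gcongr
    · rw [indicator_of_notMem (show h ∉ {t | x ^ k ≤ t} from hk), add_zero]
      exact ih

section Approximation

variable {Ω : Type*} [MeasurableSpace Ω] {μ : Measure Ω} {d m p : ℕ} {SX SZ : Set (Euc d)}
  {φ : Euc d → Euc m}

theorem le_supDist_of_not_incrementClose {ψ : Euc d → Euc m} {ε u : ℝ} (hε : 0 ≤ ε)
    (h : ¬ IncrementClose SX φ ψ ε u) : ENNReal.ofReal (ε / 2 * u) ≤ supDist SX ψ φ := by
  unfold IncrementClose at h
  push Not at h
  obtain ⟨s, hs, t, ht, hst⟩ := h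
  have h1 := norm_sub_le (ψ s - φ s) (ψ t - φ t)
  have h2 : 0 ≤ ε * ‖φ s - φ t‖ := by positivity
  have key : ∀ r ∈ SX, ε / 2 * u ≤ ‖ψ r - φ r‖ → ENNReal.ofReal (ε / 2 * u) ≤ supDist SX ψ φ := by
    intro r hr hle
    refine (ENNReal.ofReal_le_ofReal hle).trans ?_
    rw [ofReal_norm]
    exact le_iSup₂ (f := fun t (_ : t ∈ SX) => ‖ψ t - φ t‖ₑ) r hr
  rcases le_or_gt (ε / 2 * u) ‖ψ s - φ s‖ with h3 | h3
  · exact key s hs h3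
  · exact key t ht (by nlinarith)

theorem lt_incrementModulus_of_not_incrementClose {ψ : (Fin p → Euc d) → Euc d → Euc m}
    {z : Fin p → Euc d} (hz : ∀ k, z k ∈ SZ) {ε u : ℝ} (hε : 0 ≤ ε) (hu : 0 < u)
    (h : ¬ IncrementClose SX φ (ψ z) ε u) :
    ENNReal.ofReal ε < incrementModulus SX SZ φ ψ u := by
  unfold IncrementClose at h
  push Not at h
  obtain ⟨s, hs, t, ht, hst⟩ := h
  set D := max ‖φ s - φ t‖ u
  have hD : 0 < D := hu.trans_le (le_max_right _ _)
  have hlt : ε < D⁻¹ * ‖(ψ z s - φ s) - (ψ z t - φ t)‖ := by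
    rw [← div_eq_inv_mul, lt_div_iff₀ hD]
    refine lt_of_le_of_lt ?_ hst
    gcongr
    exact max_le (by linarith) (by linarith [norm_nonneg (φ s - φ t)])
  have h1 : ENNReal.ofReal D⁻¹ * ‖(ψ z s - φ s) - (ψ z t - φ t)‖ₑ
      ≤ incrementModulus SX SZ φ ψ u := by
    unfold incrementModulus
    refine le_iSup₂_of_le D (le_max_right _ _) ?_
    gcongr
    refine le_iSup₂_of_le s hs (le_iSup₂_of_le t ht ?_)
    exact le_iSup_of_le (le_max_left _ _) (le_iSup₂_of_le z hz le_rfl)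
  refine lt_of_lt_of_le ?_ h1
  rw [← ofReal_norm, ← ENNReal.ofReal_mul (by positivity)]
  exact (ENNReal.ofReal_lt_ofReal_iff (lt_of_le_of_lt hε hlt)).2 hlt

theorem incrementModulus_anti {ψ : (Fin p → Euc d) → Euc d → Euc m} {u v : ℝ} (h : u ≤ v) :
    incrementModulus SX SZ φ ψ v ≤ incrementModulus SX SZ φ ψ u :=
  iSup_mono fun _ => iSup_le fun hδ => le_iSup_of_le (h.trans hδ) le_rfl

variable {M N₁ : ℕ → ℕ} {φhat : Estimator d m N₁} {X : Ω → Euc d} {Xs Zs : ℕ → Ω → Euc d}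

/-- The event that the increments of the estimator at the random point are not close to those of
`φ`. -/
def badEvent (SX : Set (Euc d)) (φ : Euc d → Euc m) (φhat : Estimator d m N₁) (X : Ω → Euc d)
    (Xs Zs : ℕ → Ω → Euc d) (ε : ℝ) (n : ℕ) (u : ℝ) : Set Ω :=
  {ω | ¬ IncrementClose SX φ (φhat n (fun i => Xs i ω) (fun j => Zs j ω) (X ω)) ε u}

theorem replaceFirst_self (N p : ℕ) (f : ℕ → Euc d) :
    replaceFirst (fun j : Fin N => f j) (fun k : Fin p => f k) = fun j : Fin N => f j := by
  funext j
  unfold replaceFirst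
  split_ifs <;> rfl

theorem tendsto_of_const_mul_le {c : ℝ} (hc : 0 < c) {f g : ℕ → ℝ≥0∞}
    (hg : Tendsto g atTop (𝓝 0)) (h : ∀ᶠ n in atTop, ENNReal.ofReal c * f n ≤ g n) :
    Tendsto f atTop (𝓝 0) := by
  have h1 : Tendsto (fun n => ENNReal.ofReal c⁻¹ * g n) atTop (𝓝 0) := by
    simpa using ENNReal.Tendsto.const_mul hg (Or.inr ENNReal.ofReal_ne_top)
  refine tendsto_of_tendsto_of_tendsto_of_le_of_le' tendsto_const_nhds h1
    (Eventually.of_forall fun _ => zero_le) ?_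
  filter_upwards [h] with n hn
  calc f n = ENNReal.ofReal c⁻¹ * (ENNReal.ofReal c * f n) := by
        rw [← mul_assoc, ← ENNReal.ofReal_mul (by positivity), inv_mul_cancel₀ hc.ne',
          ENNReal.ofReal_one, one_mul]
    _ ≤ _ := by gcongr

/-- On the bad event at scale u_i the sup-norm error is at least εu_i/2, so the quantity in (A) is
at least c·2^{pi} with c = (ε/2)^{pm}. The weighted sum of indicators is then at most 2/c times that
quantity. -/
theorem SupNormCondition.tendsto_tsum_badEvent (hm : 0 < m) (hp : 0 < p)
    (h : SupNormCondition μ p SX SZ φ M N₁ φhat X Xs Zs) (hM : Tendsto M atTop atTop)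
    (hZ : ∀ᵐ ω ∂μ, ∀ j, Zs j ω ∈ SZ) {ε : ℝ} (hε : 0 < ε) :
    Tendsto (fun n : ℕ => ∑' i : ℕ, ((2 : ℝ≥0∞) ^ p) ^ i *
      μ (badEvent SX φ φhat X Xs Zs ε n (rootRadius m (2 ^ i * (M n / n))))) atTop (𝓝 0) := by
  set c : ℝ := (ε / 2) ^ (p * m) with hc
  have hc0 : 0 < c := by positivity
  refine tendsto_of_const_mul_le (c := c / 2) (by positivity) h ?_
  filter_upwards [eventually_gt_atTop 0, hM.eventually_gt_atTop 0] with n hn hMn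
  have hn' : (0 : ℝ) < n := by exact_mod_cast hn
  have hM' : (0 : ℝ) < M n := by exact_mod_cast hMn
  have hc' : ENNReal.ofReal c ≠ 0 := by simpa using hc0
  -- The outer expectation is bounded below by treating each measurable majorant G separately, so
  -- tail probabilities are those of a measurable function.
  refine le_iInf fun G => le_iInf fun hG => le_iInf fun hFG => ?_
  have hbad : ∀ i : ℕ, μ (badEvent SX φ φhat X Xs Zs ε n (rootRadius m (2 ^ i * (M n / n))))
      ≤ μ {ω | ((2 : ℝ≥0∞) ^ p) ^ i ≤ G ω / ENNReal.ofReal c} := by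
    intro i
    refine measure_mono_ae ?_
    filter_upwards [hZ] with ω hω hbadω
    change ((2 : ℝ≥0∞) ^ p) ^ i ≤ G ω / ENNReal.ofReal c
    rw [ENNReal.le_div_iff_mul_le (Or.inl hc') (Or.inl ENNReal.ofReal_ne_top)]
    refine le_trans ?_ (hFG ω)
    have h1 := le_supDist_of_not_incrementClose hε.le hbadω
    set u := rootRadius m (2 ^ i * (M n / n))
    have hu : u ^ m = 2 ^ i * (M n / n) := rootRadius_pow hm (by positivity)
    have hu0 : 0 < u := rootRadius_pos (by positivity)
    calc ((2 : ℝ≥0∞) ^ p) ^ i * ENNReal.ofReal c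
        = ENNReal.ofReal (((n : ℝ) / M n) ^ p) * ENNReal.ofReal (ε / 2 * u) ^ (p * m) := by
          rw [← ENNReal.ofReal_pow (by positivity), ← ENNReal.ofReal_mul (by positivity), mul_pow,
            ← hc, pow_mul' u, hu, mul_pow, ← pow_mul, ← pow_mul, mul_comm i p,
            show (2 : ℝ≥0∞) = ENNReal.ofReal 2 by simp, ← ENNReal.ofReal_pow (by positivity),
            ← ENNReal.ofReal_mul (by positivity)]
          congr 1
          have e : (n : ℝ) / M n * (M n / n) = 1 := by field_simp
          rw [show ((n : ℝ) / M n) ^ p * (c * (2 ^ (p * i) * ((M n : ℝ) / n) ^ p))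
            = 2 ^ (p * i) * c * ((n : ℝ) / M n * (M n / n)) ^ p by rw [mul_pow]; ring, e, one_pow,
            mul_one]
      _ ≤ _ := by
          refine mul_le_mul' le_rfl ?_
          -- Replacing the first entries of the sample by themselves changes nothing, so the
          -- supremum over z dominates the original estimator.
          refine le_iSup₂_of_le (fun k : Fin p => Zs k ω) (fun k => hω k) ?_
          rw [replaceFirst_self (N₁ n) p fun j => Zs j ω]
          exact pow_le_pow_left' h1 _
  calc _ ≤ ENNReal.ofReal (c / 2) * ∑' i : ℕ, ((2 : ℝ≥0∞) ^ p) ^ i *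
        μ {ω | ((2 : ℝ≥0∞) ^ p) ^ i ≤ G ω / ENNReal.ofReal c} :=
        mul_le_mul' le_rfl (ENNReal.tsum_le_tsum fun i => mul_le_mul' le_rfl (hbad i))
    _ = ENNReal.ofReal (c / 2) * ∫⁻ ω, ∑' i : ℕ, {t | ((2 : ℝ≥0∞) ^ p) ^ i ≤ t}.indicator
        (fun _ => ((2 : ℝ≥0∞) ^ p) ^ i) (G ω / ENNReal.ofReal c) ∂μ := by
        have hGc : Measurable fun ω => G ω / ENNReal.ofReal c := hG.div_const _
        rw [lintegral_tsum (f := fun i ω => {t | ((2 : ℝ≥0∞) ^ p) ^ i ≤ t}.indicator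
          (fun _ => ((2 : ℝ≥0∞) ^ p) ^ i) (G ω / ENNReal.ofReal c))
          fun i => ((measurable_const.indicator measurableSet_Ici).comp hGc).aemeasurable]
        congr 1
        refine tsum_congr fun i => ?_
        exact (lintegral_indicator_const (hGc measurableSet_Ici) _).symm
    _ ≤ ENNReal.ofReal (c / 2) * ∫⁻ ω, 2 * (G ω / ENNReal.ofReal c) ∂μ := by
        gcongr with ω
        refine tsum_pow_indicator_le ?_ _
        calc (2 : ℝ≥0∞) = 2 ^ 1 := (pow_one _).symm
          _ ≤ 2 ^ p := pow_le_pow_right₀ (by norm_num) hp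
    _ = _ := by
        rw [← lintegral_const_mul' _ _ ENNReal.ofReal_ne_top]
        refine lintegral_congr fun ω => ?_
        rw [← mul_assoc, show (2 : ℝ≥0∞) = ENNReal.ofReal 2 by simp,
          ← ENNReal.ofReal_mul (by positivity), div_mul_cancel₀ _ two_ne_zero,
          ENNReal.mul_div_cancel hc' ENNReal.ofReal_ne_top]

/-- The increment modulus decreases in u, so `T` at any v^{1/m} with v ≤ 2^i M/n bounds the bad
event at scale u_i. Summing the integral of (B) with k = p over dyadic intervals produces the
weights 2^{pi}. -/
theorem IncrementCondition.tendsto_tsum_badEvent (hm : 0 < m) (hp : 0 < p)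
    (h : IncrementCondition μ p SX SZ φ M N₁ φhat X Xs Zs) (hM : Tendsto M atTop atTop)
    (hZ : ∀ᵐ ω ∂μ, ∀ j, Zs j ω ∈ SZ) {ε : ℝ} (hε : 0 < ε) :
    Tendsto (fun n : ℕ => ∑' i : ℕ, ((2 : ℝ≥0∞) ^ p) ^ i *
      μ (badEvent SX φ φhat X Xs Zs ε n (rootRadius m (2 ^ i * (M n / n))))) atTop (𝓝 0) := by
  obtain ⟨⟨T, hT, hlim⟩, -⟩ := h
  refine tendsto_of_const_mul_le (c := (1 / 2) ^ p) (by positivity) (hlim ε hε p hp le_rfl) ?_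
  filter_upwards [eventually_gt_atTop 0, hM.eventually_gt_atTop 0] with n hn hMn
  have hn' : (0 : ℝ) < n := by exact_mod_cast hn
  have hM' : (0 : ℝ) < M n := by exact_mod_cast hMn
  set b : ℝ := M n / n with hb
  have hb0 : 0 < b := by positivity
  -- The interval ending at 2^i b has left endpoint and length f i, hence contributes at least (f
  -- i)^p times the probability; halving is the source of the constant (1/2)^p.
  set f : ℕ → ℝ := fun i => 2 ^ i * b / 2 with hf
  have hf0 : ∀ i, 0 < f i := fun i => by positivity
  have hf1 : ∀ i, f (i + 1) = 2 ^ i * b := fun i => by simp only [hf, pow_succ]; ring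
  have hfmono : Monotone f := monotone_nat_of_le_succ fun i => by
    rw [hf1]; simp only [hf]; linarith [show 0 < 2 ^ i * b by positivity]
  have hbad : ∀ i, ∀ v ∈ Ioc (f i) (f (i + 1)),
      μ (badEvent SX φ φhat X Xs Zs ε n (rootRadius m (2 ^ i * b)))
        ≤ T ε n (v ^ (1 / (m : ℝ))) := by
    intro i v hv
    have hv0 : 0 < v := (hf0 i).trans hv.1
    refine le_trans (measure_mono_ae ?_) (hT ε hε n _ (Real.rpow_pos_of_pos hv0 _))
    filter_upwards [hZ] with ω hω hbadω
    rw [hf1] at hv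
    have h1 : v ^ (1 / (m : ℝ)) ≤ rootRadius m (2 ^ i * b) :=
      Real.rpow_le_rpow hv0.le hv.2 (by positivity)
    refine lt_of_lt_of_le ?_ (incrementModulus_anti h1)
    refine lt_incrementModulus_of_not_incrementClose (z := fun k : Fin p => Zs k ω)
      (fun k => hω k) hε.le (rootRadius_pos (by positivity)) ?_
    rw [replaceFirst_self (N₁ n) p fun j => Zs j ω]
    exact hbadω
  have hint : ∑' i : ℕ, ENNReal.ofReal (f i ^ p) *
        μ (badEvent SX φ φhat X Xs Zs ε n (rootRadius m (2 ^ i * b)))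
      ≤ ∫⁻ u in Ioi (0 : ℝ), ENNReal.ofReal (u ^ (p - 1)) * T ε n (u ^ (1 / (m : ℝ))) := by
    have hsub : ⋃ i, Ioc (f i) (f (i + 1)) ⊆ Ioi 0 :=
      iUnion_subset fun i v hv => (hf0 i).trans hv.1
    refine le_trans ?_ (lintegral_mono_set hsub)
    have hdisj : Pairwise (Function.onFun Disjoint fun i => Ioc (f i) (f (i + 1))) :=
      hfmono.pairwise_disjoint_on_Ioc_succ
    rw [lintegral_iUnion (fun i => measurableSet_Ioc) hdisj]
    refine ENNReal.tsum_le_tsum fun i => ?_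
    calc _ = ∫⁻ _ in Ioc (f i) (f (i + 1)), ENNReal.ofReal (f i ^ (p - 1)) *
          μ (badEvent SX φ φhat X Xs Zs ε n (rootRadius m (2 ^ i * b))) := by
          rw [setLIntegral_const, Real.volume_Ioc, show f (i + 1) - f i = f i by
            rw [hf1]; simp only [hf]; ring, mul_right_comm,
            ← ENNReal.ofReal_mul (pow_nonneg (hf0 i).le _), pow_sub_one_mul hp.ne']
      _ ≤ _ := by
          refine setLIntegral_mono' measurableSet_Ioc fun v hv => ?_
          gcongr
          · exact hv.1.le
          · exact hbad i v hv
  calc _ = ENNReal.ofReal (((n : ℝ) / M n) ^ p) * ∑' i : ℕ, ENNReal.ofReal (f i ^ p) *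
        μ (badEvent SX φ φhat X Xs Zs ε n (rootRadius m (2 ^ i * b))) := by
        rw [← ENNReal.tsum_mul_left, ← ENNReal.tsum_mul_left]
        refine tsum_congr fun i => ?_
        rw [← mul_assoc, ← mul_assoc, ← pow_mul, show (2 : ℝ≥0∞) = ENNReal.ofReal 2 by simp,
          ← ENNReal.ofReal_pow (by positivity), ← ENNReal.ofReal_mul (by positivity),
          ← ENNReal.ofReal_mul (by positivity)]
        congr 2
        simp only [hf, hb, div_pow, mul_pow, one_pow, ← pow_mul, mul_comm i p]
        field_simp
    _ ≤ _ := by gcongr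

end Approximation

/-! ### Joint law of the point and the samples -/

theorem map_pi_option_sum {E : Type*} [MeasurableSpace E] {n N : ℕ}
    (P : Option (Fin n ⊕ Fin N) → Measure E) [∀ i, IsProbabilityMeasure (P i)] :
    (Measure.pi P).map (fun W => (W none, (fun i => W (some (Sum.inl i))),
        fun j => W (some (Sum.inr j))))
      = (P none).prod ((Measure.pi fun i => P (some (Sum.inl i))).prod
        (Measure.pi fun j => P (some (Sum.inr j)))) := by
  have h1 : MeasurePreserving (MeasurableEquiv.piOptionEquivProd fun _ => E).symm
      ((Measure.pi fun i => P (some i)).prod (P none)) (Measure.pi P) :=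
    ⟨MeasurableEquiv.measurable _, Measure.pi_map_piOptionEquivProd P⟩
  have h2 := (measurePreserving_sumPiEquivProdPi (fun i => P (some i))).prod
    (MeasurePreserving.id (P none))
  have h3 := (Measure.measurePreserving_swap.comp h2).comp h1.symm
  exact h3.map_eq

section SampleLaw

variable {Ω : Type*} [MeasurableSpace Ω] {μ : Measure Ω} {d m : ℕ}
  {X Z : Ω → Euc d} {Xs Zs : ℕ → Ω → Euc d} {φ : Euc d → Euc m}

/-- The images under `φ` of the point and of the two samples. -/
def sampleImage (φ : Euc d → Euc m) (X : Ω → Euc d) (Xs Zs : ℕ → Ω → Euc d) (n N : ℕ) (ω : Ω) :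
    Euc m × (Fin n → Euc m) × (Fin N → Euc m) :=
  (φ (X ω), (fun i => φ (Xs i ω)), fun j => φ (Zs j ω))

theorem aemeasurable_sampleImage (hX : Measurable X) (hXs : ∀ i, IdentDistrib (Xs i) X μ μ)
    (hZs : ∀ j, IdentDistrib (Zs j) Z μ μ) (hφ : Measurable φ) (n N : ℕ) :
    AEMeasurable (sampleImage φ X Xs Zs n N) μ :=
  (hφ.comp hX).aemeasurable.prodMk ((aemeasurable_pi_lambda
    (fun ω (i : Fin n) => φ (Xs i ω)) fun i =>
      hφ.comp_aemeasurable (hXs i).aemeasurable_fst).prodMk (aemeasurable_pi_lambda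
    (fun ω (j : Fin N) => φ (Zs j ω)) fun j =>
      hφ.comp_aemeasurable (hZs j).aemeasurable_fst))

/-- This product form allows φ(X) to be frozen at a value y while both samples keep their laws. It
concerns φ only; the estimator of φ never enters it. -/
theorem map_sampleImage [IsProbabilityMeasure μ] (hX : Measurable X)
    (hXs : ∀ i, IdentDistrib (Xs i) X μ μ)
    (hZs : ∀ j, IdentDistrib (Zs j) Z μ μ) (hindep : iIndepFun (twoSampleFamily X Xs Zs) μ)
    (hφ : Measurable φ) (n N : ℕ) :
    μ.map (sampleImage φ X Xs Zs n N) = (μ.map fun ω => φ (X ω)).prod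
      ((Measure.pi fun _ : Fin n => μ.map fun ω => φ (X ω)).prod
        (Measure.pi fun _ : Fin N => μ.map fun ω => φ (Z ω))) := by
  set g : Option (Fin n ⊕ Fin N) → Option (ℕ ⊕ ℕ) := Option.map (Sum.map (fun i => i) (fun j => j))
  have hg : Function.Injective g := Option.map_injective
    (Sum.map_injective.2 ⟨Fin.val_injective, Fin.val_injective⟩)
  set W : Option (Fin n ⊕ Fin N) → Ω → Euc m := fun i ω => φ (twoSampleFamily X Xs Zs (g i) ω)
  have hWind : iIndepFun W μ := (hindep.comp (fun _ => φ) fun _ => hφ).precomp hg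
  have hWm : ∀ i, AEMeasurable (W i) μ := by
    rintro (_ | i | j)
    · exact (hφ.comp hX).aemeasurable
    · exact hφ.comp_aemeasurable (hXs i).aemeasurable_fst
    · exact hφ.comp_aemeasurable (hZs j).aemeasurable_fst
  have hmap := (iIndepFun_iff_map_fun_eq_pi_map hWm).1 hWind
  have : ∀ i, IsProbabilityMeasure (μ.map (W i)) := fun i =>
    Measure.isProbabilityMeasure_map (hWm i)
  have h1 := map_pi_option_sum fun i => μ.map (W i)
  rw [← hmap, AEMeasurable.map_map_of_aemeasurable (by fun_prop)
    (aemeasurable_pi_lambda _ hWm)] at h1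
  have h2 : ∀ i, μ.map (W (some (Sum.inl i))) = μ.map fun ω => φ (X ω) :=
    fun i => ((hXs i).comp hφ).map_eq
  have h3 : ∀ j, μ.map (W (some (Sum.inr j))) = μ.map fun ω => φ (Z ω) :=
    fun j => ((hZs j).comp hφ).map_eq
  simp only [h2, h3] at h1
  exact h1

end SampleLaw

/-! ### Consequences of the assumptions on the densities -/

section Densities

variable {m : ℕ} {ν₀ ν₁ : Measure (Euc m)} {f₀ f₁ : Euc m → ℝ}

theorem ae_le_of_continuousOn_support [IsFiniteMeasure ν₀] (hf₀ : Measurable f₀)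
    (hν₀ : ν₀ = volume.withDensity fun y => ENNReal.ofReal (f₀ y))
    (hcompact : IsCompact ν₀.support) (hcont : ContinuousOn f₀ ν₀.support) :
    ∃ C : ℝ, 0 < C ∧ ∀ᵐ y ∂(volume : Measure (Euc m)), f₀ y ≤ C := by
  obtain ⟨C, hC⟩ := hcompact.bddAbove_image hcont
  refine ⟨max C 1, by positivity, ?_⟩
  have h0 : ν₀ ν₀.supportᶜ = 0 := Measure.measure_compl_support
  rw [hν₀, withDensity_apply_eq_zero hf₀.ennreal_ofReal, ← hν₀] at h0
  filter_upwards [measure_eq_zero_iff_ae_notMem.1 h0] with y hy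
  by_cases hS : y ∈ ν₀.support
  · exact (hC (mem_image_of_mem _ hS)).trans (le_max_left _ _)
  · have : ENNReal.ofReal (f₀ y) = 0 := by
      by_contra hne
      exact hy ⟨hne, hS⟩
    exact (ENNReal.ofReal_eq_zero.1 this).trans (by positivity)

/-- Where f₀ > 0 the bound on the ratio is multiplied out. The set f₀ = 0 is ν₀-null, hence ν₁-null,
so f₁ vanishes almost everywhere on it and the value of the quotient there is irrelevant. -/
theorem ae_le_mul_of_ratio_le (hf₀ : Measurable f₀) (hf₁ : Measurable f₁)
    (hν₀ : ν₀ = volume.withDensity fun y => ENNReal.ofReal (f₀ y))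
    (hν₁ : ν₁ = volume.withDensity fun y => ENNReal.ofReal (f₁ y)) (hac : ν₁ ≪ ν₀)
    (h₀ : ∀ y, 0 ≤ f₀ y) {C : ℝ} (hC : ∀ᵐ y ∂ν₀, f₁ y / f₀ y ≤ C) :
    ∀ᵐ y ∂(volume : Measure (Euc m)), f₁ y ≤ C * f₀ y := by
  rw [hν₀, ae_withDensity_iff hf₀.ennreal_ofReal] at hC
  have hz : ν₀ {y | f₀ y = 0} = 0 := by
    rw [hν₀, withDensity_apply_eq_zero hf₀.ennreal_ofReal]
    refine measure_mono_null (fun y hy => hy.1 ?_) measure_empty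
    have : f₀ y = 0 := hy.2
    simp [this]
  have hz1 := hac hz
  rw [hν₁, withDensity_apply_eq_zero hf₁.ennreal_ofReal] at hz1
  filter_upwards [hC, measure_eq_zero_iff_ae_notMem.1 hz1] with y hy hy'
  rcases (h₀ y).eq_or_lt with h | h
  · rw [← h, mul_zero]
    by_contra hcon
    exact hy' ⟨by simpa using not_le.1 hcon, h.symm⟩
  · have := hy (by simpa using h)
    rwa [div_le_iff₀ h] at this

theorem le_smul_of_ae_le {C : ℝ} (hC : 0 ≤ C) (hf₀ : Measurable f₀)
    (hν₀ : ν₀ = volume.withDensity fun y => ENNReal.ofReal (f₀ y))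
    (hν₁ : ν₁ = volume.withDensity fun y => ENNReal.ofReal (f₁ y))
    (h : ∀ᵐ y ∂(volume : Measure (Euc m)), f₁ y ≤ C * f₀ y) : ν₁ ≤ ENNReal.ofReal C • ν₀ := by
  rw [hν₀, hν₁, ← withDensity_smul _ hf₀.ennreal_ofReal]
  refine withDensity_mono ?_
  filter_upwards [h] with y hy
  rw [Pi.smul_apply, smul_eq_mul, ← ENNReal.ofReal_mul hC]
  exact ENNReal.ofReal_le_ofReal hy

theorem withDensity_le_smul_volume {C : ℝ}
    (hν₀ : ν₀ = volume.withDensity fun y => ENNReal.ofReal (f₀ y))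
    (h : ∀ᵐ y ∂(volume : Measure (Euc m)), f₀ y ≤ C) : ν₀ ≤ ENNReal.ofReal C • volume := by
  rw [hν₀, ← withDensity_const]
  refine withDensity_mono ?_
  filter_upwards [h] with y hy
  exact ENNReal.ofReal_le_ofReal hy

theorem measureReal_le_of_le_smul {α : Type*} [MeasurableSpace α] {ρ σ : Measure α}
    {C : ℝ} (hC : 0 ≤ C) (h : ρ ≤ ENNReal.ofReal C • σ) {S : Set α} (hS : σ S ≠ ⊤) :
    ρ.real S ≤ C * σ.real S := by
  have h1 := ENNReal.toReal_mono (ENNReal.mul_ne_top ENNReal.ofReal_ne_top hS) (h S)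
  rwa [ENNReal.toReal_mul, ENNReal.toReal_ofReal hC] at h1

/-- Cover the compact support by finitely many balls of radius ρ/2 centred in it, each of positive
mass. The ball of radius ρ about any point of the support contains one of them, and ν₁-almost every
point lies in the support of ν₀. -/
theorem exists_le_measureReal_closedBall [IsFiniteMeasure ν₀] (hcompact : IsCompact ν₀.support)
    (hac : ν₁ ≪ ν₀) {ρ : ℝ} (hρ : 0 < ρ) :
    ∃ β : ℝ, 0 < β ∧ ∀ᵐ w ∂ν₁, β ≤ ν₀.real (Metric.closedBall w ρ) := by
  obtain ⟨t, hts, htf, hcov⟩ := finite_cover_balls_of_compact hcompact (half_pos hρ)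
  have hpos : ∀ c ∈ t, 0 < ν₀.real (Metric.ball c (ρ / 2)) := fun c hc =>
    ENNReal.toReal_pos ((Measure.mem_support_iff_forall c).1 (hts hc) _
      (Metric.ball_mem_nhds c (half_pos hρ))).ne' (measure_ne_top _ _)
  obtain ⟨β, hβ0, hβ⟩ : ∃ β : ℝ, 0 < β ∧ ∀ c ∈ t, β ≤ ν₀.real (Metric.ball c (ρ / 2)) := by
    rcases t.eq_empty_or_nonempty with rfl | hne
    · exact ⟨1, one_pos, by simp⟩
    · obtain ⟨c, hc, hmin⟩ := t.exists_min_image (fun c => ν₀.real (Metric.ball c (ρ / 2))) htf hne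
      exact ⟨_, hpos c hc, hmin⟩
  refine ⟨β, hβ0, ?_⟩
  have hS : ∀ᵐ w ∂ν₁, w ∈ ν₀.support := hac.ae_le Measure.support_mem_ae
  filter_upwards [hS] with w hw
  obtain ⟨c, hc, hwc⟩ := mem_iUnion₂.1 (hcov hw)
  refine (hβ c hc).trans (measureReal_mono fun v hv => ?_)
  rw [Metric.mem_ball] at hwc hv
  rw [Metric.mem_closedBall]
  linarith [dist_triangle v c w, dist_comm w c]

end Densities

/-! ### Control of large values over dyadic scales -/

theorem tsum_ofReal_exp_neg_two_pow_le :
    ∃ S : ℝ, 0 ≤ S ∧ ∀ x : ℝ, 1 ≤ x →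
      ∑' i : ℕ, ENNReal.ofReal (Real.exp (-(2 ^ i * x))) ≤ ENNReal.ofReal (S * Real.exp (-x)) := by
  have hsum : Summable fun i : ℕ => Real.exp (-(i : ℝ)) := by
    simpa [← Real.exp_nat_mul] using summable_geometric_of_lt_one (Real.exp_pos (-1)).le
      (Real.exp_lt_one_iff.2 (by norm_num : (-1 : ℝ) < 0))
  refine ⟨∑' i : ℕ, Real.exp (-(i : ℝ)), tsum_nonneg fun i => (Real.exp_pos _).le, fun x hx => ?_⟩
  rw [← tsum_mul_right, ENNReal.ofReal_tsum_of_nonneg (fun i => by positivity) (hsum.mul_right _)]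
  refine ENNReal.tsum_le_tsum fun i => ENNReal.ofReal_le_ofReal ?_
  rw [← Real.exp_add, Real.exp_le_exp]
  -- Since x ≥ 1, this gives 2^i x ≥ x + i, so e^{−x} factors out of a geometric series.
  have h1 : (i : ℝ) + 1 ≤ 2 ^ i := by exact_mod_cast Nat.lt_two_pow_self
  nlinarith [(Nat.cast_nonneg i : (0 : ℝ) ≤ i)]

/-- Take the first scale i that is not bad, so that r ≤ c i. If i = 0 the first sum suffices. If i =
k + 1, scale k is bad, and the k-th term of the second sum pays for (C·2^{k+1})^p. If all scales are
bad, the right side is infinite. -/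
theorem excess_pow_le_tsum {p : ℕ} {r C : ℝ} (hC : 0 < C) {c : ℕ → ℝ}
    {b : Set ℕ} (h : ∀ i, i ∉ b → r ≤ c i) :
    ENNReal.ofReal (max 0 (r - C) ^ p) ≤
      ∑' i : ℕ, ENNReal.ofReal (2 ^ p) * ENNReal.ofReal (max 0 (c i - C * 2 ^ i) ^ p)
      + ∑' i : ℕ, ENNReal.ofReal (2 ^ p * (2 * C) ^ p) *
        (((2 : ℝ≥0∞) ^ p) ^ i * b.indicator 1 i) := by
  classical
  by_cases hall : ∀ i, i ∈ b
  · refine le_trans ?_ le_add_self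
    have h1 : ∑' _ : ℕ, ENNReal.ofReal (2 ^ p * (2 * C) ^ p) = ⊤ :=
      ENNReal.tsum_const_eq_top_of_ne_zero (by simp; positivity)
    refine le_trans (le_of_le_of_eq le_top h1.symm) (ENNReal.tsum_le_tsum fun i => ?_)
    rw [indicator_of_mem (hall i), Pi.one_apply, mul_one]
    exact le_mul_of_one_le_right' (one_le_pow₀ (one_le_pow₀ (by norm_num)))
  push Not at hall
  have hfind := Nat.find_spec hall
  have hmin : ∀ k < Nat.find hall, k ∈ b := fun k hk => not_not.1 (Nat.find_min hall hk)
  have hle := h _ hfind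
  obtain hi | ⟨k, hk⟩ : Nat.find hall = 0 ∨ ∃ k, Nat.find hall = k + 1 := by
    rcases Nat.find hall with _ | k
    · exact Or.inl rfl
    · exact Or.inr ⟨k, rfl⟩
  · rw [hi] at hle
    refine le_trans ?_ (le_trans (ENNReal.le_tsum 0) le_self_add)
    rw [← ENNReal.ofReal_mul (by positivity)]
    apply ENNReal.ofReal_le_ofReal
    have h1 : max 0 (r - C) ^ p ≤ max 0 (c 0 - C * 2 ^ 0) ^ p := by
      gcongr; simp
    exact h1.trans (le_mul_of_one_le_left (by positivity) (one_le_pow₀ (by norm_num)))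
  · rw [hk] at hle
    have hkb : k ∈ b := hmin k (by omega)
    refine le_trans ?_ (add_le_add (ENNReal.le_tsum (k + 1)) (ENNReal.le_tsum k))
    rw [indicator_of_mem hkb, Pi.one_apply, mul_one, show (2 : ℝ≥0∞) = ENNReal.ofReal 2 by simp,
      ← ENNReal.ofReal_pow (by positivity), ← ENNReal.ofReal_pow (by positivity),
      ← ENNReal.ofReal_mul (by positivity), ← ENNReal.ofReal_mul (by positivity),
      ← ENNReal.ofReal_add (by positivity) (by positivity)]
    apply ENNReal.ofReal_le_ofReal
    set e := max 0 (c (k + 1) - C * 2 ^ (k + 1))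
    have he : c (k + 1) ≤ e + C * 2 ^ (k + 1) := by
      linarith [le_max_right 0 (c (k + 1) - C * 2 ^ (k + 1))]
    calc max 0 (r - C) ^ p ≤ (e + C * 2 ^ (k + 1)) ^ p := by
          gcongr
          exact max_le (by positivity) (by linarith)
      _ ≤ 2 ^ p * (e ^ p + (C * 2 ^ (k + 1)) ^ p) :=
          add_pow_le_two_pow_mul (le_max_left _ _) (by positivity) p
      _ = _ := by
          rw [mul_add]; congr 1
          rw [mul_assoc]; congr 1
          rw [← pow_mul, mul_comm p k, pow_mul, ← mul_pow]; congr 1; ring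

section Excess

variable {Ω : Type*} {d m p : ℕ} {SX SZ : Set (Euc d)}
  {φ : Euc d → Euc m} {M N₁ : ℕ → ℕ} {X Z : Ω → Euc d} {Xs Zs : ℕ → Ω → Euc d}

/-- The density ratio estimator at the random point, as a function of the outcome. -/
noncomputable def ratioAt (SZ : Set (Euc d)) (M : ℕ → ℕ) (φhat : Estimator d m N₁)
    (X : Ω → Euc d) (Xs Zs : ℕ → Ω → Euc d) (n : ℕ) (ω : Ω) : ℝ :=
  ratioEstimator SZ (M n) (φhat n (fun i => Xs i ω) (fun j => Zs j ω) (X ω))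
    (fun i : Fin n => Xs i ω) (fun j : Fin (N₁ n) => Zs j ω) (X ω)

theorem ratioAt_nonneg {φhat : Estimator d m N₁} (n : ℕ) (ω : Ω) :
    0 ≤ ratioAt SZ M φhat X Xs Zs n ω :=
  mul_nonneg (by positivity) (div_nonneg (hits_nonneg _ _) (by positivity))

/-- The excess of the density ratio estimator over a constant vanishes in `Lᵖ`. -/
theorem exists_excess_majorant [MeasurableSpace Ω] {μ : Measure Ω} [IsProbabilityMeasure μ]
    (hm : 0 < m) (hp : 0 < p)
    (hX : Measurable X)
    (hZ : Measurable Z) (hXs : ∀ i, IdentDistrib (Xs i) X μ μ)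
    (hZs : ∀ j, IdentDistrib (Zs j) Z μ μ) (hindep : iIndepFun (twoSampleFamily X Xs Zs) μ)
    (hφ : Measurable φ) (hsub : SZ ⊆ SX) (hXmem : ∀ᵐ ω ∂μ, X ω ∈ SX)
    (hXsmem : ∀ᵐ ω ∂μ, ∀ i, Xs i ω ∈ SX) (hZsmem : ∀ᵐ ω ∂μ, ∀ j, Zs j ω ∈ SZ)
    (hM : Tendsto M atTop atTop) (hMn : Tendsto (fun n : ℕ => (M n : ℝ) / n) atTop (𝓝 0))
    (hB : Tendsto (fun n : ℕ => (M n : ℝ) * N₁ n / n) atTop atTop)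
    {C C₁ : ℝ} (hC : 0 ≤ C) (hC₁ : 0 ≤ C₁)
    (hν : ∀ S, (μ.map fun ω => φ (Z ω)).real S ≤ C * (μ.map fun ω => φ (X ω)).real S)
    (hvol : (μ.map fun ω => φ (Z ω)) ≤ ENNReal.ofReal C₁ • volume)
    {φhat : Estimator d m N₁}
    (hbad : Tendsto (fun n : ℕ => ∑' i : ℕ, ((2 : ℝ≥0∞) ^ p) ^ i *
      μ (badEvent SX φ φhat X Xs Zs (1 / 32) n (rootRadius m (2 ^ i * (M n / n))))) atTop (𝓝 0)) :
    ∃ A : ℝ, 0 < A ∧ ∃ H : ℕ → Ω → ℝ≥0∞, (∀ n, AEMeasurable (H n) μ) ∧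
      Tendsto (fun n => ∫⁻ ω, H n ω ∂μ) atTop (𝓝 0) ∧
      ∀ᶠ n in atTop, ∀ᵐ ω ∂μ,
        ENNReal.ofReal (max 0 (ratioAt SZ M φhat X Xs Zs n ω - A) ^ p) ≤ H n ω := by
  obtain ⟨es, hes⟩ := exists_cone_net m
  obtain ⟨K, hK0, hK⟩ := lintegral_crudeCount_excess_le hp es hC
  obtain ⟨S, hS0, hS⟩ := tsum_ofReal_exp_neg_two_pow_le
  set ν₀ := μ.map fun ω => φ (X ω) with hν₀
  set ν₁ := μ.map fun ω => φ (Z ω) with hν₁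
  have : IsProbabilityMeasure ν₀ := Measure.isProbabilityMeasure_map (hφ.comp hX).aemeasurable
  have : IsProbabilityMeasure ν₁ := Measure.isProbabilityMeasure_map (hφ.comp hZ).aemeasurable
  -- The volume of the ball of radius u_i is V·2^i M/n, so its ν₁-mass is at most D·2^i M/n; the
  -- scale parameter of the crude bound is c = 2^i.
  set D : ℝ := C₁ * unitBallVolume m
  have hD : 0 ≤ D := mul_nonneg hC₁ (unitBallVolume_pos m).le
  set A : ℝ := (2 * D + 1) + es.card * (4 * C + 1) with hA
  have hA0 : 0 < A := by positivity
  set u : ℕ → ℕ → ℝ := fun n i => rootRadius m (2 ^ i * (M n / n)) with hu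
  set Ξ : (n : ℕ) → ℕ → Euc m × (Fin n → Euc m) × (Fin (N₁ n) → Euc m) → ℝ≥0∞ := fun n i q =>
    ENNReal.ofReal (max 0 ((n : ℝ) / N₁ n * (crudeCount es (M n) (u n i) q.1 q.2.1 q.2.2 / M n)
      - A * 2 ^ i) ^ p) with hΞ
  have hΞm : ∀ n i, Measurable (Ξ n i) := fun n i => by
    have := measurable_crudeCount (n := n) (N := N₁ n) es (M n) (u n i)
    fun_prop
  set T := fun n => sampleImage φ X Xs Zs n (N₁ n) with hT
  have hTm : ∀ n, AEMeasurable (T n) μ := fun n => aemeasurable_sampleImage hX hXs hZs hφ _ _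
  -- Bad events involve uncountably many pairs of points and may fail to be measurable; measurable
  -- hulls have the same measure.
  set b : ℕ → ℕ → Set Ω := fun n i =>
    toMeasurable μ (badEvent SX φ φhat X Xs Zs (1 / 32) n (u n i)) with hb
  have hbm : ∀ n i, MeasurableSet (b n i) := fun n i => measurableSet_toMeasurable _ _
  set a : ℝ≥0∞ := ENNReal.ofReal (2 ^ p) with ha
  set a' : ℝ≥0∞ := ENNReal.ofReal (2 ^ p * (2 * A) ^ p) with ha'
  have hm1 : ∀ n i, AEMeasurable (fun ω => a * Ξ n i (T n ω)) μ := fun n i =>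
    ((hΞm n i).comp_aemeasurable (hTm n)).const_mul _
  have hm2 : ∀ n i, Measurable
      (fun ω => a' * (((2 : ℝ≥0∞) ^ p) ^ i * (b n i).indicator (1 : Ω → ℝ≥0∞) ω)) := fun n i =>
    ((measurable_one.indicator (hbm n i)).const_mul _).const_mul _
  refine ⟨A, hA0, fun n ω => ∑' i : ℕ, a * Ξ n i (T n ω)
    + ∑' i : ℕ, a' * (((2 : ℝ≥0∞) ^ p) ^ i * (b n i).indicator (1 : Ω → ℝ≥0∞) ω), fun n => ?_,
    ?_, ?_⟩
  · exact (AEMeasurable.tsum (hm1 n)).add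
      (Measurable.tsum (hm2 n)).aemeasurable
  · have hint : ∀ n, ∫⁻ ω, (∑' i : ℕ, a * Ξ n i (T n ω)
        + ∑' i : ℕ, a' * (((2 : ℝ≥0∞) ^ p) ^ i * (b n i).indicator (1 : Ω → ℝ≥0∞) ω)) ∂μ
        = a * ∑' i : ℕ, ∫⁻ ω, Ξ n i (T n ω) ∂μ + a' * ∑' i : ℕ, ((2 : ℝ≥0∞) ^ p) ^ i *
          μ (badEvent SX φ φhat X Xs Zs (1 / 32) n (u n i)) := by
      intro n
      rw [lintegral_add_right _ (Measurable.tsum (hm2 n)), lintegral_tsum (hm1 n),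
        lintegral_tsum fun i => (hm2 n i).aemeasurable, ← ENNReal.tsum_mul_left,
        ← ENNReal.tsum_mul_left]
      congr 1
      · exact tsum_congr fun i => lintegral_const_mul' _ _ ENNReal.ofReal_ne_top
      · refine tsum_congr fun i => ?_
        rw [lintegral_const_mul _ ((measurable_one.indicator (hbm n i)).const_mul _),
          lintegral_const_mul _ (measurable_one.indicator (hbm n i)),
          lintegral_indicator_one (hbm n i), measure_toMeasurable]
    simp_rw [hint]
    have hlim2 : Tendsto (fun n => a' * ∑' i : ℕ, ((2 : ℝ≥0∞) ^ p) ^ i *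
        μ (badEvent SX φ φhat X Xs Zs (1 / 32) n (u n i))) atTop (𝓝 0) := by
      simpa using ENNReal.Tendsto.const_mul hbad (Or.inr ENNReal.ofReal_ne_top)
    have hMr : Tendsto (fun n => (M n : ℝ)) atTop atTop := tendsto_natCast_atTop_atTop.comp hM
    have hlim1 : Tendsto (fun n => a * ∑' i : ℕ, ∫⁻ ω, Ξ n i (T n ω) ∂μ) atTop (𝓝 0) := by
      have hbound : Tendsto (fun n : ℕ => a * (ENNReal.ofReal (K * S * Real.exp (-(1 *
          ((M n : ℝ) * N₁ n / n)))) + ENNReal.ofReal (K * S * Real.exp (-(1 / 8 * M n)))))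
          atTop (𝓝 0) := by
        have h1 := tendsto_ofReal_exp_neg one_pos hB (K * S)
        have h2 := tendsto_ofReal_exp_neg (c := 1 / 8) (by norm_num) hMr (K * S)
        simpa using ENNReal.Tendsto.const_mul (a := a) (h1.add h2) (Or.inr ENNReal.ofReal_ne_top)
      refine tendsto_of_tendsto_of_tendsto_of_le_of_le' tendsto_const_nhds hbound
        (Eventually.of_forall fun _ => zero_le) ?_
      -- Requiring M ≥ 8 makes M/8 ≥ 1, as needed to sum exp(−2^i M/8) over i.
      filter_upwards [eventually_gt_atTop 0, hM.eventually_ge_atTop 8, hB.eventually_ge_atTop 1]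
        with n hn hM8 hB1
      have hM8' : (8 : ℝ) ≤ M n := by exact_mod_cast hM8
      have hn' : (0 : ℝ) < n := by exact_mod_cast hn
      set B : ℝ := (M n : ℝ) * N₁ n / n with hBdef
      refine mul_le_mul' le_rfl ?_
      have hterm : ∀ i, ∫⁻ ω, Ξ n i (T n ω) ∂μ
          ≤ ENNReal.ofReal K * (ENNReal.ofReal (Real.exp (-(2 ^ i * B)))
            + ENNReal.ofReal (Real.exp (-(2 ^ i * (M n / 8))))) := by
        intro i
        have hx : (0 : ℝ) ≤ 2 ^ i * (M n / n) := by positivity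
        rw [← lintegral_map' (hΞm n i).aemeasurable (hTm n),
          map_sampleImage hX hXs hZs hindep hφ, lintegral_prod _ (hΞm n i).aemeasurable]
        refine (lintegral_mono (g := fun _ => ENNReal.ofReal K *
          (ENNReal.ofReal (Real.exp (-(2 ^ i * B)))
            + ENNReal.ofReal (Real.exp (-(2 ^ i * (M n / 8)))))) fun y => ?_).trans ?_
        · rw [lintegral_prod (fun q => Ξ n i (y, q))
            ((hΞm n i).comp measurable_prodMk_left).aemeasurable]
          refine (hK (M := M n) (B := B) (c := 2 ^ i) (D := D) (u := u n i) (by linarith) hB1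
            hBdef hn (one_le_pow₀ (by norm_num)) ν₀ ν₁ hν y ?_).trans ?_
          · have h1 := measureReal_le_of_le_smul hC₁ hvol
              (S := Metric.closedBall y (u n i)) measure_closedBall_lt_top.ne
            refine h1.trans_eq ?_
            have hu0 : 0 ≤ u n i := Real.rpow_nonneg hx _
            have hum : u n i ^ m = 2 ^ i * (M n / n) := rootRadius_pow hm hx
            rw [volume_real_closedBall _ hu0, hum]
            simp only [D]
            ring
          · rw [ENNReal.ofReal_mul hK0, ENNReal.ofReal_add (Real.exp_pos _).le
              (Real.exp_pos _).le, mul_div_assoc]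
        · rw [lintegral_const, measure_univ, mul_one]
      calc _ ≤ ∑' i : ℕ, ENNReal.ofReal K * (ENNReal.ofReal (Real.exp (-(2 ^ i * B)))
            + ENNReal.ofReal (Real.exp (-(2 ^ i * (M n / 8))))) := ENNReal.tsum_le_tsum hterm
        _ = ENNReal.ofReal K * (∑' i : ℕ, ENNReal.ofReal (Real.exp (-(2 ^ i * B)))
            + ∑' i : ℕ, ENNReal.ofReal (Real.exp (-(2 ^ i * (M n / 8))))) := by
            rw [ENNReal.tsum_mul_left, ENNReal.tsum_add]
        _ ≤ ENNReal.ofReal K * (ENNReal.ofReal (S * Real.exp (-B))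
            + ENNReal.ofReal (S * Real.exp (-(M n / 8)))) :=
            mul_le_mul' le_rfl (add_le_add (hS B hB1) (hS _ (by linarith)))
        _ = _ := by
            rw [mul_add, ← ENNReal.ofReal_mul hK0, ← ENNReal.ofReal_mul hK0, one_mul,
              ← mul_assoc, ← mul_assoc, show (M n : ℝ) / 8 = 1 / 8 * M n by ring]
    simpa using hlim1.add hlim2
  · filter_upwards [eventually_gt_atTop 0, hM.eventually_ge_atTop 1,
      hMn.eventually (gt_mem_nhds one_pos)] with n hn hM1 hMn1
    have hn' : (0 : ℝ) < n := by exact_mod_cast hn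
    have hM' : (0 : ℝ) < M n := by exact_mod_cast hM1
    have hMlen : M n ≤ n := by
      rw [div_lt_one hn'] at hMn1
      exact_mod_cast hMn1.le
    filter_upwards [hXmem, hXsmem, hZsmem] with ω h1 h2 h3
    refine (excess_pow_le_tsum hA0 (b := {i | ω ∈ b n i})
      (c := fun i => (n : ℝ) / N₁ n * (crudeCount es (M n) (u n i) (T n ω).1 (T n ω).2.1
        (T n ω).2.2 / M n)) fun i hi => ?_).trans (le_of_eq ?_)
    · have hclose : IncrementClose SX φ (φhat n (fun i => Xs i ω) (fun j => Zs j ω) (X ω))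
          (1 / 32) (u n i) := by
        by_contra hcon
        exact hi (subset_toMeasurable μ _ hcon)
      have hu0 : 0 < u n i := rootRadius_pos (by positivity)
      have := matchCount_le_crudeCount (SZ := SZ) (xs := fun i : Fin n => Xs i ω)
        (zs := fun j : Fin (N₁ n) => Zs j ω) hes hclose (by norm_num) le_rfl hu0 hM1 hMlen h1
        (fun i => h2 i) (fun j => hsub (h3 j))
      unfold ratioAt ratioEstimator
      gcongr
      exact this
    · congr 1

end Excess

/-! ### From convergence in probability to convergence in L^p -/

theorem tendsto_prod_measure_of_ae_tendsto {α : Type*} {β : ℕ → Type*} [MeasurableSpace α]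
    [∀ n, MeasurableSpace (β n)] {ν : Measure α} [IsProbabilityMeasure ν]
    {π : (n : ℕ) → Measure (β n)} [∀ n, IsProbabilityMeasure (π n)] {F : (n : ℕ) → Set (α × β n)}
    (hF : ∀ n, MeasurableSet (F n))
    (h : ∀ᵐ y ∂ν, Tendsto (fun n => π n (Prod.mk y ⁻¹' F n)) atTop (𝓝 0)) :
    Tendsto (fun n => (ν.prod (π n)) (F n)) atTop (𝓝 0) := by
  simp_rw [fun n => Measure.prod_apply (μ := ν) (ν := π n) (hF n)]
  have := tendsto_lintegral_of_dominated_convergence (μ := ν) (f := fun _ => 0) (fun _ => 1)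
    (fun n => measurable_measure_prodMk_left (ν := π n) (hF n))
    (fun n => Eventually.of_forall fun y => prob_le_one) (by simp) h
  simpa using this

/-- Off E the error is at most η. On E it is at most A + C plus the excess over A: the constant part
is weighted by the vanishing probability of E, and the excess vanishes in L^p. -/
theorem tendsto_lintegral_pow_of_excess {Ω : Type*} [MeasurableSpace Ω] {μ : Measure Ω}
    [IsProbabilityMeasure μ] {p : ℕ} (hp : 0 < p) {g : ℕ → Ω → ℝ} {r : Ω → ℝ} {A C : ℝ}
    (hA : 0 < A) (hC : 0 ≤ C) (hg : ∀ n ω, 0 ≤ g n ω) (hr : ∀ᵐ ω ∂μ, 0 ≤ r ω ∧ r ω ≤ C)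
    {H : ℕ → Ω → ℝ≥0∞} (hHm : ∀ n, AEMeasurable (H n) μ)
    (hH : Tendsto (fun n => ∫⁻ ω, H n ω ∂μ) atTop (𝓝 0))
    (hgH : ∀ᶠ n in atTop, ∀ᵐ ω ∂μ, ENNReal.ofReal (max 0 (g n ω - A) ^ p) ≤ H n ω)
    (hE : ∀ η : ℝ, 0 < η → ∃ E : ℕ → Set Ω, Tendsto (fun n => μ (E n)) atTop (𝓝 0) ∧
      ∀ᶠ n in atTop, ∀ᵐ ω ∂μ, ω ∉ E n → |g n ω - r ω| ≤ η) :
    Tendsto (fun n => ∫⁻ ω, ENNReal.ofReal (|g n ω - r ω| ^ p) ∂μ) atTop (𝓝 0) := by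
  refine tendsto_order.2 ⟨fun a ha => absurd ha not_lt_zero, fun e he => ?_⟩
  obtain ⟨η, hη, hηe⟩ : ∃ η : ℝ, 0 < η ∧ ENNReal.ofReal (η ^ p) < e := by
    have hlim : Tendsto (fun t : ℝ => ENNReal.ofReal (t ^ p)) (𝓝[>] 0) (𝓝 0) := by
      have hc : Continuous fun t : ℝ => ENNReal.ofReal (t ^ p) :=
        ENNReal.continuous_ofReal.comp (continuous_pow p)
      have := (hc.tendsto 0).mono_left (nhdsWithin_le_nhds (s := Ioi 0))
      simpa [hp.ne'] using this
    obtain ⟨η, h1, h2⟩ := ((hlim.eventually (gt_mem_nhds he)).and self_mem_nhdsWithin).exists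
    exact ⟨η, h2, h1⟩
  obtain ⟨E, hElim, hEle⟩ := hE η hη
  set c : ℝ≥0∞ := ENNReal.ofReal (2 ^ p * (A + C) ^ p) with hc
  set a : ℝ≥0∞ := ENNReal.ofReal (2 ^ p) with ha
  have hbound : Tendsto (fun n => ENNReal.ofReal (η ^ p) + c * μ (E n) + a * ∫⁻ ω, H n ω ∂μ) atTop
      (𝓝 (ENNReal.ofReal (η ^ p))) := by
    have h1 := ENNReal.Tendsto.const_mul (a := c) hElim (Or.inr ENNReal.ofReal_ne_top)
    have h2 := ENNReal.Tendsto.const_mul (a := a) hH (Or.inr ENNReal.ofReal_ne_top)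
    simpa using (h1.const_add (ENNReal.ofReal (η ^ p))).add h2
  filter_upwards [hgH, hEle, hbound.eventually (gt_mem_nhds hηe)] with n hn1 hn2 hn3
  refine lt_of_le_of_lt ?_ hn3
  have hEm := measurableSet_toMeasurable μ (E n)
  calc ∫⁻ ω, ENNReal.ofReal (|g n ω - r ω| ^ p) ∂μ
      ≤ ∫⁻ ω, (ENNReal.ofReal (η ^ p) + c * (toMeasurable μ (E n)).indicator 1 ω
          + a * H n ω) ∂μ := by
        refine lintegral_mono_ae ?_
        filter_upwards [hn1, hn2, hr] with ω h1 h2 h3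
        by_cases hω : ω ∈ toMeasurable μ (E n)
        · rw [indicator_of_mem hω, Pi.one_apply, mul_one, add_assoc]
          refine le_trans ?_ le_add_self
          refine le_trans ?_ (add_le_add le_rfl (mul_le_mul' le_rfl h1))
          rw [hc, ha, ← ENNReal.ofReal_mul (by positivity),
            ← ENNReal.ofReal_add (by positivity) (by positivity), ← mul_add]
          apply ENNReal.ofReal_le_ofReal
          have h4 : |g n ω - r ω| ≤ (A + C) + max 0 (g n ω - A) := by
            have h5 := le_max_left 0 (g n ω - A)
            have h6 := le_max_right 0 (g n ω - A)
            have h7 := hg n ω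
            rw [abs_le]
            constructor <;> linarith
          exact (pow_le_pow_left₀ (abs_nonneg _) h4 p).trans
            (add_pow_le_two_pow_mul (by positivity) (le_max_left _ _) p)
        · have h4 := h2 fun h => hω (subset_toMeasurable μ _ h)
          rw [add_assoc]
          exact le_trans (ENNReal.ofReal_le_ofReal (pow_le_pow_left₀ (abs_nonneg _) h4 p))
            le_self_add
    _ = _ := by
        have hm1 : Measurable fun ω => (toMeasurable μ (E n)).indicator (1 : Ω → ℝ≥0∞) ω :=
          measurable_one.indicator hEm
        rw [lintegral_add_left ((hm1.const_mul _).const_add _),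
          lintegral_add_left measurable_const, lintegral_const_mul _ hm1,
          lintegral_const_mul'' _ (hHm n), lintegral_const, measure_univ, mul_one,
          lintegral_indicator_one hEm, measure_toMeasurable]

section Deviation

variable {Ω : Type*} [MeasurableSpace Ω] {μ : Measure Ω} [IsProbabilityMeasure μ] {d m p : ℕ}
  {SX SZ : Set (Euc d)} {φ : Euc d → Euc m} {M N₁ : ℕ → ℕ} {X Z : Ω → Euc d}
  {Xs Zs : ℕ → Ω → Euc d} {f₀ f₁ : Euc m → ℝ}

theorem tendsto_measure_sampleImage (hX : Measurable X)
    (hXs : ∀ i, IdentDistrib (Xs i) X μ μ) (hZ : Measurable Z)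
    (hZs : ∀ j, IdentDistrib (Zs j) Z μ μ) (hindep : iIndepFun (twoSampleFamily X Xs Zs) μ)
    (hφ : Measurable φ) {F : (n : ℕ) → Set (Euc m × (Fin n → Euc m) × (Fin (N₁ n) → Euc m))}
    (hF : ∀ n, MeasurableSet (F n))
    (h : ∀ᵐ y ∂(μ.map fun ω => φ (X ω)), Tendsto (fun n =>
      ((Measure.pi fun _ : Fin n => μ.map fun ω => φ (X ω)).prod
        (Measure.pi fun _ : Fin (N₁ n) => μ.map fun ω => φ (Z ω))) (Prod.mk y ⁻¹' F n))
      atTop (𝓝 0)) :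
    Tendsto (fun n => μ {ω | sampleImage φ X Xs Zs n (N₁ n) ω ∈ F n}) atTop (𝓝 0) := by
  have : IsProbabilityMeasure (μ.map fun ω => φ (X ω)) :=
    Measure.isProbabilityMeasure_map (hφ.comp hX).aemeasurable
  have : IsProbabilityMeasure (μ.map fun ω => φ (Z ω)) :=
    Measure.isProbabilityMeasure_map (hφ.comp hZ).aemeasurable
  refine (tendsto_prod_measure_of_ae_tendsto hF h).congr fun n => ?_
  rw [← map_sampleImage hX hXs hZs hindep hφ, Measure.map_apply_of_aemeasurable
    (aemeasurable_sampleImage hX hXs hZs hφ _ _) (hF n)]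
  rfl

/-- Off an event of vanishing probability the density ratio estimator is close to the density
ratio. -/
theorem exists_deviation_event (hm : 0 < m) (hX : Measurable X)
    (hZ : Measurable Z) (hXs : ∀ i, IdentDistrib (Xs i) X μ μ)
    (hZs : ∀ j, IdentDistrib (Zs j) Z μ μ) (hindep : iIndepFun (twoSampleFamily X Xs Zs) μ)
    (hφ : Measurable φ) (hsub : SZ ⊆ SX) (hXmem : ∀ᵐ ω ∂μ, X ω ∈ SX)
    (hXsmem : ∀ᵐ ω ∂μ, ∀ i, Xs i ω ∈ SX) (hZsmem : ∀ᵐ ω ∂μ, ∀ j, Zs j ω ∈ SZ)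
    (hf₀ : Measurable f₀) (hf₁ : Measurable f₁)
    (hf₀_nonneg : ∀ y, 0 ≤ f₀ y) (hf₁_nonneg : ∀ y, 0 ≤ f₁ y)
    (hν₀ : μ.map (fun ω => φ (X ω)) = volume.withDensity (fun y => ENNReal.ofReal (f₀ y)))
    (hν₁ : μ.map (fun ω => φ (Z ω)) = volume.withDensity (fun y => ENNReal.ofReal (f₁ y)))
    (hac : μ.map (fun ω => φ (Z ω)) ≪ μ.map (fun ω => φ (X ω)))
    (hcompact : IsCompact (μ.map (fun ω => φ (X ω))).support)
    (hM : Tendsto M atTop atTop) (hMn : Tendsto (fun n : ℕ => (M n : ℝ) / n) atTop (𝓝 0))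
    (hB : Tendsto (fun n : ℕ => (M n : ℝ) * N₁ n / n) atTop atTop)
    {C C₀ C₁ : ℝ} (hC : 0 ≤ C) (hC₁ : 0 ≤ C₁)
    (hr : ∀ᵐ ω ∂μ, f₁ (φ (X ω)) / f₀ (φ (X ω)) ≤ C)
    (hf₀C : ∀ᵐ y ∂(volume : Measure (Euc m)), f₀ y ≤ C₀)
    (hvol : (μ.map fun ω => φ (Z ω)) ≤ ENNReal.ofReal C₁ • volume)
    {φhat : Estimator d m N₁}
    (hbad : ∀ ε : ℝ, 0 < ε → Tendsto (fun n : ℕ => ∑' i : ℕ, ((2 : ℝ≥0∞) ^ p) ^ i *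
      μ (badEvent SX φ φhat X Xs Zs ε n (rootRadius m (2 ^ i * (M n / n))))) atTop (𝓝 0))
    {η : ℝ} (hη : 0 < η) :
    ∃ E : ℕ → Set Ω, Tendsto (fun n => μ (E n)) atTop (𝓝 0) ∧
      ∀ᶠ n in atTop, ∀ᵐ ω ∂μ, ω ∉ E n →
        |ratioAt SZ M φhat X Xs Zs n ω - f₁ (φ (X ω)) / f₀ (φ (X ω))| ≤ η := by
  -- The total error is δr + 3δ, at most δ(C + 3).
  set δ : ℝ := min (1 / 2) (η / (C + 3)) with hδdef
  have hδ : 0 < δ := by positivity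
  have hδ' : δ ≤ 1 / 2 := min_le_left _ _
  have hδη : δ * (C + 3) ≤ η := by
    have := min_le_right (1 / 2) (η / (C + 3))
    rwa [le_div_iff₀ (by positivity)] at this
  set V := unitBallVolume m with hVdef
  have hV : 0 < V := unitBallVolume_pos m
  -- The global bound C₀ for f₀ gives (M/n)^{1/m} ≤ κR at almost every y with the same κ. Hence ε
  -- and the bad event can be chosen independently of y.
  set κ : ℝ := max 1 (2 * (C₀ * V)) with hκ
  have hκ1 : 1 ≤ κ := le_max_left _ _
  have hκV : 2 * (C₀ * V) ≤ κ ^ m := (le_max_right _ _).trans (le_self_pow₀ hκ1 hm.ne')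
  obtain ⟨ε, θ, hε0, -, hε1, hθ0, hθ, hout, hin, hout', hin'⟩ :=
    exists_small_parameters (m := m) (κ := κ) hδ one_pos
  set ν₀ := μ.map fun ω => φ (X ω) with hν₀def
  set ν₁ := μ.map fun ω => φ (Z ω) with hν₁def
  have : IsProbabilityMeasure ν₀ := Measure.isProbabilityMeasure_map (hφ.comp hX).aemeasurable
  have : IsProbabilityMeasure ν₁ := Measure.isProbabilityMeasure_map (hφ.comp hZ).aemeasurable
  have hac₀ : ν₀ ≪ volume := by rw [hν₀]; exact withDensity_absolutelyContinuous _ _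
  have hd₀ : ∀ᵐ y ∂ν₀, HasDensityAt ν₀ (f₀ y) y :=
    hac₀.ae_le (ae_hasDensityAt hf₀ hf₀_nonneg hν₀)
  have hd₁ : ∀ᵐ y ∂ν₀, HasDensityAt ν₁ (f₁ y) y :=
    hac₀.ae_le (ae_hasDensityAt hf₁ hf₁_nonneg hν₁)
  have hpos : ∀ᵐ y ∂ν₀, 0 < f₀ y := by
    rw [hν₀, ae_withDensity_iff hf₀.ennreal_ofReal]
    exact Eventually.of_forall fun y hy => by simpa using hy
  have hle : ∀ᵐ y ∂ν₀, f₀ y ≤ C₀ := hac₀.ae_le hf₀C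
  set Fout : (n : ℕ) → Set (Euc m × (Fin n → Euc m) × (Fin (N₁ n) → Euc m)) := fun n =>
    {q | (1 + δ) * (f₁ q.1 / f₀ q.1) + 3 * δ < (n : ℝ) / N₁ n *
      (hits (outerCatch (M n) ε (rootRadius m (M n / n)) q.1 q.2.1) q.2.2 / M n)} with hFout
  set Finn : (n : ℕ) → Set (Euc m × (Fin n → Euc m) × (Fin (N₁ n) → Euc m)) := fun n =>
    {q | (n : ℝ) / N₁ n *
      (hits (innerCatch (M n) ε (rootRadius m (M n / n)) q.1 q.2.1) q.2.2 / M n) <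
      (1 - δ) * (f₁ q.1 / f₀ q.1) - 3 * δ} with hFinn
  have hFoutm : ∀ n, MeasurableSet (Fout n) := fun n => by
    have := measurable_hits_outerCatch (m := m) (n := n) (N := N₁ n) (M n) ε
      (rootRadius m (M n / n))
    exact measurableSet_lt (by fun_prop) (by fun_prop)
  have hFinm : ∀ n, MeasurableSet (Finn n) := fun n => by
    have := measurable_hits_innerCatch (m := m) (n := n) (N := N₁ n) (M n) ε
      (rootRadius m (M n / n))
    exact measurableSet_lt (by fun_prop) (by fun_prop)
  have hκm : ∀ y, f₀ y ≤ C₀ → f₀ y * V ≤ κ ^ m * (1 - δ) := fun y hy => by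
    have h1 : f₀ y * V ≤ C₀ * V := by gcongr
    have h2 : 0 ≤ κ ^ m := by positivity
    nlinarith
  have hlout : Tendsto (fun n => μ {ω | sampleImage φ X Xs Zs n (N₁ n) ω ∈ Fout n}) atTop
      (𝓝 0) := by
    refine tendsto_measure_sampleImage hX hXs hZ hZs hindep hφ hFoutm ?_
    filter_upwards [hd₀, hd₁, hpos, hle] with y h1 h2 h3 h4
    have h5 : f₀ y * V ≤ κ ^ m * (1 + δ) :=
      (hκm y h4).trans (by gcongr; linarith)
    exact tendsto_measure_outerCatch hm hM hMn hB hC₁ hvol h3 (hf₁_nonneg y) h1 h2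
      (fun ρ hρ => exists_le_measureReal_closedBall hcompact hac hρ) hδ hδ' hε0.le
      (by positivity) hθ0 hθ h5 hout hout'
  have hlin : Tendsto (fun n => μ {ω | sampleImage φ X Xs Zs n (N₁ n) ω ∈ Finn n}) atTop
      (𝓝 0) := by
    refine tendsto_measure_sampleImage hX hXs hZ hZs hindep hφ hFinm ?_
    filter_upwards [hd₀, hd₁, hpos, hle] with y h1 h2 h3 h4
    exact tendsto_measure_innerCatch hm hM hMn hB h3 (hf₁_nonneg y) h1 h2 hδ hδ' hε0.le
      (by positivity) hθ0 (hκm y h4) hε1 hin hin'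
  have hlbad : Tendsto (fun n => μ (badEvent SX φ φhat X Xs Zs ε n (rootRadius m (M n / n))))
      atTop (𝓝 0) := by
    refine tendsto_of_tendsto_of_tendsto_of_le_of_le tendsto_const_nhds (hbad ε hε0)
      (fun _ => zero_le) fun n => ?_
    refine le_trans (le_of_eq ?_) (ENNReal.le_tsum 0)
    simp
  refine ⟨fun n => badEvent SX φ φhat X Xs Zs ε n (rootRadius m (M n / n)) ∪
    ({ω | sampleImage φ X Xs Zs n (N₁ n) ω ∈ Fout n} ∪
      {ω | sampleImage φ X Xs Zs n (N₁ n) ω ∈ Finn n}), ?_, ?_⟩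
  · refine tendsto_of_tendsto_of_tendsto_of_le_of_le tendsto_const_nhds
      (by simpa using hlbad.add (hlout.add hlin)) (fun _ => zero_le) fun n => ?_
    exact (measure_union_le _ _).trans (add_le_add le_rfl (measure_union_le _ _))
  · filter_upwards [eventually_gt_atTop 0, hM.eventually_ge_atTop 1,
      hMn.eventually (gt_mem_nhds one_pos)] with n hn hM1 hMn1
    have hn' : (0 : ℝ) < n := by exact_mod_cast hn
    have hMlen : M n ≤ n := by
      rw [div_lt_one hn'] at hMn1
      exact_mod_cast hMn1.le
    filter_upwards [hXmem, hXsmem, hZsmem, hr] with ω h1 h2 h3 h4 hω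
    have hclose : IncrementClose SX φ (φhat n (fun i => Xs i ω) (fun j => Zs j ω) (X ω))
        ε (rootRadius m (M n / n)) := by
      by_contra hcon
      exact hω (Or.inl hcon)
    have ho : (n : ℝ) / N₁ n * (hits (outerCatch (M n) ε (rootRadius m (M n / n)) (φ (X ω))
        fun i : Fin n => φ (Xs i ω)) (fun j : Fin (N₁ n) => φ (Zs j ω)) / M n)
        ≤ (1 + δ) * (f₁ (φ (X ω)) / f₀ (φ (X ω))) + 3 * δ := by
      by_contra! hcon
      exact hω (Or.inr (Or.inl hcon))
    have hi : (1 - δ) * (f₁ (φ (X ω)) / f₀ (φ (X ω))) - 3 * δ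
        ≤ (n : ℝ) / N₁ n * (hits (innerCatch (M n) ε (rootRadius m (M n / n)) (φ (X ω))
        fun i : Fin n => φ (Xs i ω)) (fun j : Fin (N₁ n) => φ (Zs j ω)) / M n) := by
      by_contra! hcon
      exact hω (Or.inr (Or.inr hcon))
    have hco := matchCount_le_outerCatch (SZ := SZ) (xs := fun i : Fin n => Xs i ω)
      (zs := fun j : Fin (N₁ n) => Zs j ω) hclose hM1 hMlen h1 (fun i => h2 i)
      (fun j => hsub (h3 j))
    have hci := innerCatch_le_matchCount (SZ := SZ) (xs := fun i : Fin n => Xs i ω)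
      (zs := fun j : Fin (N₁ n) => Zs j ω) hclose hM1 hMlen h1 (fun i => h2 i)
      (fun j => hsub (h3 j)) (fun j => h3 j)
    have hup : ratioAt SZ M φhat X Xs Zs n ω
        ≤ (1 + δ) * (f₁ (φ (X ω)) / f₀ (φ (X ω))) + 3 * δ := by
      refine le_trans ?_ ho
      unfold ratioAt ratioEstimator
      gcongr
    have hlow : (1 - δ) * (f₁ (φ (X ω)) / f₀ (φ (X ω))) - 3 * δ
        ≤ ratioAt SZ M φhat X Xs Zs n ω := by
      refine hi.trans ?_
      unfold ratioAt ratioEstimator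
      gcongr
    have hδC : δ * (f₁ (φ (X ω)) / f₀ (φ (X ω))) ≤ δ * C := by gcongr
    rw [abs_le]
    constructor <;> linarith

end Deviation

/-! ### Assembly of the main theorem -/

theorem ae_mem_support_map {Ω : Type*} [MeasurableSpace Ω] {μ : Measure Ω} {d : ℕ}
    {X Y : Ω → Euc d} (h : IdentDistrib Y X μ μ) : ∀ᵐ ω ∂μ, Y ω ∈ (μ.map X).support := by
  rw [← h.map_eq]
  exact ae_of_ae_map h.aemeasurable_fst Measure.support_mem_ae

theorem tendsto_div_of_tendsto_mul_log_div {M : ℕ → ℕ}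
    (h : Tendsto (fun n : ℕ => (M n : ℝ) * Real.log n / n) atTop (𝓝 0)) :
    Tendsto (fun n : ℕ => (M n : ℝ) / n) atTop (𝓝 0) := by
  have hlog : ∀ᶠ n : ℕ in atTop, (1 : ℝ) ≤ Real.log n :=
    (Real.tendsto_log_atTop.comp tendsto_natCast_atTop_atTop).eventually_ge_atTop 1
  refine tendsto_of_tendsto_of_tendsto_of_le_of_le' tendsto_const_nhds h
    (Eventually.of_forall fun n => by positivity) ?_
  filter_upwards [hlog] with n hn
  gcongr
  exact le_mul_of_one_le_right (by positivity) hn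

theorem mainTheorem6
    {Ω : Type*} [MeasurableSpace Ω] (μ : Measure Ω) [IsProbabilityMeasure μ]
    (d m : ℕ) (hm : 0 < m)
    -- the random vectors, their supports, and the two independent samples
    (X Z : Ω → Euc d) (hX : Measurable X) (hZ : Measurable Z)
    (SX SZ : Set (Euc d)) (hSX : SX = (μ.map X).support) (hSZ : SZ = (μ.map Z).support)
    (hsub : SZ ⊆ SX)
    (Xs Zs : ℕ → Ω → Euc d)
    (hXs : ∀ i, IdentDistrib (Xs i) X μ μ) (hZs : ∀ j, IdentDistrib (Zs j) Z μ μ)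
    (hindep : iIndepFun (twoSampleFamily X Xs Zs) μ)
    -- the map `φ`, and the densities of `φ(X)` and `φ(Z)`
    (φ : Euc d → Euc m) (hφ : Measurable φ)
    (f₀ f₁ : Euc m → ℝ) (hf₀ : Measurable f₀) (hf₁ : Measurable f₁)
    (hf₀_nonneg : ∀ y, 0 ≤ f₀ y) (hf₁_nonneg : ∀ y, 0 ≤ f₁ y)
    (hν₀ : μ.map (fun ω => φ (X ω)) = volume.withDensity (fun y => ENNReal.ofReal (f₀ y)))
    (hν₁ : μ.map (fun ω => φ (Z ω)) = volume.withDensity (fun y => ENNReal.ofReal (f₁ y)))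
    (hac : μ.map (fun ω => φ (Z ω)) ≪ μ.map (fun ω => φ (X ω)))
    -- sample sizes `N₀ = n`, `N₁ n`, number of matches `M n`, and the estimator of `φ`
    (M N₁ : ℕ → ℕ)
    (hMlog : Tendsto (fun n : ℕ => (M n : ℝ) * Real.log n / n) atTop (𝓝 0))
    (hMN : Tendsto (fun n : ℕ => (M n : ℝ) * (N₁ n : ℝ) / n) atTop atTop)
    (hM : Tendsto M atTop atTop)
    (φhat : Estimator d m N₁)
    (hφhat : ∀ n, Measurable
      (fun q : (Fin n → Euc d) × (Fin (N₁ n) → Euc d) × Euc d × Euc d =>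
        φhat n q.1 q.2.1 q.2.2.1 q.2.2.2))
    (p : ℕ) (hp : 0 < p) (hp_even : Even p)
    (happrox : SupNormCondition μ p SX SZ φ M N₁ φhat X Xs Zs ∨
      IncrementCondition μ p SX SZ φ M N₁ φhat X Xs Zs)
    -- regularity of the supports, of the density ratio and of the densities
    (hSX_compact : IsCompact SX)
    (hSX_area : surfaceArea SX < ⊤) (hSZ_area : surfaceArea SZ < ⊤)
    (hr : ∃ C : ℝ, ∀ x ∈ SX, f₁ (φ x) / f₀ (φ x) ≤ C)
    (hφX_compact : IsCompact (μ.map (fun ω => φ (X ω))).support)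
    (hf₀_cont : ContinuousOn f₀ (μ.map (fun ω => φ (X ω))).support)
    (hf₁_cont : ContinuousOn f₁ (μ.map (fun ω => φ (Z ω))).support) :
    Tendsto (fun n : ℕ => ∫⁻ ω, ENNReal.ofReal
        (|ratioEstimator SZ (M n)
            (φhat n (fun i => Xs i ω) (fun j => Zs j ω) (X ω))
            (fun i : Fin n => Xs i ω) (fun j : Fin (N₁ n) => Zs j ω) (X ω)
          - f₁ (φ (X ω)) / f₀ (φ (X ω))| ^ p) ∂μ)
      atTop (𝓝 0) := by

  have hXmem : ∀ᵐ ω ∂μ, X ω ∈ SX := hSX ▸ ae_mem_support_map (IdentDistrib.refl hX.aemeasurable)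
  have hXsmem : ∀ᵐ ω ∂μ, ∀ i, Xs i ω ∈ SX :=
    ae_all_iff.2 fun i => hSX ▸ ae_mem_support_map (hXs i)
  have hZsmem : ∀ᵐ ω ∂μ, ∀ j, Zs j ω ∈ SZ :=
    ae_all_iff.2 fun j => hSZ ▸ ae_mem_support_map (hZs j)
  have hMn := tendsto_div_of_tendsto_mul_log_div hMlog
  have hbad : ∀ ε : ℝ, 0 < ε → Tendsto (fun n : ℕ => ∑' i : ℕ, ((2 : ℝ≥0∞) ^ p) ^ i *
      μ (badEvent SX φ φhat X Xs Zs ε n (rootRadius m (2 ^ i * (M n / n))))) atTop (𝓝 0) :=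
    fun ε hε => happrox.elim (fun h => h.tendsto_tsum_badEvent hm hp hM hZsmem hε)
      (fun h => h.tendsto_tsum_badEvent hm hp hM hZsmem hε)
  have : IsProbabilityMeasure (μ.map fun ω => φ (X ω)) :=
    Measure.isProbabilityMeasure_map (hφ.comp hX).aemeasurable
  have : IsProbabilityMeasure (μ.map fun ω => φ (Z ω)) :=
    Measure.isProbabilityMeasure_map (hφ.comp hZ).aemeasurable
  obtain ⟨C', hC'⟩ := hr
  set C := max C' 0 with hCdef
  have hC : 0 ≤ C := le_max_right _ _
  have hrC : ∀ᵐ ω ∂μ, f₁ (φ (X ω)) / f₀ (φ (X ω)) ≤ C := by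
    filter_upwards [hXmem] with ω hω
    exact (hC' _ hω).trans (le_max_left _ _)
  have hrν : ∀ᵐ y ∂(μ.map fun ω => φ (X ω)), f₁ y / f₀ y ≤ C :=
    (ae_map_iff (hφ.comp hX).aemeasurable (measurableSet_le (hf₁.div hf₀) measurable_const)).2 hrC
  obtain ⟨C₀, hC₀, hf₀C⟩ := ae_le_of_continuousOn_support hf₀ hν₀ hφX_compact hf₀_cont
  have hf₁C := ae_le_mul_of_ratio_le hf₀ hf₁ hν₀ hν₁ hac hf₀_nonneg hrν
  have hν := le_smul_of_ae_le hC hf₀ hν₀ hν₁ hf₁C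
  have hvol : (μ.map fun ω => φ (Z ω)) ≤ ENNReal.ofReal (C * C₀) • volume := by
    refine withDensity_le_smul_volume hν₁ ?_
    filter_upwards [hf₁C, hf₀C] with y h1 h2
    exact h1.trans (by gcongr)
  obtain ⟨A, hA, H, hHm, hH, hgH⟩ := exists_excess_majorant hm hp hX hZ hXs hZs hindep hφ hsub
    hXmem hXsmem hZsmem hM hMn hMN hC (by positivity)
    (fun S => measureReal_le_of_le_smul hC hν (measure_ne_top _ S)) hvol
    (hbad (1 / 32) (by norm_num))
  refine tendsto_lintegral_pow_of_excess (g := ratioAt SZ M φhat X Xs Zs)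
    (r := fun ω => f₁ (φ (X ω)) / f₀ (φ (X ω))) hp hA hC ratioAt_nonneg ?_ hHm hH hgH
    fun η hη => exists_deviation_event hm hX hZ hXs hZs hindep hφ hsub hXmem hXsmem hZsmem
      hf₀ hf₁ hf₀_nonneg hf₁_nonneg hν₀ hν₁ hac hφX_compact hM hMn hMN hC (by positivity)
      hrC hf₀C hvol hbad hη
  filter_upwards [hrC] with ω hω
  exact ⟨div_nonneg (hf₁_nonneg _) (hf₀_nonneg _), hω⟩
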